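/- Let $n\ge 2$ be an integer and $s\in(-1,1)$. Write points of $\mathbb R^{n+1}_+=\{(x,t): x\in\mathbb R^n,\ t>0\}$ as $(x,t)$, with $|(x,t)|=\sqrt{|x|^2+t^2}$. Let $\dot W$ be the completion of the space of restrictions to $\mathbb R^{n+1}_+$ of functions in $C_c^\infty(\mathbb R^{n+1})$ under the norm $\|u\|=\big(\int_{\mathbb R^{n+1}_+}|\nabla u(x,t)|^2t^s\,dx\,dt\big)^{1/2}$; its elements are functions on $\mathbb R^{n+1}_+$ with a trace $u(\cdot,0)$ on $\mathbb R^n$. Call $u$ radial if $u(x,t)=v(|(x,t)|)$ almost everywhere for some function $v$. Let $C_{LS,r}(n,s)$ be the least $C>0$ such that $$\int_{\mathbb R^n}u(x,0)^2\ln\big(u(x,0)^2\big)\,dx\le\frac n{1-s}\ln\Big(C\int_{\mathbb R^{n+1}_+}|\nabla u|^2t^s\,dx\,dt\Big)$$ for all radial $u\in\dot W$ with $\int_{\mathbb R^n}u(x,0)^2dx=1$, and let $C_{LH,r}(n,s)$ be the least $C>0$ such that $$\int_{\mathbb R^n}\frac{u(x,0)^2}{|x|^{1-s}}\ln\Big(\frac{u(x,0)^2}{|x|^{1-s-n}}\Big)dx\le\frac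 n{1-s}\ln\Big(C\int_{\mathbb R^{n+1}_+}|\nabla u|^2t^s\,dx\,dt\Big)$$ for all radial $u\in\dot W$ with $\int_{\mathbb R^n}u(x,0)^2|x|^{-(1-s)}dx=1$. (In both cases the positive part of the integrand on the left is integrable, so that the left-hand side is well defined in $[-\infty,\infty)$; this is part of the claim.) **Theorem.** These least constants exist and equal $$C_{LS,r}(n,s)=\frac{8}{n(1-s)e}\,\frac{\Gamma\left(\frac{n+1+s}2\right)}{\Gamma\left(\frac n2\right)\Gamma\left(\frac{1+s}2\right)}\left(\frac{(1-s)\Gamma\left(\frac n2\right)}{2\pi^{\frac n2}\Gamma\left(\frac n{1-s}\right)}\right)^{\frac{1-s}n},$$ $$C_{LH,r}(n,s)=\frac{2\,\Gamma\left(\frac{n+1+s}2\right)}{\pi^{\frac{1-s}2}\Gamma\left(\frac n2+1\right)\Gamma\left(\frac{1+s}2\right)}\left(\frac{2n-1+s}{(n-1+s)^2}\right)^{1-\frac{1-s}{2n}}\left(\frac{(1-s)\Gamma\left(\frac n2\right)^2}{8\pi e}\right)^{\frac{1-s}{2n}}.$$ Moreover, with $\omega_{n-1}=2\pi^{n/2}/\Gamma(n/2)$,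 for every $\lambda>0$ the function $$u(x,t)=\lambda^{\frac n2}\left(\frac{1-s}{\Gamma\left(\frac n{1-s}\right)\omega_{n-1}}\right)^{\frac12}\exp\left(-\frac{|\lambda(x,t)|^{1-s}}2\right)$$ is radial, belongs to $\dot W$, satisfies $\int_{\mathbb R^n}u(x,0)^2dx=1$, and gives equality in the first inequality with $C=C_{LS,r}(n,s)$; and the function $$u(x,t)=\left(\frac{(n-1+s)^2}{2\pi\left(\frac{2n}{1-s}-1\right)\omega_{n-1}^2}\right)^{\frac14}\lambda^{\frac{n-1+s}2}|\lambda(x,t)|^{-\frac{n-1+s}2}\exp\left(-\frac{(n-1+s)^2}{4\left(\frac{2n}{1-s}-1\right)}\big(\ln|\lambda(x,t)|\big)^2\right)$$ is radial, belongs to $\dot W$, satisfies $\int_{\mathbb R^n}u(x,0)^2|x|^{-(1-s)}dx=1$, and gives equality in the second inequality with $C=C_{LH,r}(n,s)$. In both equality cases the integrand on the left-hand side is integrable. -/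

import Mathlib

open MeasureTheory Filter Topology

noncomputable section

namespace RadialLogTrace

/-- The Euclidean space `ℝⁿ`. Points of `ℝⁿ⁺¹` are written `(x, t)` with `x : Sp n` and `t : ℝ`. -/
abbrev Sp (n : ℕ) : Type := EuclideanSpace ℝ (Fin n)

/-- The open upper half space `{(x, t) : t > 0}` of `ℝⁿ⁺¹`. -/
def upperHalf (n : ℕ) : Set (Sp n × ℝ) := {p | 0 < p.2}

/-- The Euclidean length `|(x, t)| = √(|x|² + t²)`
(the norm that Mathlib puts on a product is the maximum norm). -/
def euclLen {n : ℕ} (p : Sp n × ℝ) : ℝ := Real.sqrt (‖p.1‖ ^ 2 + p.2 ^ 2)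

/-- The component `∇ₓ u` of the gradient. -/
def gradX {n : ℕ} (u : Sp n × ℝ → ℝ) (p : Sp n × ℝ) : Sp n :=
  gradient (fun y : Sp n => u (y, p.2)) p.1

/-- The component `∂ₜ u` of the gradient. -/
def gradT {n : ℕ} (u : Sp n × ℝ → ℝ) (p : Sp n × ℝ) : ℝ :=
  deriv (fun τ : ℝ => u (p.1, τ)) p.2

/-- Test functions: smooth compactly supported functions on the whole of `ℝⁿ⁺¹`;
only their restrictions to the closed upper half space matter below. -/
def IsTest {n : ℕ} (φ : Sp n × ℝ → ℝ) : Prop :=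
  ContDiff ℝ ((⊤ : ℕ∞) : WithTop ℕ∞) φ ∧ HasCompactSupport φ

/-- The weighted Dirichlet energy `∫ (|Gx|² + Gt²) tˢ dx dt` over the upper half space of a gradient
field `(Gx, Gt)`. -/
def energy {n : ℕ} (s : ℝ) (Gx : Sp n × ℝ → Sp n) (Gt : Sp n × ℝ → ℝ) : ℝ :=
  ∫ p in upperHalf n, (‖Gx p‖ ^ 2 + Gt p ^ 2) * p.2 ^ s

/-- `MemW s u Gx Gt f`: the function `u` on the upper half space is an element of the completion of
the test functions under the norm `(∫ |∇φ|² tˢ dx dt)^(1/2)`, its gradient is `(Gx, Gt)` and its trace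
`u(·, 0)` is `f`.

An element of the completion is given by test functions `φ k` whose gradients converge in
`L²(tˢ dx dt)`. By the weighted Hardy and the trace inequalities such a sequence also converges
locally in `L²(tˢ dx dt)`, and the restrictions `φ k (·, 0)` converge locally in `L²(ℝⁿ)`. The
limits are the gradient, the function and the trace, all determined up to null sets. -/
structure MemW {n : ℕ} (s : ℝ) (u : Sp n × ℝ → ℝ)
    (Gx : Sp n × ℝ → Sp n) (Gt : Sp n × ℝ → ℝ) (f : Sp n → ℝ) : Prop where
  aesm_u : AEStronglyMeasurable u (volume.restrict (upperHalf n))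
  aesm_gradX : AEStronglyMeasurable Gx (volume.restrict (upperHalf n))
  aesm_gradT : AEStronglyMeasurable Gt (volume.restrict (upperHalf n))
  aesm_trace : AEStronglyMeasurable f volume
  approx : ∃ φ : ℕ → Sp n × ℝ → ℝ,
    (∀ k, IsTest (φ k)) ∧
    Tendsto (fun k => ∫⁻ p in upperHalf n,
      ENNReal.ofReal ((‖Gx p - gradX (φ k) p‖ ^ 2 + (Gt p - gradT (φ k) p) ^ 2) * p.2 ^ s))
      atTop (𝓝 0) ∧
    (∀ K : Set (Sp n × ℝ), IsCompact K →
      Tendsto (fun k => ∫⁻ p in upperHalf n ∩ K,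
        ENNReal.ofReal ((u p - φ k p) ^ 2 * p.2 ^ s)) atTop (𝓝 0)) ∧
    (∀ K : Set (Sp n), IsCompact K →
      Tendsto (fun k => ∫⁻ x in K,
        ENNReal.ofReal ((f x - φ k (x, 0)) ^ 2)) atTop (𝓝 0))

/-- `u` is radial on the upper half space: `u(x, t) = v(|(x, t)|)` almost everywhere. -/
def IsRadial {n : ℕ} (u : Sp n × ℝ → ℝ) : Prop :=
  ∃ v : ℝ → ℝ, Measurable v ∧
    ∀ᵐ p ∂(volume.restrict (upperHalf n)), u p = v (euclLen p)

/-- The inequality `∫ g ≤ R` for the integral with values in `[-∞, ∞)`: the positive part of `g` has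
finite integral, and `∫ g ≤ R` unless the negative part has infinite integral
(where `∫ g = -∞`). -/
def ExtIntegralLE {n : ℕ} (g : Sp n → ℝ) (R : ℝ) : Prop :=
  (∫⁻ x, ENNReal.ofReal (g x)) < ⊤ ∧ (Integrable g → ∫ x, g x ≤ R)

/-- The integrand `f² ln(f²)`. -/
def entropyLS {n : ℕ} (f : Sp n → ℝ) (x : Sp n) : ℝ :=
  f x ^ 2 * Real.log (f x ^ 2)

/-- The density `f² / |x|^(1-s)`. -/
def densityLH {n : ℕ} (s : ℝ) (f : Sp n → ℝ) (x : Sp n) : ℝ :=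
  f x ^ 2 / ‖x‖ ^ (1 - s)

/-- The integrand `(f² / |x|^(1-s)) ln(f² / |x|^(1-s-n))`. -/
def entropyLH {n : ℕ} (s : ℝ) (f : Sp n → ℝ) (x : Sp n) : ℝ :=
  densityLH s f x * Real.log (f x ^ 2 / ‖x‖ ^ (1 - s - (n : ℝ)))

/-- The logarithmic Sobolev trace inequality with constant `C` for all radial functions. -/
def RadialLogSobolevTrace (n : ℕ) (s C : ℝ) : Prop :=
  ∀ (u : Sp n × ℝ → ℝ) (Gx : Sp n × ℝ → Sp n) (Gt : Sp n × ℝ → ℝ) (f : Sp n → ℝ),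
    MemW s u Gx Gt f → IsRadial u → (∫ x, f x ^ 2) = 1 →
      ExtIntegralLE (entropyLS f) ((n : ℝ) / (1 - s) * Real.log (C * energy s Gx Gt))

/-- The logarithmic Hardy trace inequality with constant `C` for all radial functions. -/
def RadialLogHardyTrace (n : ℕ) (s C : ℝ) : Prop :=
  ∀ (u : Sp n × ℝ → ℝ) (Gx : Sp n × ℝ → Sp n) (Gt : Sp n × ℝ → ℝ) (f : Sp n → ℝ),
    MemW s u Gx Gt f → IsRadial u → (∫ x, densityLH s f x) = 1 →
      ExtIntegralLE (entropyLH s f) ((n : ℝ) / (1 - s) * Real.log (C * energy s Gx Gt))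

/-- `u`, with its classical gradient on the upper half space and its boundary values `u(x, 0)`, is an
admissible radial function for which the logarithmic Sobolev trace inequality with constant `C` is
an equality. -/
def IsLogSobolevExtremal (n : ℕ) (s C : ℝ) (u : Sp n × ℝ → ℝ) : Prop :=
  MemW s u (gradX u) (gradT u) (fun x => u (x, 0)) ∧ IsRadial u ∧
    (∫ x : Sp n, u (x, 0) ^ 2) = 1 ∧
    Integrable (entropyLS fun x : Sp n => u (x, 0)) ∧
    (∫ x : Sp n, entropyLS (fun x => u (x, 0)) x) =
      (n : ℝ) / (1 - s) * Real.log (C * energy s (gradX u) (gradT u))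

/-- `u`, with its classical gradient on the upper half space and its boundary values `u(x, 0)`, is an
admissible radial function for which the logarithmic Hardy trace inequality with constant `C` is
an equality. -/
def IsLogHardyExtremal (n : ℕ) (s C : ℝ) (u : Sp n × ℝ → ℝ) : Prop :=
  MemW s u (gradX u) (gradT u) (fun x => u (x, 0)) ∧ IsRadial u ∧
    (∫ x : Sp n, densityLH s (fun x => u (x, 0)) x) = 1 ∧
    Integrable (entropyLH s fun x : Sp n => u (x, 0)) ∧
    (∫ x : Sp n, entropyLH s (fun x => u (x, 0)) x) =
      (n : ℝ) / (1 - s) * Real.log (C * energy s (gradX u) (gradT u))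

/-- The value of the best constant in the radial logarithmic Sobolev trace inequality. -/
def constLS (n : ℕ) (s : ℝ) : ℝ :=
  8 / ((n : ℝ) * (1 - s) * Real.exp 1) *
    (Real.Gamma (((n : ℝ) + 1 + s) / 2) /
      (Real.Gamma ((n : ℝ) / 2) * Real.Gamma ((1 + s) / 2))) *
    ((1 - s) * Real.Gamma ((n : ℝ) / 2) /
      (2 * Real.pi ^ ((n : ℝ) / 2) * Real.Gamma ((n : ℝ) / (1 - s)))) ^ ((1 - s) / (n : ℝ))

/-- The value of the best constant in the radial logarithmic Hardy trace inequality. -/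
def constLH (n : ℕ) (s : ℝ) : ℝ :=
  2 * Real.Gamma (((n : ℝ) + 1 + s) / 2) /
      (Real.pi ^ ((1 - s) / 2) * Real.Gamma ((n : ℝ) / 2 + 1) * Real.Gamma ((1 + s) / 2)) *
    ((2 * (n : ℝ) - 1 + s) / ((n : ℝ) - 1 + s) ^ 2) ^ (1 - (1 - s) / (2 * (n : ℝ))) *
    ((1 - s) * Real.Gamma ((n : ℝ) / 2) ^ 2 / (8 * Real.pi * Real.exp 1)) ^
      ((1 - s) / (2 * (n : ℝ)))

/-- The surface area `2 π^(n/2) / Γ(n/2)` of the unit sphere of `ℝⁿ`. -/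
def sphereArea (n : ℕ) : ℝ := 2 * Real.pi ^ ((n : ℝ) / 2) / Real.Gamma ((n : ℝ) / 2)

/-- The extremal functions of the radial logarithmic Sobolev trace inequality. -/
def extremalLS (n : ℕ) (s l : ℝ) (p : Sp n × ℝ) : ℝ :=
  l ^ ((n : ℝ) / 2) *
    Real.sqrt ((1 - s) / (Real.Gamma ((n : ℝ) / (1 - s)) * sphereArea n)) *
    Real.exp (-((l * euclLen p) ^ (1 - s) / 2))

/-- The extremal functions of the radial logarithmic Hardy trace inequality. -/
def extremalLH (n : ℕ) (s l : ℝ) (p : Sp n × ℝ) : ℝ :=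
  (((n : ℝ) - 1 + s) ^ 2 /
      (2 * Real.pi * (2 * (n : ℝ) / (1 - s) - 1) * sphereArea n ^ 2)) ^ (1 / 4 : ℝ) *
    l ^ (((n : ℝ) - 1 + s) / 2) *
    (l * euclLen p) ^ (-(((n : ℝ) - 1 + s) / 2)) *
    Real.exp (-(((n : ℝ) - 1 + s) ^ 2 / (4 * (2 * (n : ℝ) / (1 - s) - 1)) *
      Real.log (l * euclLen p) ^ 2))

end RadialLogTrace

end

namespace RadialLogTrace

open Set

/-! ### Cumulative functions of densities on the line -/

/-! A radial function is a profile `V` of the variable `y = ln |(x,t)|`. Polar coordinates turn the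
energy into `A ∫ e^{(n-1+s)y} V'²`, with `A` the `tˢ`-area of the unit half sphere. Integrals over
the boundary become integrals against `ω e^{ny} dy`, with `ω` the area of the unit sphere of `ℝⁿ`.
Both theorems thereby reduce to sharp inequalities on the line, which are proved by mass transport.

Logarithmic Sobolev: let `P = ω V² e^{Ny}` be the probability density of the trace, `N = n` and `θ =
(1-s)/2`. Let `z` be the monotone map carrying `P` to the model density `p(z) = c e^{Nz}
exp(-e^{2θz})`, so that `P = p(z) z'`. Taking logarithms expresses `ln V²` through `z - y`,
`e^{2θz}` and `ln z'`. Tangent lines to the logarithm bound the terms in `z - y` and `ln z'`, the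
term `-e^{2θz}` is absorbed by completing a square with `V'`, and what is left is the derivative of
`B = κ (ω/θ) V² e^{(N-θ)y + θz}`. Since `B` vanishes at both ends, integration gives the inequality
for every scale `κ` (`logSobolev_pointwise`, `integral_le_of_calibration`, `exp_logSobolev`).
Optimizing `κ` gives `exp_logSobolev_sharp`.

Logarithmic Hardy: with `a = (n-1+s)/2` and `g = √ω e^{ay} V` the entropy becomes, up to a constant,
that of `g`, and `ω ∫ e^{2ay} V'² = ∫ g'² + a²`. The same transport argument with a Gaussian target
gives the logarithmic Sobolev inequality on the line for `g` (`line_logSobolev`). Concavity of the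
logarithm then replaces `∫ g'²` by `∫ g'² + a²` at the price of the exponent `n/(1-s)`
(`exp_logHardy_sharp`).

The passage from the completion to profiles is `MemW.exists_profile`. Along almost every ray through
the origin the approximating test functions converge together with the integrals of their
derivatives, so `u` has a locally absolutely continuous profile. Cauchy–Schwarz bounds the weighted
norm of `V'` by the energy, and vertical lines identify the trace. Conversely `memW_of_profile`
places smooth profiles in the completion by cutting off in `y`. The explicit extremals then give
equality by Gamma and Gaussian integrals, and equality forces the constants to be least. -/

/-- The cumulative function `x ↦ ∫_{-∞}^x P`. -/
noncomputable def cumul (P : ℝ → ℝ) (x : ℝ) : ℝ := ∫ y in Iic x, P y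

section cumul

variable {P : ℝ → ℝ}

lemma cumul_sub (hint : Integrable P) (x y : ℝ) :
    cumul P y - cumul P x = ∫ t in x..y, P t :=
  intervalIntegral.integral_Iic_sub_Iic hint.integrableOn hint.integrableOn

lemma hasDerivAt_cumul (hP : Continuous P) (hint : Integrable P) (x : ℝ) :
    HasDerivAt (cumul P) (P x) x := by
  have h := ((hP.integral_hasStrictDerivAt 0 x).hasDerivAt).const_add (cumul P 0)
  refine h.congr_of_eventuallyEq (Eventually.of_forall fun y => ?_)
  have := cumul_sub hint 0 y
  simp only
  linarith

lemma continuous_cumul (hP : Continuous P) (hint : Integrable P) : Continuous (cumul P) :=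
  continuous_iff_continuousAt.2 fun x => (hasDerivAt_cumul hP hint x).continuousAt

lemma cumul_nonneg (h0 : ∀ y, 0 ≤ P y) (x : ℝ) : 0 ≤ cumul P x :=
  integral_nonneg fun y => h0 y

lemma cumul_mono (h0 : ∀ y, 0 ≤ P y) (hint : Integrable P) : Monotone (cumul P) := by
  intro x y hxy
  have h := cumul_sub hint x y
  have := intervalIntegral.integral_nonneg hxy (f := P) (μ := volume) fun u _ => h0 u
  linarith

lemma cumul_add_Ioi (hint : Integrable P) (x : ℝ) :
    cumul P x + ∫ y in Ioi x, P y = ∫ y, P y := by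
  have := integral_add_compl (s := Iic x) measurableSet_Iic hint
  rwa [compl_Iic] at this

lemma cumul_le (h0 : ∀ y, 0 ≤ P y) (hint : Integrable P) (x : ℝ) : cumul P x ≤ ∫ y, P y := by
  have h := cumul_add_Ioi hint x
  have : 0 ≤ ∫ y in Ioi x, P y := integral_nonneg fun y => h0 y
  linarith

lemma tendsto_cumul_atBot : Tendsto (cumul P) atBot (𝓝 0) :=
  tendsto_integral_Iic_zero fun _ a => a

lemma tendsto_cumul_atTop (hint : Integrable P) : Tendsto (cumul P) atTop (𝓝 (∫ y, P y)) := by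
  have h : Tendsto (fun x => ∫ y in Ioi x, P y) atTop (𝓝 0) :=
    tendsto_integral_Ioi_zero fun _ a => a
  have h2 := (tendsto_const_nhds (x := ∫ y, P y)).sub h
  rw [sub_zero] at h2
  refine h2.congr fun x => ?_
  have := cumul_add_Ioi hint x
  linarith

lemma exists_cumul_eq (hP : Continuous P) (hint : Integrable P) (h1 : ∫ y, P y = 1) {q : ℝ}
    (hq : q ∈ Ioo (0 : ℝ) 1) : ∃ x, cumul P x = q := by
  have hb := tendsto_cumul_atBot (P := P)
  have ht := tendsto_cumul_atTop hint
  rw [h1] at ht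
  have := mem_range_of_exists_le_of_exists_ge (continuous_cumul hP hint)
    ((hb.eventually (gt_mem_nhds hq.1)).exists.imp fun _ h => le_of_lt h)
    ((ht.eventually (lt_mem_nhds hq.2)).exists.imp fun _ h => le_of_lt h)
  exact this

/-- If the cumulative function reached `0` or `1` at `x`, it would have an extremum there, so its
derivative `P x` would vanish. -/
lemma cumul_mem_Ioo_of_pos (hP : Continuous P) (h0 : ∀ y, 0 ≤ P y) (hint : Integrable P)
    (h1 : ∫ y, P y = 1) {x : ℝ} (hx : 0 < P x) : cumul P x ∈ Ioo (0 : ℝ) 1 := by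
  have hd := hasDerivAt_cumul hP hint x
  constructor
  · refine lt_of_le_of_ne (cumul_nonneg h0 x) fun h => hx.ne' ?_
    refine IsLocalMin.hasDerivAt_eq_zero (Eventually.of_forall fun y => ?_) hd
    rw [← h]; exact cumul_nonneg h0 y
  · refine lt_of_le_of_ne (h1 ▸ cumul_le h0 hint x) fun h => hx.ne' ?_
    refine IsLocalMax.hasDerivAt_eq_zero (Eventually.of_forall fun y => ?_) hd
    rw [h]; exact h1 ▸ cumul_le h0 hint y

end cumul

/-! ### The quantile function of a positive density -/

/-- The quantile function, the inverse of the cumulative function, on `(0, 1)`. -/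
noncomputable def quantile (p : ℝ → ℝ) (q : ℝ) : ℝ := Function.invFun (cumul p) q

/-- A continuous positive probability density on the line. -/
structure IsDensity (p : ℝ → ℝ) : Prop where
  cont : Continuous p
  pos : ∀ x, 0 < p x
  int : Integrable p
  one : ∫ x, p x = 1

namespace IsDensity

variable {p : ℝ → ℝ} (hp : IsDensity p)
include hp

lemma strictMono_cumul : StrictMono (cumul p) :=
  strictMono_of_hasDerivAt_pos (fun x => hasDerivAt_cumul hp.cont hp.int x) fun x => hp.pos x

lemma cumul_mem (x : ℝ) : cumul p x ∈ Ioo (0 : ℝ) 1 :=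
  cumul_mem_Ioo_of_pos hp.cont (fun y => (hp.pos y).le) hp.int hp.one (hp.pos x)

lemma cumul_quantile {q : ℝ} (hq : q ∈ Ioo (0 : ℝ) 1) : cumul p (quantile p q) = q :=
  Function.invFun_eq (exists_cumul_eq hp.cont hp.int hp.one hq)

lemma quantile_lt_iff {q x : ℝ} (hq : q ∈ Ioo (0 : ℝ) 1) : quantile p q < x ↔ q < cumul p x := by
  rw [← hp.strictMono_cumul.lt_iff_lt, hp.cumul_quantile hq]

lemma lt_quantile_iff {q x : ℝ} (hq : q ∈ Ioo (0 : ℝ) 1) : x < quantile p q ↔ cumul p x < q := by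
  rw [← hp.strictMono_cumul.lt_iff_lt, hp.cumul_quantile hq]

/-- Strict monotonicity of the cumulative function turns each bound on the quantile into an open
condition on `q`. -/
lemma continuousAt_quantile {q : ℝ} (hq : q ∈ Ioo (0 : ℝ) 1) : ContinuousAt (quantile p) q := by
  have hI : Ioo (0 : ℝ) 1 ∈ 𝓝 q := Ioo_mem_nhds hq.1 hq.2
  refine tendsto_order.2 ⟨fun x hx => ?_, fun x hx => ?_⟩
  · filter_upwards [hI, lt_mem_nhds ((hp.lt_quantile_iff hq).1 hx)] with r hr h
    exact (hp.lt_quantile_iff hr).2 h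
  · filter_upwards [hI, gt_mem_nhds ((hp.quantile_lt_iff hq).1 hx)] with r hr h
    exact (hp.quantile_lt_iff hr).2 h

lemma hasDerivAt_quantile {q : ℝ} (hq : q ∈ Ioo (0 : ℝ) 1) :
    HasDerivAt (quantile p) (p (quantile p q))⁻¹ q := by
  refine (hasDerivAt_cumul hp.cont hp.int _).of_local_left_inverse (hp.continuousAt_quantile hq)
    (hp.pos _).ne' ?_
  filter_upwards [Ioo_mem_nhds hq.1 hq.2] with r hr
  exact hp.cumul_quantile hr

lemma tendsto_quantile_atBot {ι : Type*} {l : Filter ι} {q : ι → ℝ}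
    (hq : ∀ᶠ i in l, q i ∈ Ioo (0 : ℝ) 1) (h : Tendsto q l (𝓝 0)) :
    Tendsto (fun i => quantile p (q i)) l atBot := by
  refine tendsto_atBot.2 fun x => ?_
  filter_upwards [hq, h.eventually (gt_mem_nhds (hp.cumul_mem x).1)] with i hi hx
  exact ((hp.quantile_lt_iff hi).2 hx).le

lemma tendsto_quantile_atTop {ι : Type*} {l : Filter ι} {q : ι → ℝ}
    (hq : ∀ᶠ i in l, q i ∈ Ioo (0 : ℝ) 1) (h : Tendsto q l (𝓝 1)) :
    Tendsto (fun i => quantile p (q i)) l atTop := by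
  refine tendsto_atTop.2 fun x => ?_
  filter_upwards [hq, h.eventually (lt_mem_nhds (hp.cumul_mem x).2)] with i hi hx
  exact ((hp.lt_quantile_iff hi).2 hx).le

/-- A Chebyshev bound: on `(-∞, z]` with `z ≤ 0` the weight is at least `K z`, so the product is at
most a tail of the convergent integral of `K p`. This kills the boundary terms of the transport
argument. -/
lemma tendsto_mul_cumul {K : ℝ → ℝ} (hK0 : ∀ x, 0 ≤ K x) (hK : AntitoneOn K (Iic 0))
    (hint : Integrable fun x => K x * p x) :
    Tendsto (fun z => K z * cumul p z) atBot (𝓝 0) := by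
  refine squeeze_zero' (Eventually.of_forall fun z => mul_nonneg (hK0 z) (hp.cumul_mem z).1.le) ?_
    (tendsto_cumul_atBot (P := fun x => K x * p x))
  filter_upwards [eventually_le_atBot (0 : ℝ)] with z hz
  rw [cumul, cumul, ← integral_const_mul]
  refine setIntegral_mono_on (hp.int.integrableOn.const_mul _) hint.integrableOn measurableSet_Iic
    fun x hx => ?_
  exact mul_le_mul_of_nonneg_right (hK (le_trans hx hz) hz hx) (hp.pos x).le

lemma tendsto_mul_one_sub_cumul {K : ℝ → ℝ} (hK0 : ∀ x, 0 ≤ K x) (hK : MonotoneOn K (Ici 0))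
    (hint : Integrable fun x => K x * p x) :
    Tendsto (fun z => K z * (1 - cumul p z)) atTop (𝓝 0) := by
  have h : Tendsto (fun x => ∫ y in Ioi x, K y * p y) atTop (𝓝 0) :=
    tendsto_integral_Ioi_zero fun _ a => a
  refine squeeze_zero' (Eventually.of_forall fun z =>
    mul_nonneg (hK0 z) (sub_nonneg.2 (hp.cumul_mem z).2.le)) ?_ h
  filter_upwards [eventually_ge_atTop (0 : ℝ)] with z hz
  have h1 := cumul_add_Ioi hp.int z
  rw [hp.one] at h1
  rw [← h1, add_sub_cancel_left, ← integral_const_mul]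
  refine setIntegral_mono_on (hp.int.integrableOn.const_mul _) hint.integrableOn measurableSet_Ioi
    fun x hx => ?_
  exact mul_le_mul_of_nonneg_right (hK hz (le_trans hz (le_of_lt hx)) (le_of_lt hx)) (hp.pos x).le

end IsDensity

/-! ### Integration of a calibrated inequality -/

/-- If `e ≤ c₁ P + c₂ D + B'` almost everywhere where the cumulative function of the probability
density `P` lies in `(0, 1)`, and `B` vanishes in the limits where it tends to `0` and `1`, then
`∫ e ≤ c₁ + c₂ ∫ D`. -/
lemma integral_le_of_calibration {P e D B : ℝ → ℝ} {c₁ c₂ : ℝ} (hP : Continuous P)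
    (h0 : ∀ y, 0 ≤ P y) (hPi : Integrable P) (h1 : ∫ y, P y = 1) (he : Integrable e)
    (heP : ∀ y, P y = 0 → e y = 0) (hD : Integrable D) (hD0 : ∀ y, 0 ≤ D y) (hc₂ : 0 ≤ c₂)
    (hB : ∀ a b, a ≤ b → 0 < cumul P a → cumul P b < 1 → AbsolutelyContinuousOnInterval B a b)
    (hpt : ∀ᵐ y, cumul P y ∈ Ioo (0 : ℝ) 1 → e y ≤ c₁ * P y + c₂ * D y + deriv B y)
    (hbot : ∀ a : ℕ → ℝ, (∀ k, cumul P (a k) ∈ Ioo (0 : ℝ) 1) →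
      Tendsto (fun k => cumul P (a k)) atTop (𝓝 0) → Tendsto (fun k => B (a k)) atTop (𝓝 0))
    (htop : ∀ a : ℕ → ℝ, (∀ k, cumul P (a k) ∈ Ioo (0 : ℝ) 1) →
      Tendsto (fun k => cumul P (a k)) atTop (𝓝 1) → Tendsto (fun k => B (a k)) atTop (𝓝 0)) :
    ∫ y, e y ≤ c₁ + c₂ * ∫ y, D y := by
  have hmono := cumul_mono h0 hPi
  -- The tails are cut at the levels `ε k` and `1 - ε k` of the cumulative function. The shift by
  -- `3` keeps `ε k < 1/2`, which orders the two cut points.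
  set ε : ℕ → ℝ := fun k => 1 / ((k : ℝ) + 3) with hε
  have hε0 : ∀ k, 0 < ε k := fun k => by positivity
  have hε2 : ∀ k, ε k < 1 / 2 := fun k => by
    refine one_div_lt_one_div_of_lt (by norm_num) ?_
    have : (0 : ℝ) ≤ k := k.cast_nonneg
    linarith
  have hεt : Tendsto ε atTop (𝓝 0) := by
    refine tendsto_const_nhds.div_atTop ?_
    exact tendsto_atTop_add_const_right _ _ tendsto_natCast_atTop_atTop
  choose a ha using fun k => exists_cumul_eq hP hPi h1 (q := ε k)
    ⟨hε0 k, (hε2 k).trans (by norm_num)⟩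
  choose b hb using fun k => exists_cumul_eq hP hPi h1 (q := 1 - ε k)
    ⟨by linarith [hε2 k], by linarith [hε0 k]⟩
  have hab : ∀ k, a k ≤ b k := fun k => by
    by_contra! h
    have := hmono h.le
    rw [ha, hb] at this
    linarith [hε2 k]
  have hBa : Tendsto (fun k => B (a k)) atTop (𝓝 0) := by
    refine hbot a (fun k => ?_) ?_
    · rw [ha]; exact ⟨hε0 k, (hε2 k).trans (by norm_num)⟩
    · simpa only [ha] using hεt
  have hBb : Tendsto (fun k => B (b k)) atTop (𝓝 0) := by
    refine htop b (fun k => ?_) ?_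
    · rw [hb]; exact ⟨by linarith [hε2 k], by linarith [hε0 k]⟩
    · simpa only [hb, sub_zero] using (tendsto_const_nhds (x := (1 : ℝ))).sub hεt
  have hlim : Tendsto (fun k => ∫ y in a k..b k, e y) atTop (𝓝 (∫ y, e y)) := by
    have h : ∀ k, ∫ y in a k..b k, e y = ∫ y, (Ioc (a k) (b k)).indicator e y := fun k => by
      rw [intervalIntegral.integral_of_le (hab k), integral_indicator measurableSet_Ioc]
    simp_rw [h]
    refine tendsto_integral_of_dominated_convergence (fun y => ‖e y‖)
      (fun k => (he.indicator measurableSet_Ioc).aestronglyMeasurable) he.norm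
      (fun k => ae_of_all _ fun y => norm_indicator_le_norm_self _ _) (ae_of_all _ fun y => ?_)
    -- A point with `P y = 0` may stay outside all the intervals, but `e` vanishes there. Where `P y
    -- > 0` the cumulative function is strictly between `0` and `1`, so the point is eventually
    -- inside.
    rcases eq_or_lt_of_le (h0 y) with hy | hy
    · simp [indicator, heP y hy.symm]
    · have hm := cumul_mem_Ioo_of_pos hP h0 hPi h1 hy
      refine tendsto_const_nhds.congr' ?_
      filter_upwards [hεt.eventually (gt_mem_nhds hm.1),
        hεt.eventually (gt_mem_nhds (sub_pos.2 hm.2))] with k h1 h2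
      rw [indicator_of_mem]
      constructor
      · by_contra! h
        have := hmono h
        rw [ha] at this; linarith
      · by_contra! h
        have := hmono h.le
        rw [hb] at this; linarith
  have hle : ∀ k, ∫ y in a k..b k, e y ≤
      c₁ * (cumul P (b k) - cumul P (a k)) + c₂ * (∫ y, D y) + (B (b k) - B (a k)) := by
    intro k
    have hBk := hB (a k) (b k) (hab k) (by rw [ha]; exact hε0 k) (by rw [hb]; linarith [hε0 k])
    have i1 : IntervalIntegrable (fun y => c₁ * P y) volume (a k) (b k) :=
      (hPi.intervalIntegrable).const_mul _
    have i2 : IntervalIntegrable (fun y => c₂ * D y) volume (a k) (b k) :=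
      (hD.intervalIntegrable).const_mul _
    have hD' : ∫ y in a k..b k, D y ≤ ∫ y, D y := by
      rw [intervalIntegral.integral_of_le (hab k)]
      exact setIntegral_le_integral hD (ae_of_all _ hD0)
    calc ∫ y in a k..b k, e y
        ≤ ∫ y in a k..b k, (c₁ * P y + c₂ * D y + deriv B y) := by
          rw [intervalIntegral.integral_of_le (hab k), intervalIntegral.integral_of_le (hab k)]
          refine setIntegral_mono_on_ae he.integrableOn
            (((i1.add i2).add hBk.intervalIntegrable_deriv).1) measurableSet_Ioc ?_
          filter_upwards [hpt] with y hy hyk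
          refine hy ⟨?_, ?_⟩
          · exact lt_of_lt_of_le (by rw [ha]; exact hε0 k) (hmono hyk.1.le)
          · exact lt_of_le_of_lt (hmono hyk.2) (by rw [hb]; linarith [hε0 k])
      _ = c₁ * (cumul P (b k) - cumul P (a k)) + c₂ * (∫ y in a k..b k, D y)
            + (B (b k) - B (a k)) := by
          rw [intervalIntegral.integral_add (i1.add i2) hBk.intervalIntegrable_deriv,
            intervalIntegral.integral_add i1 i2, intervalIntegral.integral_const_mul,
            intervalIntegral.integral_const_mul, cumul_sub hPi, hBk.integral_deriv_eq_sub]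
      _ ≤ _ := by gcongr
  have hr : Tendsto (fun k => c₁ * (cumul P (b k) - cumul P (a k)) + c₂ * (∫ y, D y)
      + (B (b k) - B (a k))) atTop (𝓝 (c₁ * ((1 - 0) - 0) + c₂ * (∫ y, D y) + (0 - 0))) := by
    simp only [ha, hb]
    exact ((((tendsto_const_nhds.sub hεt).sub hεt).const_mul c₁).add tendsto_const_nhds).add
      (hBb.sub hBa)
  have := le_of_tendsto_of_tendsto' hlim hr hle
  linarith

/-! ### Locally absolutely continuous functions -/

/-- Local absolute continuity on the line. -/
def LocAC (V : ℝ → ℝ) : Prop := ∀ a b, AbsolutelyContinuousOnInterval V a b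

namespace LocAC

variable {V U : ℝ → ℝ}

lemma of_contDiff (h : ContDiff ℝ 1 V) : LocAC V := fun _ _ =>
  h.contDiffOn.absolutelyContinuousOnInterval

lemma mul (hV : LocAC V) (hU : LocAC U) : LocAC fun x => V x * U x := fun a b =>
  (hV a b).fun_mul (hU a b)

lemma sq (hV : LocAC V) : LocAC fun x => V x ^ 2 := by
  simpa only [pow_two] using hV.mul hV

lemma continuous (hV : LocAC V) : Continuous V := by
  refine continuous_iff_continuousAt.2 fun x => ?_
  refine (hV (x - 1) (x + 1)).continuousOn.continuousAt ?_
  rw [uIcc_of_le (by linarith)]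
  exact Icc_mem_nhds (by linarith) (by linarith)

lemma ae_differentiableAt (hV : LocAC V) : ∀ᵐ x, DifferentiableAt ℝ V x := by
  have h : ∀ k : ℕ, ∀ᵐ x : ℝ, x ∈ uIcc (-(k : ℝ)) k → DifferentiableAt ℝ V x := fun k =>
    (hV _ _).ae_differentiableAt
  filter_upwards [ae_all_iff.2 h] with x hx
  obtain ⟨k, hk⟩ := exists_nat_ge |x|
  refine hx k ?_
  rw [uIcc_of_le (by linarith [abs_nonneg x])]
  exact abs_le.1 hk

lemma ae_deriv_sq (hV : LocAC V) : ∀ᵐ x, deriv (fun x => V x ^ 2) x = 2 * (V x * deriv V x) := by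
  filter_upwards [hV.ae_differentiableAt] with x hx
  have h := (hx.hasDerivAt.fun_pow 2).deriv
  rw [h]; push_cast; ring

/-- The reflected function is written as the primitive `V 0 - ∫₀ˣ V'(-t) dt`. The interval is first
enlarged to contain the base point `0`, for either order of the endpoints. -/
lemma comp_neg (hV : LocAC V) : LocAC fun x => V (-x) := by
  have h : ∀ x, V (-x) = V 0 - ∫ t in (0 : ℝ)..x, deriv V (-t) := fun x => by
    rw [intervalIntegral.integral_comp_neg (fun t => deriv V t), neg_zero,
      (hV _ _).integral_deriv_eq_sub]
    ring
  have hloc : ∀ a b, IntervalIntegrable (fun t => deriv V (-t)) volume a b := fun a b => by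
    simpa using ((hV (-a) (-b)).intervalIntegrable_deriv).comp_sub_left 0
  intro a b
  have h0 := (hloc (min a 0) (max b 0)).absolutelyContinuousOnInterval_intervalIntegral
    (c := 0) (by rw [uIcc_of_le (by simp)]; simp)
  have h1 : AbsolutelyContinuousOnInterval (fun _ : ℝ => V 0) (min a 0) (max b 0) :=
    contDiff_const.contDiffOn.absolutelyContinuousOnInterval
  have h2 := h1.sub h0
  have h3 : AbsolutelyContinuousOnInterval (fun x => V (-x)) (min a 0) (max b 0) := by
    convert! h2 using 2
    rename_i x
    exact h x
  have h0' := (hloc (min b 0) (max a 0)).absolutelyContinuousOnInterval_intervalIntegral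
    (c := 0) (by rw [uIcc_of_le (by simp)]; simp)
  have h1' : AbsolutelyContinuousOnInterval (fun _ : ℝ => V 0) (min b 0) (max a 0) :=
    contDiff_const.contDiffOn.absolutelyContinuousOnInterval
  have h3' : AbsolutelyContinuousOnInterval (fun x => V (-x)) (min b 0) (max a 0) := by
    convert! h1'.sub h0' using 2
    rename_i x
    exact h x
  rcases le_total a b with hab | hab
  · refine h3.mono ?_
    rw [uIcc_of_le hab, uIcc_of_le (by simp)]
    exact Icc_subset_Icc (min_le_left _ _) (le_max_left _ _)
  · refine h3'.mono ?_
    rw [uIcc_of_ge hab, uIcc_of_le (by simp)]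
    exact Icc_subset_Icc (min_le_left _ _) (le_max_left _ _)

end LocAC

/-! ### Decay of functions with weighted square integrable derivative. -/

/-- Otherwise `{K ≥ ε}` would contain a half line, which has infinite measure. -/
lemma frequently_lt_of_integrable {K : ℝ → ℝ} (hK : Integrable K) {ε : ℝ} (hε : 0 < ε) :
    ∃ᶠ x in atTop, K x < ε := by
  intro h
  simp only [not_lt] at h
  obtain ⟨c, hc⟩ := eventually_atTop.1 h
  have h1 := hK.measure_norm_ge_lt_top hε
  have h2 : volume (Ici c) ≤ volume {x | ε ≤ ‖K x‖} :=
    measure_mono fun x hx => (hc x hx).trans (le_abs_self _)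
  rw [Real.volume_Ici] at h2
  exact absurd h1 (not_lt.2 h2)

/-- Integrate `H'` from `y` to a far point where `H` is below `ε`. Smallness at arbitrarily large
points is enough; no limit at infinity is required. -/
lemma LocAC.le_integral_Ioi {H : ℝ → ℝ} (hH : LocAC H) {y : ℝ}
    (hint : IntegrableOn (deriv H) (Ioi y)) (hfreq : ∀ ε > 0, ∃ᶠ x in atTop, H x < ε) :
    H y ≤ ∫ x in Ioi y, |deriv H x| := by
  refine le_of_forall_pos_lt_add fun ε hε => ?_
  obtain ⟨x, hx, hxy⟩ := ((hfreq ε hε).and_eventually (eventually_ge_atTop y)).exists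
  have h1 := (hH y x).integral_deriv_eq_sub
  have h2 : |∫ t in y..x, deriv H t| ≤ ∫ t in Ioi y, |deriv H t| := by
    refine (intervalIntegral.abs_integral_le_integral_abs hxy).trans ?_
    rw [intervalIntegral.integral_of_le hxy]
    exact setIntegral_mono_set hint.abs (ae_of_all _ fun _ => abs_nonneg _)
      (Ioc_subset_Ioi_self.eventuallyLE)
  rw [h1] at h2
  linarith [(abs_le.1 h2).1]

lemma integral_abs_mul_le_sqrt {α : Type*} [MeasurableSpace α] {μ : Measure α} {f g : α → ℝ}
    (hf : MemLp f 2 μ) (hg : MemLp g 2 μ) :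
    ∫ x, |f x * g x| ∂μ ≤ √(∫ x, f x ^ 2 ∂μ) * √(∫ x, g x ^ 2 ∂μ) := by
  have h := integral_mul_le_Lp_mul_Lq_of_nonneg (μ := μ) Real.HolderConjugate.two_two
    (f := fun x => |f x|) (g := fun x => |g x|) (ae_of_all _ fun _ => abs_nonneg _)
    (ae_of_all _ fun _ => abs_nonneg _) (by simpa using hf.norm) (by simpa using hg.norm)
  simpa only [abs_mul, Real.rpow_two, sq_abs, Real.sqrt_eq_rpow] using h

lemma integrable_abs_mul {α : Type*} [MeasurableSpace α] {μ : Measure α} {f g : α → ℝ}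
    (hf : MemLp f 2 μ) (hg : MemLp g 2 μ) : Integrable (fun x => f x * g x) μ :=
  hf.integrable_mul hg

/-- The weighted tail bound
`e^{(α+β)y} V(y)² ≤ 2 (∫_y^∞ (e^{αx} V)²)^{1/2} (∫ (e^{βx} V')²)^{1/2}`. -/
lemma LocAC.exp_mul_sq_le {V : ℝ → ℝ} (hV : LocAC V) {α β : ℝ} (hα : 0 ≤ α) (hαβ : 0 ≤ α + β)
    (h1 : MemLp (fun x => Real.exp (α * x) * V x) 2)
    (h2 : MemLp (fun x => Real.exp (β * x) * deriv V x) 2) (y : ℝ) :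
    Real.exp ((α + β) * y) * V y ^ 2 ≤
      2 * (√(∫ x in Ioi y, (Real.exp (α * x) * V x) ^ 2) *
        √(∫ x, (Real.exp (β * x) * deriv V x) ^ 2)) := by
  have hd := hV.ae_deriv_sq
  have hmul := integrable_abs_mul h1 h2
  have hexp : ∀ x, Real.exp (α * x) * V x * (Real.exp (β * x) * deriv V x)
      = Real.exp ((α + β) * x) * (V x * deriv V x) := fun x => by
    rw [add_mul, Real.exp_add]; ring
  have hmul' := hmul
  simp only [hexp] at hmul'
  have hmono : ∀ x ∈ Ioi y, Real.exp ((α + β) * y) ≤ Real.exp ((α + β) * x) := fun x hx =>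
    Real.exp_le_exp.2 (mul_le_mul_of_nonneg_left (le_of_lt hx) hαβ)
  have hmeas : AEStronglyMeasurable (fun x => V x * deriv V x) volume :=
    (hV.continuous.measurable.mul (measurable_deriv V)).aestronglyMeasurable
  have hint : IntegrableOn (fun x => V x * deriv V x) (Ioi y) := by
    refine ((hmul'.norm.const_mul (Real.exp ((α + β) * y))⁻¹).integrableOn (s := Ioi y)).mono'
      hmeas.restrict ?_
    filter_upwards [ae_restrict_mem measurableSet_Ioi] with x hx
    rw [norm_mul (Real.exp _), Real.norm_of_nonneg (Real.exp_pos _).le, ← mul_assoc]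
    refine le_mul_of_one_le_left (norm_nonneg _) ?_
    rw [inv_mul_eq_div, one_le_div (Real.exp_pos _)]
    exact hmono x hx
  -- For `x ≥ 0` the weight `e^{2αx}` is at least `1`, so smallness of the weighted square passes to
  -- `V²`.
  have hfreq : ∀ ε > 0, ∃ᶠ x in atTop, V x ^ 2 < ε := fun ε hε => by
    have hi : Integrable fun x => (Real.exp (α * x) * V x) ^ 2 := h1.integrable_sq
    refine ((frequently_lt_of_integrable hi hε).and_eventually (eventually_ge_atTop 0)).mono ?_
    rintro x ⟨hx, hx0⟩
    refine lt_of_le_of_lt ?_ hx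
    rw [mul_pow]
    exact le_mul_of_one_le_left (sq_nonneg _)
      (one_le_pow₀ (Real.one_le_exp (mul_nonneg hα hx0)))
  have hle := hV.sq.le_integral_Ioi (y := y)
    ((hint.const_mul 2).congr ((ae_restrict_of_ae hd).mono fun x hx => hx.symm)) hfreq
  have hCS := integral_abs_mul_le_sqrt (h1.restrict (Ioi y)) (h2.restrict (Ioi y))
  have hsub : √(∫ x in Ioi y, (Real.exp (β * x) * deriv V x) ^ 2) ≤
      √(∫ x, (Real.exp (β * x) * deriv V x) ^ 2) :=
    Real.sqrt_le_sqrt (setIntegral_le_integral h2.integrable_sq (ae_of_all _ fun _ => sq_nonneg _))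
  -- As `α + β ≥ 0`, the weight at `y` is at most the weight at every later `x`. It can be moved
  -- under the integral and split between the two factors before Cauchy–Schwarz.
  have hcmp : Real.exp ((α + β) * y) * ∫ x in Ioi y, |deriv (fun x => V x ^ 2) x| ≤
      2 * ∫ x in Ioi y, |Real.exp (α * x) * V x * (Real.exp (β * x) * deriv V x)| := by
    rw [← integral_const_mul, ← integral_const_mul]
    refine setIntegral_mono_on_ae ?_ (hmul.abs.const_mul 2).integrableOn measurableSet_Ioi ?_
    · refine (((hint.const_mul 2).abs.const_mul (Real.exp ((α + β) * y))).congr ((ae_restrict_of_ae hd).mono fun x hx => ?_))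
      simp only [hx]
    · filter_upwards [hd] with x hx hxy
      rw [hx, hexp, abs_mul 2, abs_mul (Real.exp _), abs_two, Real.abs_exp]
      have := mul_le_mul_of_nonneg_right (hmono x hxy) (abs_nonneg (V x * deriv V x))
      linarith
  calc Real.exp ((α + β) * y) * V y ^ 2
      ≤ Real.exp ((α + β) * y) * ∫ x in Ioi y, |deriv (fun x => V x ^ 2) x| := by gcongr
    _ ≤ _ := hcmp
    _ ≤ _ := by
      refine mul_le_mul_of_nonneg_left (hCS.trans ?_) zero_le_two
      exact mul_le_mul_of_nonneg_left hsub (Real.sqrt_nonneg _)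

/-! ### Transport of densities -/

namespace IsDensity

variable {p : ℝ → ℝ} (hp : IsDensity p) {P : ℝ → ℝ} (hP : Continuous P) (hPi : Integrable P)
include hp hP hPi

/-- Differentiating "equal mass to the left" gives the one-dimensional Monge–Ampère equation `p(z)
z' = P`. -/
lemma hasDerivAt_transport {y : ℝ} (hy : cumul P y ∈ Ioo (0 : ℝ) 1) :
    HasDerivAt (fun y => quantile p (cumul P y)) (P y / p (quantile p (cumul P y))) y := by
  have h := (hp.hasDerivAt_quantile hy).comp y (hasDerivAt_cumul hP hPi y)
  convert! h using 1
  rw [div_eq_inv_mul]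

lemma contDiffOn_transport :
    ContDiffOn ℝ 1 (fun y => quantile p (cumul P y)) {y | cumul P y ∈ Ioo (0 : ℝ) 1} := by
  have hopen : IsOpen {y | cumul P y ∈ Ioo (0 : ℝ) 1} :=
    isOpen_Ioo.preimage (continuous_cumul hP hPi)
  have hd : ∀ y, cumul P y ∈ Ioo (0 : ℝ) 1 → _ := fun y hy => hp.hasDerivAt_transport hP hPi hy
  have hc : ContinuousOn (fun y => quantile p (cumul P y)) {y | cumul P y ∈ Ioo (0 : ℝ) 1} :=
    fun y hy => (hd y hy).continuousAt.continuousWithinAt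
  rw [show (1 : WithTop ℕ∞) = 0 + 1 by simp, contDiffOn_succ_iff_deriv_of_isOpen hopen]
  refine ⟨fun y hy => (hd y hy).differentiableAt.differentiableWithinAt, by simp, ?_⟩
  rw [contDiffOn_zero]
  refine ContinuousOn.congr (f := fun y => P y / p (quantile p (cumul P y))) ?_
    fun y hy => (hd y hy).deriv
  exact hP.continuousOn.div (hp.cont.comp_continuousOn hc) fun y _ => (hp.pos _).ne'

/-- The transport map is only controlled where the cumulative function is strictly between `0` and
`1`. By monotonicity the two endpoint conditions keep the whole interval in that region, where the
map is `C¹`. -/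
lemma absolutelyContinuousOnInterval_comp_transport (h0 : ∀ y, 0 ≤ P y) {a b : ℝ} (hab : a ≤ b)
    (ha : 0 < cumul P a) (hb : cumul P b < 1) {Φ : ℝ × ℝ → ℝ} (hΦ : ContDiff ℝ 1 Φ) :
    AbsolutelyContinuousOnInterval (fun y => Φ (y, quantile p (cumul P y))) a b := by
  refine ContDiffOn.absolutelyContinuousOnInterval ?_
  have hsub : uIcc a b ⊆ {y | cumul P y ∈ Ioo (0 : ℝ) 1} := by
    rw [uIcc_of_le hab]
    intro y hy
    exact ⟨ha.trans_le (cumul_mono h0 hPi hy.1), (cumul_mono h0 hPi hy.2).trans_lt hb⟩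
  exact hΦ.comp_contDiffOn (contDiffOn_id.prodMk ((hp.contDiffOn_transport hP hPi).mono hsub))

end IsDensity

/-! ### Logarithmic Sobolev inequality with an exponential weight -/

/-- The tangent line of the logarithm at `1/κ`. The free parameter becomes the scale that is
optimized at the end. -/
lemma log_le_mul_sub {κ x : ℝ} (hκ : 0 < κ) (hx : 0 < x) :
    Real.log x ≤ κ * x - 1 - Real.log κ := by
  have := Real.log_le_sub_one_of_pos (mul_pos hκ hx)
  rw [Real.log_mul hκ.ne' hx.ne'] at this
  linarith

/-- The model density of the logarithmic Sobolev inequality. -/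
noncomputable def expDensity (N θ c z : ℝ) : ℝ :=
  c * (Real.exp (N * z) * Real.exp (-Real.exp (2 * θ * z)))

/-- The calibrated pointwise inequality behind the logarithmic Sobolev inequality. -/
lemma logSobolev_pointwise {N θ c ω κ v w y z z' : ℝ} (hθ : 0 < θ) (hN : θ ≤ N) (hc : 0 < c)
    (hω : 0 < ω) (hκ : 0 < κ) (hz : ω * (v ^ 2 * Real.exp (N * y)) = expDensity N θ c z * z') :
    ω * (v ^ 2 * Real.exp (N * y)) * Real.log (v ^ 2) ≤
      (Real.log (c / ω) - N / θ * (1 + Real.log κ)) * (ω * (v ^ 2 * Real.exp (N * y))) +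
      κ ^ 2 * ω / θ ^ 2 * (Real.exp ((N / 2 - θ) * y) * w) ^ 2 +
      κ * (ω / θ) * (2 * (v * w) * (Real.exp ((N - θ) * y) * Real.exp (θ * z)) +
        v ^ 2 * ((N - θ + θ * z') * (Real.exp ((N - θ) * y) * Real.exp (θ * z)))) := by
  set R := Real.exp (N / 2 * y) with hR
  set S := Real.exp ((N / 2 - θ) * y) with hS
  set Q := Real.exp (θ * z) with hQ
  set q := Real.exp (θ * (z - y)) with hq
  have e1 : Real.exp (N * y) = R ^ 2 := by
    rw [hR, ← Real.exp_nat_mul]; congr 1; push_cast; ring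
  have e2 : Real.exp ((N - θ) * y) = R * S := by
    rw [hR, hS, ← Real.exp_add]; congr 1; ring
  have e3 : S * Q = R * q := by
    rw [hR, hS, hQ, hq, ← Real.exp_add, ← Real.exp_add]; congr 1; ring
  have e4 : Real.exp (2 * θ * z) = Q ^ 2 := by
    rw [hQ, ← Real.exp_nat_mul]; congr 1; push_cast; ring
  have hRpos : 0 < R := Real.exp_pos _
  have hqpos : 0 < q := Real.exp_pos _
  rw [e1, e2]
  rw [e1] at hz
  -- This square trades the term `-Q²` of the model density for the gradient term. It is the only
  -- loss besides the tangent lines.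
  have hsq : 0 ≤ ω * (v * R * Q + κ / θ * (S * w)) ^ 2 := by positivity
  rcases eq_or_ne v 0 with hv | hv
  · subst hv
    have : 0 ≤ κ ^ 2 * ω / θ ^ 2 * (S * w) ^ 2 := by positivity
    simpa using this
  · have hP : 0 < ω * (v ^ 2 * R ^ 2) := by positivity
    have hpz : 0 < expDensity N θ c z := by unfold expDensity; positivity
    have hz' : 0 < z' := by
      rw [hz] at hP
      exact (mul_pos_iff_of_pos_left hpz).1 hP
    have hlog : Real.log (v ^ 2) = Real.log (c / ω) + N * (z - y) - Q ^ 2 + Real.log z' := by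
      have h1 := congrArg Real.log hz
      rw [Real.log_mul hω.ne' (by positivity), Real.log_mul (by positivity) (by positivity),
        Real.log_mul hpz.ne' hz'.ne', expDensity, Real.log_mul hc.ne' (by positivity),
        Real.log_mul (by positivity) (by positivity), Real.log_exp, Real.log_exp, ← e1,
        Real.log_exp, e4] at h1
      rw [Real.log_div hc.ne' hω.ne']
      linarith
    -- The quantity `N (z - y) + ln z'` is split as `ln(q z')` plus `(N - θ)/θ` copies of `ln q`.
    -- With one `κ` for all tangent lines, the linear terms add up to `(κ q/θ)(N - θ + θ z')`, which
    -- after multiplication by `P` is the `V²` part of the derivative of the calibrating function.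
    have l1 : Real.log z' + θ * (z - y) ≤ κ * (q * z') - 1 - Real.log κ := by
      have := log_le_mul_sub hκ (mul_pos hqpos hz')
      rw [Real.log_mul hqpos.ne' hz'.ne', hq, Real.log_exp] at this
      linarith
    have l2 : θ * (z - y) ≤ κ * q - 1 - Real.log κ := by
      have := log_le_mul_sub hκ hqpos
      rwa [hq, Real.log_exp] at this
    -- The number of copies must be nonnegative; this is where `θ ≤ N` enters.
    have l3 : (N - θ) / θ * (θ * (z - y)) ≤ (N - θ) / θ * (κ * q - 1 - Real.log κ) :=
      mul_le_mul_of_nonneg_left l2 (div_nonneg (by linarith) hθ.le)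
    have l4 : (N - θ) / θ * (θ * (z - y)) = (N - θ) * (z - y) := by field_simp
    have l5 : Real.log (v ^ 2) ≤ Real.log (c / ω) - N / θ * (1 + Real.log κ) - Q ^ 2
        + κ * q / θ * (N - θ + θ * z') := by
      have : (N - θ) / θ * (κ * q - 1 - Real.log κ) + (κ * (q * z') - 1 - Real.log κ) =
          - (N / θ * (1 + Real.log κ)) + κ * q / θ * (N - θ + θ * z') := by
        field_simp; ring
      rw [hlog]; linarith
    have l6 := mul_le_mul_of_nonneg_left l5 hP.le
    refine l6.trans ?_
    have key : (Real.log (c / ω) - N / θ * (1 + Real.log κ)) * (ω * (v ^ 2 * R ^ 2)) +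
        κ ^ 2 * ω / θ ^ 2 * (S * w) ^ 2 + κ * (ω / θ) * (2 * (v * w) * (R * S * Q) +
        v ^ 2 * ((N - θ + θ * z') * (R * (S * Q)))) -
        ω * (v ^ 2 * R ^ 2) * (Real.log (c / ω) - N / θ * (1 + Real.log κ) - Q ^ 2
        + κ * q / θ * (N - θ + θ * z')) = ω * (v * R * Q + κ / θ * (S * w)) ^ 2 := by
      rw [e3]; field_simp; ring
    have e5 : R * S * Q = R * (S * Q) := by ring
    rw [e5] at key ⊢
    linarith

/-- The logarithmic Sobolev inequality on the line with weight `e^{Ny}`, in its scale-dependent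
form. -/
theorem exp_logSobolev {V : ℝ → ℝ} (hV : LocAC V) {N θ c ω κ : ℝ} (hθ : 0 < θ) (hN : θ ≤ N)
    (hc : 0 < c) (hω : 0 < ω) (hκ : 0 < κ) (hp : IsDensity (expDensity N θ c))
    (hp2 : Integrable fun z => Real.exp (2 * θ * z) * expDensity N θ c z)
    (h1 : MemLp (fun x => Real.exp (N / 2 * x) * V x) 2)
    (h2 : MemLp (fun x => Real.exp ((N / 2 - θ) * x) * deriv V x) 2)
    (hone : ω * ∫ x, (Real.exp (N / 2 * x) * V x) ^ 2 = 1)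
    (he : Integrable fun x => V x ^ 2 * Real.log (V x ^ 2) * Real.exp (N * x)) :
    ω * ∫ x, V x ^ 2 * Real.log (V x ^ 2) * Real.exp (N * x) ≤
      Real.log (c / ω) - N / θ * (1 + Real.log κ) +
      κ ^ 2 * ω / θ ^ 2 * ∫ x, (Real.exp ((N / 2 - θ) * x) * deriv V x) ^ 2 := by
  set P : ℝ → ℝ := fun y => ω * (V y ^ 2 * Real.exp (N * y)) with hPdef
  set z : ℝ → ℝ := fun y => quantile (expDensity N θ c) (cumul P y) with hz
  set D := ∫ x, (Real.exp ((N / 2 - θ) * x) * deriv V x) ^ 2 with hD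
  have hPsq : ∀ y, P y = ω * (Real.exp (N / 2 * y) * V y) ^ 2 := fun y => by
    have : Real.exp (N * y) = Real.exp (N / 2 * y) ^ 2 := by
      rw [← Real.exp_nat_mul]; congr 1; push_cast; ring
    rw [hPdef]; simp only; rw [this]; ring
  have hP : Continuous P := by
    have := hV.continuous
    fun_prop
  have h0 : ∀ y, 0 ≤ P y := fun y => by positivity
  have hPi : Integrable P := by
    simp only [funext hPsq]
    exact h1.integrable_sq.const_mul ω
  have hP1 : ∫ y, P y = 1 := by
    simp only [hPsq, integral_const_mul]; exact hone
  set Φ : ℝ × ℝ → ℝ := fun x => Real.exp ((N - θ) * x.1) * Real.exp (θ * x.2) with hΦ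
  have hΦc : ContDiff ℝ 1 Φ := by fun_prop
  set B : ℝ → ℝ := fun y => κ * (ω / θ) * (V y ^ 2 * Φ (y, z y)) with hB
  have hαβ : N / 2 + (N / 2 - θ) = N - θ := by ring
  -- The integral in the weighted tail bound is the mass of `P` to the right of `y`, which is also
  -- the mass of the model density to the right of `z y`. This link makes the boundary term
  -- controllable.
  have htail : ∀ y, Real.exp ((N - θ) * y) * V y ^ 2 ≤ 2 * (√((1 - cumul P y) / ω) * √D) := by
    intro y
    have h := hV.exp_mul_sq_le (α := N / 2) (β := N / 2 - θ) (by linarith) (by linarith) h1 h2 y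
    rw [hαβ] at h
    refine h.trans (le_of_eq ?_)
    congr 4
    have h3 := cumul_add_Ioi hPi y
    rw [hP1] at h3
    have h4 : ∫ x in Ioi y, P x = ω * ∫ x in Ioi y, (Real.exp (N / 2 * x) * V x) ^ 2 := by
      simp only [hPsq, integral_const_mul]
    rw [← h3, h4]
    field_simp; ring
  have hB0 : ∀ y, 0 ≤ B y := fun y => by
    simp only [hB, hΦ]; positivity
  have hBle : ∀ y, B y ≤ κ * (ω / θ) * (2 * (√((1 - cumul P y) / ω) * √D)) * Real.exp (θ * z y) := by
    intro y
    have := mul_le_mul_of_nonneg_right (htail y) (Real.exp_pos (θ * z y)).le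
    have h := mul_le_mul_of_nonneg_left this (show 0 ≤ κ * (ω / θ) by positivity)
    simp only [hB, hΦ]
    nlinarith [h]
  have hmain := integral_le_of_calibration (P := P)
    (e := fun y => ω * (V y ^ 2 * Real.log (V y ^ 2) * Real.exp (N * y)))
    (D := fun y => (Real.exp ((N / 2 - θ) * y) * deriv V y) ^ 2) (B := B)
    (c₁ := Real.log (c / ω) - N / θ * (1 + Real.log κ)) (c₂ := κ ^ 2 * ω / θ ^ 2)
    hP h0 hPi hP1 (he.const_mul ω) ?_ h2.integrable_sq (fun y => sq_nonneg _) (by positivity)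
    ?_ ?_ ?_ ?_
  · rwa [integral_const_mul] at hmain
  · intro y hy
    have : V y ^ 2 = 0 := by
      simpa [hPdef, hω.ne', (Real.exp_pos _).ne'] using hy
    simp [this]
  · intro a b hab ha hb
    have h3 := hp.absolutelyContinuousOnInterval_comp_transport hP hPi h0 hab ha hb hΦc
    exact ((hV.sq a b).fun_mul h3).const_mul _
  · filter_upwards [hV.ae_differentiableAt] with y hy hmem
    have hzd := hp.hasDerivAt_transport hP hPi hmem
    have hB' : HasDerivAt B (κ * (ω / θ) * (2 * (V y * deriv V y) *
        (Real.exp ((N - θ) * y) * Real.exp (θ * z y)) +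
        V y ^ 2 * ((N - θ + θ * (P y / expDensity N θ c (z y))) *
          (Real.exp ((N - θ) * y) * Real.exp (θ * z y))))) y := by
      have d1 := hy.hasDerivAt.fun_pow 2
      have d2 := ((hasDerivAt_id y).const_mul (N - θ)).exp
      have d3 := (hzd.const_mul θ).exp
      have := (d1.mul (d2.mul d3)).const_mul (κ * (ω / θ))
      convert! this using 1
      simp only [hz, Pi.mul_apply, id, Nat.cast_ofNat]; ring
    rw [hB'.deriv]
    have := logSobolev_pointwise (N := N) (θ := θ) (c := c) (ω := ω) (κ := κ) (v := V y)
      (w := deriv V y) (y := y) (z := z y) (z' := P y / expDensity N θ c (z y)) hθ hN hc hω hκ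
      (by rw [mul_div_cancel₀ _ (hp.pos _).ne'])
    refine le_trans (le_of_eq ?_) this
    ring
  · intro a ha hlim
    have hzt := hp.tendsto_quantile_atBot (Eventually.of_forall ha) hlim
    -- At the lower end the tail factor stays bounded, and `z → -∞` makes `e^{θz}` vanish.
    have he : Tendsto (fun k => Real.exp (θ * z (a k))) atTop (𝓝 0) :=
      Real.tendsto_exp_atBot.comp (hzt.const_mul_atBot hθ)
    have hs : Tendsto (fun k => κ * (ω / θ) * (2 * (√((1 - cumul P (a k)) / ω) * √D)) *
        Real.exp (θ * z (a k))) atTop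
        (𝓝 (κ * (ω / θ) * (2 * (√((1 - 0) / ω) * √D)) * 0)) := by
      refine Tendsto.mul ?_ he
      exact ((((tendsto_const_nhds.sub hlim).div_const ω).sqrt.mul_const _).const_mul _).const_mul _
    rw [mul_zero] at hs
    exact squeeze_zero (fun k => hB0 _) (fun k => hBle _) hs
  · intro a ha hlim
    have hzt := hp.tendsto_quantile_atTop (Eventually.of_forall ha) hlim
    -- At the upper end `e^{θz}` grows, but only its product with the square root of the tail mass
    -- occurs. That product vanishes because `e^{2θz}` is integrable against the model density.
    have hK := (hp.tendsto_mul_one_sub_cumul (K := fun z => Real.exp (2 * θ * z))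
      (fun x => (Real.exp_pos _).le) (fun x _ y _ hxy => Real.exp_le_exp.2 (by gcongr)) hp2).comp hzt
    have hs : Tendsto (fun k => κ * (ω / θ) * (2 * √D) * √(Real.exp (2 * θ * z (a k)) *
        (1 - cumul P (a k)) / ω)) atTop (𝓝 (κ * (ω / θ) * (2 * √D) * √(0 / ω))) := by
      refine ((hK.congr fun k => ?_).div_const ω).sqrt.const_mul _
      simp only [Function.comp, hp.cumul_quantile (ha k), hz]
    rw [zero_div, Real.sqrt_zero, mul_zero] at hs
    refine squeeze_zero (fun k => hB0 _) (fun k => (hBle _).trans (le_of_eq ?_)) hs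
    have : Real.exp (2 * θ * z (a k)) = Real.exp (θ * z (a k)) ^ 2 := by
      rw [← Real.exp_nat_mul]; congr 1; push_cast; ring
    rw [mul_div_assoc, this, Real.sqrt_mul (sq_nonneg _), Real.sqrt_sq (Real.exp_pos _).le]
    ring

/-! ### Logarithmic Sobolev inequality on the line -/

/-- The standard Gaussian density. -/
noncomputable def gaussDensity (z : ℝ) : ℝ := (√(2 * Real.pi))⁻¹ * Real.exp (-(z ^ 2 / 2))

lemma integrable_pow_mul_exp_neg_mul_sq {b : ℝ} (hb : 0 < b) (k : ℕ) :
    Integrable fun x : ℝ => x ^ k * Real.exp (-b * x ^ 2) := by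
  have := integrable_rpow_mul_exp_neg_mul_sq hb (s := k) (by
    have : (0 : ℝ) ≤ k := k.cast_nonneg
    linarith)
  simpa using this

lemma isDensity_gaussDensity : IsDensity gaussDensity where
  cont := by unfold gaussDensity; fun_prop
  pos x := by unfold gaussDensity; positivity
  int := by
    have := (integrable_exp_neg_mul_sq (b := 1 / 2) (by norm_num)).const_mul (√(2 * Real.pi))⁻¹
    refine this.congr (ae_of_all _ fun x => ?_)
    simp only [gaussDensity]; congr 2; ring
  one := by
    have h := integral_gaussian (1 / 2)
    have : ∀ x, gaussDensity x = (√(2 * Real.pi))⁻¹ * Real.exp (-(1 / 2) * x ^ 2) := fun x => by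
      simp only [gaussDensity]; congr 2; ring
    simp only [this, integral_const_mul, h]
    rw [show Real.pi / (1 / 2) = 2 * Real.pi by ring]
    exact inv_mul_cancel₀ (by positivity)

lemma integrable_sq_mul_gaussDensity : Integrable fun z => z ^ 2 * gaussDensity z := by
  have := (integrable_pow_mul_exp_neg_mul_sq (b := 1 / 2) (by norm_num) 2).const_mul
    (√(2 * Real.pi))⁻¹
  refine this.congr (ae_of_all _ fun x => ?_)
  simp only [gaussDensity]
  rw [show -(1 / 2) * x ^ 2 = -(x ^ 2 / 2) by ring]; ring

/-- With `z` the transport to the standard Gaussian, the term `-v² z²/2` is completed to `-(v z + 2κ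
w)²/2` and `ln z'` is bounded by a tangent line. The remaining terms form the derivative of `κ v²
z`. -/
lemma gauss_pointwise {κ v w z z' : ℝ} (hκ : 0 < κ) (hz : v ^ 2 = gaussDensity z * z') :
    v ^ 2 * Real.log (v ^ 2) ≤ (-(Real.log (2 * Real.pi) / 2) - 1 - Real.log κ) * v ^ 2 +
      2 * κ ^ 2 * w ^ 2 + κ * (2 * (v * w) * z + v ^ 2 * z') := by
  have hsq := sq_nonneg (v * z + 2 * κ * w)
  rcases eq_or_ne v 0 with hv | hv
  · subst hv
    have : 0 ≤ 2 * κ ^ 2 * w ^ 2 := by positivity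
    simpa using this
  · have hP : 0 < v ^ 2 := by positivity
    have hpz := isDensity_gaussDensity.pos z
    have hz' : 0 < z' := by
      rw [hz] at hP
      exact (mul_pos_iff_of_pos_left hpz).1 hP
    have hlog : Real.log (v ^ 2) = -(Real.log (2 * Real.pi) / 2) - z ^ 2 / 2 + Real.log z' := by
      rw [hz, Real.log_mul hpz.ne' hz'.ne', gaussDensity, Real.log_mul (by positivity)
        (by positivity), Real.log_inv, Real.log_sqrt (by positivity), Real.log_exp]
      ring
    have l1 := log_le_mul_sub hκ hz'
    have l2 : Real.log (v ^ 2) ≤ -(Real.log (2 * Real.pi) / 2) - z ^ 2 / 2 +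
        (κ * z' - 1 - Real.log κ) := by linarith
    have l3 := mul_le_mul_of_nonneg_left l2 hP.le
    refine l3.trans ?_
    linear_combination hsq / 2

lemma LocAC.sq_le_integral_Ioi {g : ℝ → ℝ} (hg : LocAC g) (h1 : MemLp g 2)
    (h2 : MemLp (deriv g) 2) (y : ℝ) :
    g y ^ 2 ≤ 2 * (√(∫ x in Ioi y, g x ^ 2) * √(∫ x, deriv g x ^ 2)) := by
  simpa using hg.exp_mul_sq_le (α := 0) (β := 0) le_rfl (by simp) (by simpa using h1)
    (by simpa using h2) y

lemma LocAC.sq_le_integral_Iic {g : ℝ → ℝ} (hg : LocAC g) (h1 : MemLp g 2)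
    (h2 : MemLp (deriv g) 2) (y : ℝ) :
    g y ^ 2 ≤ 2 * (√(∫ x in Iic y, g x ^ 2) * √(∫ x, deriv g x ^ 2)) := by
  have mp := Measure.measurePreserving_neg (volume : Measure ℝ)
  have hd : ∀ x, deriv (fun x => g (-x)) x = -deriv g (-x) := fun x => deriv_comp_neg g x
  have h := hg.comp_neg.sq_le_integral_Ioi (h1.comp_measurePreserving mp)
    (by
      simp only [funext hd]
      exact (h2.comp_measurePreserving mp).neg) (-y)
  simp only [hd, neg_sq, neg_neg] at h
  rwa [integral_comp_neg_Ioi (-y) (fun x => g x ^ 2), neg_neg,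
    integral_neg_eq_self (fun x => deriv g x ^ 2)] at h

/-- The Gaussian logarithmic Sobolev inequality on the line, in its scale-dependent form. -/
theorem line_logSobolev {g : ℝ → ℝ} (hg : LocAC g) (h1 : MemLp g 2) (h2 : MemLp (deriv g) 2)
    (hone : ∫ x, g x ^ 2 = 1) (he : Integrable fun x => g x ^ 2 * Real.log (g x ^ 2)) {κ : ℝ}
    (hκ : 0 < κ) :
    ∫ x, g x ^ 2 * Real.log (g x ^ 2) ≤
      -(Real.log (2 * Real.pi) / 2) - 1 - Real.log κ + 2 * κ ^ 2 * ∫ x, deriv g x ^ 2 := by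
  set P : ℝ → ℝ := fun y => g y ^ 2 with hPdef
  set z : ℝ → ℝ := fun y => quantile gaussDensity (cumul P y) with hz
  set D := ∫ x, deriv g x ^ 2 with hD
  have hp := isDensity_gaussDensity
  have hP : Continuous P := hg.continuous.pow 2
  have h0 : ∀ y, 0 ≤ P y := fun y => sq_nonneg _
  have hPi : Integrable P := h1.integrable_sq
  set Φ : ℝ × ℝ → ℝ := fun x => x.2 with hΦ
  have hΦc : ContDiff ℝ 1 Φ := by fun_prop
  set B : ℝ → ℝ := fun y => κ * (g y ^ 2 * Φ (y, z y)) with hB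
  -- One estimate serves both ends: if `m` is the tail mass, then `|B| ≤ 2κ √D √(z² m)`, and `z² m →
  -- 0` by the second moment of the Gaussian.
  have hK := fun (a : ℕ → ℝ) => fun (m : ℕ → ℝ) (ha : ∀ k, cumul P (a k) ∈ Ioo (0 : ℝ) 1)
      (hm : ∀ k, 0 ≤ m k) (hb : ∀ k, g (a k) ^ 2 ≤ 2 * (√(m k) * √D))
      (ht : Tendsto (fun k => z (a k) ^ 2 * m k) atTop (𝓝 0)) => by
    show Tendsto (fun k => B (a k)) atTop (𝓝 0)
    have hs : Tendsto (fun k => κ * (2 * √D) * √(z (a k) ^ 2 * m k)) atTop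
        (𝓝 (κ * (2 * √D) * √0)) := ht.sqrt.const_mul _
    rw [Real.sqrt_zero, mul_zero] at hs
    refine squeeze_zero_norm (fun k => ?_) hs
    have e : |g (a k) ^ 2| = g (a k) ^ 2 := abs_of_nonneg (sq_nonneg _)
    simp only [hB, hΦ, norm_mul, Real.norm_eq_abs, abs_of_pos hκ, e]
    rw [Real.sqrt_mul (sq_nonneg _), Real.sqrt_sq_eq_abs]
    have h3 := mul_le_mul_of_nonneg_right (hb k) (abs_nonneg (z (a k)))
    have h4 := mul_le_mul_of_nonneg_left h3 hκ.le
    linarith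
  have hmain := integral_le_of_calibration (P := P) (e := fun y => g y ^ 2 * Real.log (g y ^ 2))
    (D := fun y => deriv g y ^ 2) (B := B)
    (c₁ := -(Real.log (2 * Real.pi) / 2) - 1 - Real.log κ) (c₂ := 2 * κ ^ 2)
    hP h0 hPi hone he ?_ h2.integrable_sq (fun y => sq_nonneg _) (by positivity) ?_ ?_ ?_ ?_
  · exact hmain
  · intro y hy
    have : g y ^ 2 = 0 := hy
    simp [this]
  · intro a b hab ha hb
    have h3 := hp.absolutelyContinuousOnInterval_comp_transport hP hPi h0 hab ha hb hΦc
    exact ((hg.sq a b).fun_mul h3).const_mul _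
  · filter_upwards [hg.ae_differentiableAt] with y hy hmem
    have hzd := hp.hasDerivAt_transport hP hPi hmem
    have hB' : HasDerivAt B (κ * (2 * (g y * deriv g y) * z y +
        g y ^ 2 * (P y / gaussDensity (z y)))) y := by
      have := ((hy.hasDerivAt.fun_pow 2).mul hzd).const_mul κ
      convert! this using 1
      simp only [hz, Nat.cast_ofNat]; ring
    rw [hB'.deriv]
    exact gauss_pointwise hκ (by rw [mul_div_cancel₀ _ (hp.pos _).ne'])
  · intro a ha hlim
    have hzt := hp.tendsto_quantile_atBot (Eventually.of_forall ha) hlim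
    have ht := (hp.tendsto_mul_cumul (K := fun z => z ^ 2) (fun x => sq_nonneg _)
      (fun x hx y hy hxy => by
        simp only [mem_Iic] at hx hy
        nlinarith) integrable_sq_mul_gaussDensity).comp hzt
    refine hK a (fun k => cumul P (a k)) ha (fun k => (ha k).1.le) (fun k => ?_) (ht.congr fun k => ?_)
    · exact hg.sq_le_integral_Iic h1 h2 (a k)
    · simp only [Function.comp, hp.cumul_quantile (ha k), hz]
  · intro a ha hlim
    have hzt := hp.tendsto_quantile_atTop (Eventually.of_forall ha) hlim
    have ht := (hp.tendsto_mul_one_sub_cumul (K := fun z => z ^ 2) (fun x => sq_nonneg _)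
      (fun x hx y hy hxy => by
        simp only [mem_Ici] at hx hy
        nlinarith) integrable_sq_mul_gaussDensity).comp hzt
    refine hK a (fun k => 1 - cumul P (a k)) ha (fun k => sub_nonneg.2 (ha k).2.le) (fun k => ?_)
      (ht.congr fun k => ?_)
    · have h3 := cumul_add_Ioi hPi (a k)
      rw [hone] at h3
      rw [← h3, add_sub_cancel_left]
      exact hg.sq_le_integral_Ioi h1 h2 (a k)
    · simp only [Function.comp, hp.cumul_quantile (ha k), hz]

/-! ### The model density -/

lemma integral_comp_exp (g : ℝ → ℝ) : ∫ x, Real.exp x * g (Real.exp x) = ∫ y in Ioi 0, g y := by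
  have h := integral_image_eq_integral_abs_deriv_smul (f := Real.exp) (f' := Real.exp)
    MeasurableSet.univ (fun x _ => (Real.hasDerivAt_exp x).hasDerivWithinAt)
    Real.exp_injective.injOn g
  rw [image_univ, Real.range_exp, Measure.restrict_univ] at h
  simpa only [Real.abs_exp, smul_eq_mul] using h.symm

/-- Prepares the substitution `r = eˣ`, under which these integrals become Gamma integrals. -/
lemma exp_mul_exp_neg_eq (N q b x : ℝ) :
    Real.exp (N * x) * Real.exp (-(b * Real.exp (q * x))) = Real.exp x *
      (fun r : ℝ => r ^ (N - 1) * Real.exp (-b * r ^ q)) (Real.exp x) := by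
  simp only [← Real.exp_mul]
  have h : Real.exp (N * x) = Real.exp x * Real.exp (x * (N - 1)) := by
    rw [← Real.exp_add]; congr 1; ring
  rw [h, mul_assoc, mul_comm x q, neg_mul]

lemma integral_exp_mul_exp_neg {N q b : ℝ} (hN : 0 < N) (hq : 0 < q) (hb : 0 < b) :
    ∫ x, Real.exp (N * x) * Real.exp (-(b * Real.exp (q * x))) =
      b ^ (-(N / q)) * q⁻¹ * Real.Gamma (N / q) := by
  simp only [exp_mul_exp_neg_eq]
  rw [integral_comp_exp (fun r : ℝ => r ^ (N - 1) * Real.exp (-b * r ^ q)),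
    integral_rpow_mul_exp_neg_mul_rpow hq (by linarith) hb]
  simp only [sub_add_cancel, one_div, neg_div]

lemma integrable_exp_mul_exp_neg {N q b : ℝ} (hN : 0 < N) (hq : 0 < q) (hb : 0 < b) :
    Integrable fun x => Real.exp (N * x) * Real.exp (-(b * Real.exp (q * x))) := by
  refine Integrable.of_integral_ne_zero ?_
  rw [integral_exp_mul_exp_neg hN hq hb]
  have := Real.Gamma_pos_of_pos (div_pos hN hq)
  positivity

lemma isDensity_expDensity {N θ : ℝ} (hN : 0 < N) (hθ : 0 < θ) :
    IsDensity (expDensity N θ (2 * θ / Real.Gamma (N / (2 * θ)))) := by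
  have hG := Real.Gamma_pos_of_pos (div_pos hN (mul_pos two_pos hθ))
  have h := integral_exp_mul_exp_neg hN (mul_pos two_pos hθ) one_pos
  have hi := integrable_exp_mul_exp_neg hN (mul_pos two_pos hθ) one_pos
  simp only [one_mul] at h hi
  refine ⟨by unfold expDensity; fun_prop, fun x => by unfold expDensity; positivity,
    hi.const_mul _, ?_⟩
  simp only [expDensity, integral_const_mul, h, Real.one_rpow]
  field_simp

lemma integrable_exp_mul_expDensity {N θ c : ℝ} (hN : 0 < N) (hθ : 0 < θ) :
    Integrable fun z => Real.exp (2 * θ * z) * expDensity N θ c z := by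
  have hi := (integrable_exp_mul_exp_neg (N := N + 2 * θ) (by positivity) (mul_pos two_pos hθ)
    one_pos).const_mul c
  refine hi.congr (ae_of_all _ fun x => ?_)
  simp only [expDensity, one_mul, add_mul, Real.exp_add]
  ring

/-! ### Optimization over the scale -/

/-- Minimizing `-d ln κ + κ² M` over `κ` gives the logarithmic form. Positivity of `M` matters as
well, because `Real.log 0 = 0` would make a bound by the logarithm of a vanishing energy
meaningless. -/
lemma pos_and_le_of_forall_scale {L K d M : ℝ} (hd : 0 < d) (hM : 0 ≤ M)
    (h : ∀ κ > 0, L ≤ K - d * Real.log κ + κ ^ 2 * M) :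
    0 < M ∧ L ≤ K + d / 2 + d / 2 * Real.log (2 * M / d) := by
  have hM' : 0 < M := by
    refine lt_of_le_of_ne hM fun h0 => ?_
    -- If `M = 0`, this `κ` makes the right-hand side equal to `L - 1`.
    have := h (Real.exp ((K - L + 1) / d)) (Real.exp_pos _)
    rw [← h0, Real.log_exp, mul_div_cancel₀ _ hd.ne'] at this
    linarith
  refine ⟨hM', ?_⟩
  -- The critical point, where `2 κ² M = d`.
  have h1 := h (√(d / (2 * M))) (by positivity)
  rw [Real.log_sqrt (by positivity), Real.sq_sqrt (by positivity),
    show d / (2 * M) = (2 * M / d)⁻¹ by rw [inv_div], Real.log_inv] at h1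
  refine h1.trans (le_of_eq ?_)
  field_simp
  ring

/-- The logarithmic Sobolev inequality on the line with weight `e^{Ny}`. -/
theorem exp_logSobolev_sharp {V : ℝ → ℝ} (hV : LocAC V) {N θ ω : ℝ} (hθ : 0 < θ) (hN : θ ≤ N)
    (hω : 0 < ω) (h1 : MemLp (fun x => Real.exp (N / 2 * x) * V x) 2)
    (h2 : MemLp (fun x => Real.exp ((N / 2 - θ) * x) * deriv V x) 2)
    (hone : ω * ∫ x, (Real.exp (N / 2 * x) * V x) ^ 2 = 1)
    (he : Integrable fun x => V x ^ 2 * Real.log (V x ^ 2) * Real.exp (N * x)) :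
    0 < ∫ x, (Real.exp ((N / 2 - θ) * x) * deriv V x) ^ 2 ∧
    ω * ∫ x, V x ^ 2 * Real.log (V x ^ 2) * Real.exp (N * x) ≤
      Real.log (2 * θ / Real.Gamma (N / (2 * θ)) / ω) - N / (2 * θ) +
      N / (2 * θ) * Real.log (2 * ω / (N * θ) *
        ∫ x, (Real.exp ((N / 2 - θ) * x) * deriv V x) ^ 2) := by
  have hN0 : 0 < N := hθ.trans_le hN
  have hG := Real.Gamma_pos_of_pos (div_pos hN0 (mul_pos two_pos hθ))
  set D := ∫ x, (Real.exp ((N / 2 - θ) * x) * deriv V x) ^ 2 with hD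
  have hD0 : 0 ≤ D := integral_nonneg fun x => sq_nonneg _
  obtain ⟨h3, h4⟩ := pos_and_le_of_forall_scale (d := N / θ) (M := ω / θ ^ 2 * D)
    (K := Real.log (2 * θ / Real.Gamma (N / (2 * θ)) / ω) - N / θ) (by positivity) (by positivity)
    (fun κ hκ => (exp_logSobolev hV hθ hN (by positivity) hω hκ (isDensity_expDensity hN0 hθ)
      (integrable_exp_mul_expDensity hN0 hθ) h1 h2 hone he).trans (le_of_eq (by ring)))
  refine ⟨(mul_pos_iff_of_pos_left (by positivity)).1 h3, h4.trans (le_of_eq ?_)⟩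
  have e : 2 * (ω / θ ^ 2 * D) / (N / θ) = 2 * ω / (N * θ) * D := by field_simp
  rw [e]
  field_simp
  ring

/-! ### The logarithmic Hardy inequality -/

lemma LocAC.tendsto_sq_atTop {g : ℝ → ℝ} (hg : LocAC g) (h1 : MemLp g 2)
    (h2 : MemLp (deriv g) 2) : Tendsto (fun y => g y ^ 2) atTop (𝓝 0) := by
  have h : Tendsto (fun y => ∫ x in Ioi y, g x ^ 2) atTop (𝓝 0) :=
    tendsto_integral_Ioi_zero fun _ a => a
  have h3 := (h.sqrt.mul_const (√(∫ x, deriv g x ^ 2))).const_mul 2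
  rw [Real.sqrt_zero, zero_mul, mul_zero] at h3
  exact squeeze_zero (fun y => sq_nonneg _) (fun y => hg.sq_le_integral_Ioi h1 h2 y) h3

lemma LocAC.tendsto_sq_atBot {g : ℝ → ℝ} (hg : LocAC g) (h1 : MemLp g 2)
    (h2 : MemLp (deriv g) 2) : Tendsto (fun y => g y ^ 2) atBot (𝓝 0) := by
  have h : Tendsto (fun y => ∫ x in Iic y, g x ^ 2) atBot (𝓝 0) :=
    tendsto_integral_Iic_zero fun _ a => a
  have h3 := (h.sqrt.mul_const (√(∫ x, deriv g x ^ 2))).const_mul 2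
  rw [Real.sqrt_zero, zero_mul, mul_zero] at h3
  exact squeeze_zero (fun y => sq_nonneg _) (fun y => hg.sq_le_integral_Iic h1 h2 y) h3

/-- The integrand is half the derivative of `g²`, and `g²` vanishes at both ends. This removes the
cross term when the Hardy energy is expanded. -/
lemma LocAC.integral_mul_deriv_eq_zero {g : ℝ → ℝ} (hg : LocAC g) (h1 : MemLp g 2)
    (h2 : MemLp (deriv g) 2) : ∫ x, g x * deriv g x = 0 := by
  have hint := integrable_abs_mul h1 h2
  have hlim := intervalIntegral_tendsto_integral (hint.const_mul 2)
    (tendsto_neg_atTop_atBot (G := ℝ)) tendsto_id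
  have hlim2 : Tendsto (fun y => g y ^ 2 - g (-y) ^ 2) atTop (𝓝 (0 - 0)) :=
    (hg.tendsto_sq_atTop h1 h2).sub ((hg.tendsto_sq_atBot h1 h2).comp tendsto_neg_atTop_atBot)
  have h3 := tendsto_nhds_unique (hlim.congr fun y => ?_) hlim2
  · rw [integral_const_mul] at h3
    linarith
  · rw [← (hg.sq (-y) y).integral_deriv_eq_sub]
    refine intervalIntegral.integral_congr_ae ?_
    filter_upwards [hg.ae_deriv_sq] with x hx _
    rw [hx]

/-- The logarithmic Hardy inequality on the line. -/
theorem exp_logHardy_sharp {V : ℝ → ℝ} (hV : LocAC V) {a ω d : ℝ} (ha : 0 < a) (hω : 0 < ω)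
    (hd : 1 < d) (h1 : MemLp (fun x => Real.exp (a * x) * V x) 2)
    (h2 : MemLp (fun x => Real.exp (a * x) * deriv V x) 2)
    (hone : ω * ∫ x, (Real.exp (a * x) * V x) ^ 2 = 1)
    (he : Integrable fun x => (Real.exp (a * x) * V x) ^ 2 *
      Real.log ((Real.exp (a * x) * V x) ^ 2)) :
    0 < ∫ x, (Real.exp (a * x) * deriv V x) ^ 2 ∧
    ω * ∫ x, (Real.exp (a * x) * V x) ^ 2 * Real.log ((Real.exp (a * x) * V x) ^ 2) ≤
      -Real.log ω + Real.log (2 / Real.pi) / 2 - 1 / 2 - Real.log d / 2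
      - (d - 1) / 2 * Real.log (d * a ^ 2 / (d - 1)) +
      d / 2 * Real.log (ω * ∫ x, (Real.exp (a * x) * deriv V x) ^ 2) := by
  -- The ground state substitution: `g` is normalized in unweighted `L²`, and the weight reappears
  -- only as the constant `a²` in the energy.
  set g : ℝ → ℝ := fun x => √ω * (Real.exp (a * x) * V x) with hgdef
  set D := ∫ x, (Real.exp (a * x) * deriv V x) ^ 2 with hDdef
  have hexp : ContDiff ℝ 1 fun x : ℝ => √ω * Real.exp (a * x) := by fun_prop
  have hg : LocAC g := by
    have := (LocAC.of_contDiff hexp).mul hV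
    simpa only [hgdef, mul_assoc] using this
  have hsq : ∀ x, g x ^ 2 = ω * (Real.exp (a * x) * V x) ^ 2 := fun x => by
    rw [hgdef]; simp only; rw [mul_pow, Real.sq_sqrt hω.le]
  have hd' : deriv g =ᵐ[volume] fun x => √ω * (Real.exp (a * x) * deriv V x) + a * g x := by
    filter_upwards [hV.ae_differentiableAt] with x hx
    have h3 := ((((hasDerivAt_id x).const_mul a).exp).mul hx.hasDerivAt).const_mul (√ω)
    have h4 : deriv g x = _ := h3.deriv
    rw [h4, hgdef]
    simp only [id]
    ring
  have hg1 : MemLp g 2 := h1.const_mul _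
  have hg2 : MemLp (deriv g) 2 :=
    (memLp_congr_ae hd').2 ((h2.const_mul _).add (hg1.const_mul _))
  have hgone : ∫ x, g x ^ 2 = 1 := by
    simp only [hsq, integral_const_mul]; exact hone
  have hlogpt : ∀ x, g x ^ 2 * Real.log (g x ^ 2) = ω * ((Real.exp (a * x) * V x) ^ 2 *
      Real.log ((Real.exp (a * x) * V x) ^ 2)) + Real.log ω * g x ^ 2 := fun x => by
    rcases eq_or_ne ((Real.exp (a * x) * V x) ^ 2) 0 with h0 | h0
    · simp [hsq, h0]
    · rw [hsq, Real.log_mul hω.ne' h0]; ring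
  have hge : Integrable fun x => g x ^ 2 * Real.log (g x ^ 2) := by
    simp only [hlogpt]
    exact (he.const_mul ω).add (hg1.integrable_sq.const_mul _)
  have hgint : ∫ x, g x ^ 2 * Real.log (g x ^ 2) = ω * (∫ x, (Real.exp (a * x) * V x) ^ 2 *
      Real.log ((Real.exp (a * x) * V x) ^ 2)) + Real.log ω := by
    simp only [hlogpt]
    rw [integral_add (he.const_mul ω) (hg1.integrable_sq.const_mul _), integral_const_mul,
      integral_const_mul, hgone, mul_one]
  have hcross := hg.integral_mul_deriv_eq_zero hg1 hg2
  have hE : ω * D = (∫ x, deriv g x ^ 2) + a ^ 2 := by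
    have h3 : ω * D = ∫ x, (deriv g x ^ 2 - 2 * a * (g x * deriv g x) + a ^ 2 * g x ^ 2) := by
      rw [hDdef, ← integral_const_mul]
      refine integral_congr_ae (hd'.mono fun x hx => ?_)
      have h4 : √ω * (Real.exp (a * x) * deriv V x) = deriv g x - a * g x := by rw [hx]; ring
      have h5 : (√ω * (Real.exp (a * x) * deriv V x)) ^ 2 = (deriv g x - a * g x) ^ 2 := by rw [h4]
      rw [mul_pow, Real.sq_sqrt hω.le] at h5
      exact h5.trans (by ring)
    have i1 := hg2.integrable_sq
    have i2 := (integrable_abs_mul hg1 hg2).const_mul (2 * a)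
    have i3 := hg1.integrable_sq.const_mul (a ^ 2)
    have i12 : Integrable fun x => deriv g x ^ 2 - 2 * a * (g x * deriv g x) := i1.sub i2
    rw [h3, integral_add i12 i3, integral_sub i1 i2, integral_const_mul,
      integral_const_mul, hcross, hgone]
    ring
  set D₁ := ∫ x, deriv g x ^ 2 with hD₁
  have hD₁0 : 0 ≤ D₁ := integral_nonneg fun x => sq_nonneg _
  obtain ⟨h3, h4⟩ := pos_and_le_of_forall_scale (d := 1) (M := 2 * D₁)
    (K := -(Real.log (2 * Real.pi) / 2) - 1) one_pos (by positivity)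
    (fun κ hκ => (line_logSobolev hg hg1 hg2 hgone hge hκ).trans (le_of_eq (by ring)))
  have hD₁pos : 0 < D₁ := by linarith
  refine ⟨?_, ?_⟩
  · refine (mul_pos_iff_of_pos_left hω).1 ?_
    rw [hE]; positivity
  have hd0 : 0 < d := by linarith
  have hd1 : 0 < d - 1 := by linarith
  -- Write `D₁ + a²` as the mean of `d D₁` and `d a²/(d-1)` with weights `1/d` and `(d-1)/d`.
  -- Concavity turns `½ ln D₁` into `(d/2) ln(D₁ + a²)` plus constants. Equality needs `D₁ =
  -- a²/(d-1)`, which selects the width of the Gaussian extremal.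
  have hconc := strictConcaveOn_log_Ioi.concaveOn.2
    (show d * D₁ ∈ Ioi 0 from mem_Ioi.2 (by positivity))
    (show d * a ^ 2 / (d - 1) ∈ Ioi 0 from mem_Ioi.2 (by positivity))
    (show 0 ≤ 1 / d by positivity) (show 0 ≤ (d - 1) / d by positivity) (by field_simp; ring)
  simp only [smul_eq_mul] at hconc
  have e1 : 1 / d * (d * D₁) + (d - 1) / d * (d * a ^ 2 / (d - 1)) = ω * D := by
    rw [hE]; field_simp
  rw [e1] at hconc
  have hconc2 := mul_le_mul_of_nonneg_left hconc (show 0 ≤ d / 2 by positivity)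
  rw [mul_add] at hconc2
  have e2 : d / 2 * (1 / d * Real.log (d * D₁)) = Real.log d / 2 + Real.log D₁ / 2 := by
    rw [Real.log_mul hd0.ne' hD₁pos.ne']; field_simp
  have e3 : d / 2 * ((d - 1) / d * Real.log (d * a ^ 2 / (d - 1))) =
      (d - 1) / 2 * Real.log (d * a ^ 2 / (d - 1)) := by field_simp
  rw [e2, e3] at hconc2
  have e4 : Real.log (2 * (2 * D₁) / 1) = 2 * Real.log 2 + Real.log D₁ := by
    rw [show 2 * (2 * D₁) / 1 = 2 * 2 * D₁ by ring, Real.log_mul (by norm_num) hD₁pos.ne',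
      Real.log_mul (by norm_num) (by norm_num)]
    ring
  have e5 : Real.log (2 * Real.pi) = Real.log 2 + Real.log Real.pi :=
    Real.log_mul (by norm_num) Real.pi_pos.ne'
  have e6 : Real.log (2 / Real.pi) = Real.log 2 - Real.log Real.pi :=
    Real.log_div (by norm_num) Real.pi_pos.ne'
  rw [hgint, e4, e5] at h4
  rw [e6]
  linarith

/-! ### Polar decomposition of the measures -/

/-- The measure `tˢ dx dt` on the upper half space. -/
noncomputable def halfMeasure (n : ℕ) (s : ℝ) : Measure (Sp n × ℝ) :=
  (volume.restrict (upperHalf n)).withDensity fun p => ENNReal.ofReal (p.2 ^ s)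

/-- The measure of the upper unit half sphere with respect to `tˢ`. -/
noncomputable def halfSphereArea (n : ℕ) (s : ℝ) : ℝ :=
  Real.pi ^ ((n : ℝ) / 2) * Real.Gamma ((1 + s) / 2) / Real.Gamma (((n : ℝ) + 1 + s) / 2)

lemma measurableSet_upperHalf (n : ℕ) : MeasurableSet (upperHalf n) :=
  measurableSet_lt measurable_const measurable_snd

lemma measurable_euclLen {n : ℕ} : Measurable (euclLen (n := n)) := by
  unfold euclLen; fun_prop

lemma continuous_euclLen {n : ℕ} : Continuous (euclLen (n := n)) := by
  unfold euclLen; fun_prop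

lemma euclLen_sq {n : ℕ} (p : Sp n × ℝ) : euclLen p ^ 2 = ‖p.1‖ ^ 2 + p.2 ^ 2 :=
  Real.sq_sqrt (by positivity)

lemma euclLen_nonneg {n : ℕ} (p : Sp n × ℝ) : 0 ≤ euclLen p := Real.sqrt_nonneg _

lemma euclLen_pos {n : ℕ} {p : Sp n × ℝ} (hp : p ∈ upperHalf n) : 0 < euclLen p := by
  have : 0 < p.2 := hp
  unfold euclLen; positivity

lemma euclLen_smul {n : ℕ} {c : ℝ} (hc : 0 ≤ c) (p : Sp n × ℝ) : euclLen (c • p) = c * euclLen p := by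
  unfold euclLen
  rw [show ‖(c • p).1‖ ^ 2 + (c • p).2 ^ 2 = c ^ 2 * (‖p.1‖ ^ 2 + p.2 ^ 2) by
    simp [norm_smul, mul_pow]; ring, Real.sqrt_mul (sq_nonneg _), Real.sqrt_sq hc]

lemma smul_mem_upperHalf_iff {n : ℕ} {c : ℝ} (hc : 0 < c) (p : Sp n × ℝ) :
    c • p ∈ upperHalf n ↔ p ∈ upperHalf n := by
  simp [upperHalf, hc]

lemma measurable_rpow_snd {n : ℕ} (s : ℝ) :
    Measurable fun p : Sp n × ℝ => ENNReal.ofReal (p.2 ^ s) := by fun_prop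

lemma lintegral_halfMeasure {n : ℕ} (s : ℝ) {F : Sp n × ℝ → ENNReal} (hF : Measurable F) :
    ∫⁻ p, F p ∂halfMeasure n s = ∫⁻ p in upperHalf n, F p * ENNReal.ofReal (p.2 ^ s) := by
  rw [halfMeasure, lintegral_withDensity_eq_lintegral_mul _ (measurable_rpow_snd s) hF]
  simp only [Pi.mul_apply, mul_comm]

lemma volume_restrict_upperHalf (n : ℕ) :
    (volume : Measure (Sp n × ℝ)).restrict (upperHalf n) =
      (volume : Measure (Sp n)).prod (volume.restrict (Ioi 0)) := by
  have h : upperHalf n = univ ×ˢ Ioi (0 : ℝ) := by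
    ext p; simp [upperHalf]
  rw [h, Measure.volume_eq_prod, ← Measure.prod_restrict, Measure.restrict_univ]

instance isAddHaarMeasure_prod_volume (n : ℕ) :
    (volume : Measure (Sp n × ℝ)).IsAddHaarMeasure := by
  rw [Measure.volume_eq_prod]; infer_instance

lemma lintegral_comp_smul {n : ℕ} {c : ℝ} (hc : 0 < c) {F : Sp n × ℝ → ENNReal}
    (hF : Measurable F) :
    ∫⁻ p, F p = ENNReal.ofReal (c ^ (n + 1)) * ∫⁻ p, F (c • p) := by
  have h := Measure.map_addHaar_smul (volume : Measure (Sp n × ℝ)) hc.ne'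
  have hfr : Module.finrank ℝ (Sp n × ℝ) = n + 1 := by simp
  rw [hfr] at h
  rw [← lintegral_map hF (measurable_const_smul c), h, lintegral_smul_measure, smul_eq_mul,
    ← mul_assoc, ← ENNReal.ofReal_mul (by positivity), abs_of_pos (by positivity),
    mul_inv_cancel₀ (by positivity), ENNReal.ofReal_one, one_mul]

/-- The Gaussian is both radial and a product, so Fubini evaluates it. This single value fixes the
normalization of the polar decomposition. -/
lemma lintegral_gaussian_halfMeasure (n : ℕ) {s : ℝ} (hs : -1 < s) :
    ∫⁻ p, ENNReal.ofReal (Real.exp (-euclLen p ^ 2)) ∂halfMeasure n s =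
      ENNReal.ofReal (Real.pi ^ ((n : ℝ) / 2) * (Real.Gamma ((1 + s) / 2) / 2)) := by
  rw [lintegral_halfMeasure s (by have := measurable_euclLen (n := n); fun_prop),
    volume_restrict_upperHalf]
  have h : ∀ p : Sp n × ℝ, ENNReal.ofReal (Real.exp (-euclLen p ^ 2)) * ENNReal.ofReal (p.2 ^ s) =
      ENNReal.ofReal (Real.exp (-1 * ‖p.1‖ ^ 2)) *
        (ENNReal.ofReal (Real.exp (-p.2 ^ 2)) * ENNReal.ofReal (p.2 ^ s)) := fun p => by
    rw [euclLen_sq, neg_add, Real.exp_add, ENNReal.ofReal_mul (Real.exp_pos _).le, mul_assoc,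
      neg_one_mul]
  simp only [h]
  rw [lintegral_prod_mul (f := fun x : Sp n => ENNReal.ofReal (Real.exp (-1 * ‖x‖ ^ 2)))
    (g := fun t : ℝ => ENNReal.ofReal (Real.exp (-t ^ 2)) * ENNReal.ofReal (t ^ s))
    (by fun_prop) (by fun_prop), ENNReal.ofReal_mul (by positivity)]
  congr 1
  · have hg := GaussianFourier.integral_rexp_neg_mul_sq_norm (V := Sp n) one_pos
    rw [div_one, finrank_euclideanSpace_fin] at hg
    rw [← hg, ofReal_integral_eq_lintegral_ofReal _ (ae_of_all _ fun _ => (Real.exp_pos _).le)]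
    refine Integrable.of_integral_ne_zero ?_
    rw [hg]; positivity
  · have hg := integral_rpow_mul_exp_neg_mul_rpow (p := 2) (q := s) (b := 1) two_pos hs one_pos
    have hG : 0 < Real.Gamma ((s + 1) / 2) := Real.Gamma_pos_of_pos (by linarith)
    rw [Real.one_rpow, one_mul, one_div_mul_eq_div, add_comm s 1] at hg
    rw [← hg, ofReal_integral_eq_lintegral_ofReal]
    · refine setLIntegral_congr_fun measurableSet_Ioi fun t ht => ?_
      simp only [Real.rpow_two, neg_mul, one_mul]
      rw [ENNReal.ofReal_mul (Real.rpow_nonneg (le_of_lt ht) _), mul_comm]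
    · refine Integrable.of_integral_ne_zero ?_
      rw [hg, add_comm]; positivity
    · filter_upwards [ae_restrict_mem measurableSet_Ioi] with t ht
      exact mul_nonneg (Real.rpow_nonneg (le_of_lt ht) _) (Real.exp_pos _).le

lemma withDensity_exp_Iic {A m : ℝ} (hA : 0 ≤ A) (hm : 0 < m) (y : ℝ) :
    (volume.withDensity fun y : ℝ => ENNReal.ofReal (A * Real.exp (m * y))) (Iic y) =
      ENNReal.ofReal (A / m * Real.exp (m * y)) := by
  rw [withDensity_apply _ measurableSet_Iic, ← ofReal_integral_eq_lintegral_ofReal,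
    integral_const_mul, integral_exp_mul_Iic hm]
  · congr 1; ring
  · exact (integrableOn_exp_mul_Iic hm y).const_mul A
  · exact ae_of_all _ fun y => by positivity

/-- A measure on the line whose cumulative function is exponential has an exponential density. -/
lemma eq_withDensity_exp {ν : Measure ℝ} {A m : ℝ} (hA : 0 ≤ A) (hm : 0 < m)
    (h : ∀ y, ν (Iic y) = ENNReal.ofReal (A / m * Real.exp (m * y))) :
    ν = volume.withDensity fun y : ℝ => ENNReal.ofReal (A * Real.exp (m * y)) := by
  have hfin : ∀ y, ν (Iic y) ≠ ⊤ := fun y => by rw [h]; exact ENNReal.ofReal_ne_top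
  refine Measure.ext_of_Ioc' _ _ (fun a b _ => ?_) fun a b hab => ?_
  · exact ne_top_of_le_ne_top (hfin b) (measure_mono Ioc_subset_Iic_self)
  · rw [← Iic_sdiff_Iic, measure_sdiff (Iic_subset_Iic.2 hab.le) measurableSet_Iic.nullMeasurableSet
      (hfin a), measure_sdiff (Iic_subset_Iic.2 hab.le) measurableSet_Iic.nullMeasurableSet]
    · rw [h, h, withDensity_exp_Iic hA hm, withDensity_exp_Iic hA hm]
    · rw [withDensity_exp_Iic hA hm]; exact ENNReal.ofReal_ne_top

lemma measurable_log_euclLen {n : ℕ} : Measurable fun p : Sp n × ℝ => Real.log (euclLen p) :=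
  measurable_euclLen.log

/-- The measure `tˢ dx dt` is homogeneous of degree `n + 1 + s` under dilations, so balls about the
origin are compared with the unit ball. -/
lemma halfMeasure_log_le {n : ℕ} (s y : ℝ) :
    halfMeasure n s {p | Real.log (euclLen p) ≤ y} =
      ENNReal.ofReal (Real.exp (((n : ℝ) + 1 + s) * y)) *
        halfMeasure n s {p | Real.log (euclLen p) ≤ 0} := by
  have hms : ∀ y, MeasurableSet {p : Sp n × ℝ | Real.log (euclLen p) ≤ y} := fun y =>
    measurableSet_le measurable_log_euclLen measurable_const
  have hformula : ∀ y, halfMeasure n s {p | Real.log (euclLen p) ≤ y} =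
      ∫⁻ p, ({p | Real.log (euclLen p) ≤ y} ∩ upperHalf n).indicator
        (fun p => ENNReal.ofReal (p.2 ^ s)) p := fun y => by
    rw [halfMeasure, withDensity_apply _ (hms y), Measure.restrict_restrict (hms y),
      lintegral_indicator ((hms y).inter (measurableSet_upperHalf n))]
  rw [hformula, hformula, lintegral_comp_smul (Real.exp_pos y)
    ((measurable_rpow_snd s).indicator ((hms y).inter (measurableSet_upperHalf n)))]
  have h : ∀ p : Sp n × ℝ, ({p | Real.log (euclLen p) ≤ y} ∩ upperHalf n).indicator
        (fun p => ENNReal.ofReal (p.2 ^ s)) (Real.exp y • p) = ENNReal.ofReal (Real.exp (s * y)) *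
      ({p | Real.log (euclLen p) ≤ 0} ∩ upperHalf n).indicator
        (fun p => ENNReal.ofReal (p.2 ^ s)) p := fun p => by
    by_cases hp : p ∈ upperHalf n
    · have h1 : Real.log (euclLen (Real.exp y • p)) = y + Real.log (euclLen p) := by
        rw [euclLen_smul (Real.exp_pos y).le, Real.log_mul (Real.exp_pos y).ne' (euclLen_pos hp).ne',
          Real.log_exp]
      have h2 : Real.exp y • p ∈ {p : Sp n × ℝ | Real.log (euclLen p) ≤ y} ∩ upperHalf n ↔
          p ∈ {p : Sp n × ℝ | Real.log (euclLen p) ≤ 0} ∩ upperHalf n := by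
        simp only [mem_inter_iff, smul_mem_upperHalf_iff (Real.exp_pos y), mem_ofPred_eq, h1]
        simp
      by_cases hmem : p ∈ {p : Sp n × ℝ | Real.log (euclLen p) ≤ 0} ∩ upperHalf n
      · rw [indicator_of_mem hmem, indicator_of_mem (h2.2 hmem)]
        rw [← ENNReal.ofReal_mul (Real.exp_pos _).le]
        congr 1
        have hp2 : 0 < p.2 := hp
        rw [Prod.smul_snd, smul_eq_mul, Real.mul_rpow (Real.exp_pos _).le hp2.le, ← Real.exp_mul,
          mul_comm y s]
      · rw [indicator_of_notMem hmem, indicator_of_notMem (fun h => hmem (h2.1 h)), mul_zero]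
    · have h2 : Real.exp y • p ∉ upperHalf n := by rwa [smul_mem_upperHalf_iff (Real.exp_pos y)]
      simp [indicator, hp, h2]
  simp only [h]
  rw [lintegral_const_mul _
    ((measurable_rpow_snd s).indicator ((hms 0).inter (measurableSet_upperHalf n))), ← mul_assoc,
    ← ENNReal.ofReal_mul (by positivity)]
  congr 2
  rw [← Real.exp_nat_mul, ← Real.exp_add]
  congr 1; push_cast; ring

/-- Polar coordinates on the upper half space, in the logarithmic radial variable. -/
theorem map_log_euclLen (n : ℕ) {s : ℝ} (hs : -1 < s) :
    (halfMeasure n s).map (fun p => Real.log (euclLen p)) = volume.withDensity fun y : ℝ =>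
      ENNReal.ofReal (halfSphereArea n s * Real.exp (((n : ℝ) + 1 + s) * y)) := by
  have hn : (0 : ℝ) ≤ n := n.cast_nonneg
  have hm : 0 < (n : ℝ) + 1 + s := by linarith
  have hG1 : 0 < Real.Gamma ((1 + s) / 2) := Real.Gamma_pos_of_pos (by linarith)
  have hG2 : 0 < Real.Gamma (((n : ℝ) + 1 + s) / 2) := Real.Gamma_pos_of_pos (by linarith)
  set k := halfMeasure n s {p | Real.log (euclLen p) ≤ 0} with hk
  have hgauss := lintegral_gaussian_halfMeasure n hs
  have hae : ∀ᵐ p ∂halfMeasure n s, p ∈ upperHalf n :=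
    (withDensity_absolutelyContinuous _ _).ae_le (ae_restrict_mem (measurableSet_upperHalf n))
  -- Markov's inequality for the Gaussian, which is at least `e⁻¹` on the unit half ball.
  have hkfin : k ≠ ⊤ := by
    have h1 := mul_meas_ge_le_lintegral (μ := halfMeasure n s)
      (f := fun p => ENNReal.ofReal (Real.exp (-euclLen p ^ 2)))
      (by have := measurable_euclLen (n := n); fun_prop) (ENNReal.ofReal (Real.exp (-1)))
    rw [hgauss] at h1
    have h2 : k ≤ halfMeasure n s {p | ENNReal.ofReal (Real.exp (-1)) ≤
        ENNReal.ofReal (Real.exp (-euclLen p ^ 2))} := by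
      refine measure_mono_ae (hae.mono fun p hp hle => ?_)
      refine ENNReal.ofReal_le_ofReal (Real.exp_le_exp.2 ?_)
      have h3 : euclLen p ≤ 1 := by
        have := Real.exp_le_exp.2 (show Real.log (euclLen p) ≤ 0 from hle)
        rwa [Real.exp_log (euclLen_pos hp), Real.exp_zero] at this
      nlinarith [euclLen_nonneg p]
    intro htop
    rw [htop, top_le_iff] at h2
    rw [h2, ENNReal.mul_top (by simp [Real.exp_pos])] at h1
    exact absurd h1 (by simp)
  have hmap : (halfMeasure n s).map (fun p => Real.log (euclLen p)) = volume.withDensity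
      fun y : ℝ => ENNReal.ofReal (((n : ℝ) + 1 + s) * k.toReal *
        Real.exp (((n : ℝ) + 1 + s) * y)) := by
    refine eq_withDensity_exp (by positivity) hm fun y => ?_
    rw [Measure.map_apply measurable_log_euclLen measurableSet_Iic]
    have := halfMeasure_log_le (n := n) s y
    simp only [preimage, mem_Iic]
    rw [this, mul_div_cancel_left₀ _ hm.ne', mul_comm k.toReal,
      ENNReal.ofReal_mul (Real.exp_pos _).le, ENNReal.ofReal_toReal hkfin]
  -- Homogeneity leaves one unknown constant. It is found by integrating the Gaussian in both
  -- coordinate systems.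
  have hconst : ((n : ℝ) + 1 + s) * k.toReal = halfSphereArea n s := by
    have h1 : ∫⁻ p, ENNReal.ofReal (Real.exp (-euclLen p ^ 2)) ∂halfMeasure n s =
        ∫⁻ y, ENNReal.ofReal (Real.exp (-Real.exp (2 * y)))
          ∂(halfMeasure n s).map (fun p => Real.log (euclLen p)) := by
      rw [lintegral_map (by fun_prop) measurable_log_euclLen]
      refine lintegral_congr_ae (hae.mono fun p hp => ?_)
      simp only
      rw [two_mul, Real.exp_add, Real.exp_log (euclLen_pos hp), pow_two]
    have hi := integrable_exp_mul_exp_neg hm two_pos one_pos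
    have hv := integral_exp_mul_exp_neg hm two_pos one_pos
    simp only [one_mul, Real.one_rpow] at hi hv
    rw [hmap, lintegral_withDensity_eq_lintegral_mul _ (by fun_prop) (by fun_prop), hgauss] at h1
    have h2 : ∀ y : ℝ, ((fun y : ℝ => ENNReal.ofReal (((n : ℝ) + 1 + s) * k.toReal *
        Real.exp (((n : ℝ) + 1 + s) * y))) * fun y : ℝ =>
        ENNReal.ofReal (Real.exp (-Real.exp (2 * y)))) y = ENNReal.ofReal
        (((n : ℝ) + 1 + s) * k.toReal * (Real.exp (((n : ℝ) + 1 + s) * y) *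
          Real.exp (-Real.exp (2 * y)))) := fun y => by
      rw [Pi.mul_apply, ← ENNReal.ofReal_mul (by positivity)]; congr 1; ring
    simp only [h2] at h1
    rw [← ofReal_integral_eq_lintegral_ofReal (hi.const_mul _) (ae_of_all _ fun y => by positivity),
      integral_const_mul, hv, ENNReal.ofReal_eq_ofReal_iff (by positivity) (by positivity)] at h1
    rw [halfSphereArea, eq_div_iff hG2.ne']
    linarith
  rw [hmap, hconst]

/-- Polar coordinates on `ℝⁿ`, in the logarithmic radial variable. -/
theorem map_log_norm {n : ℕ} (hn : 0 < n) :
    (volume : Measure (Sp n)).map (fun x => Real.log ‖x‖) = volume.withDensity fun y : ℝ =>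
      ENNReal.ofReal (sphereArea n * Real.exp ((n : ℝ) * y)) := by
  have hn' : (0 : ℝ) < n := Nat.cast_pos.2 hn
  have : Nonempty (Fin n) := ⟨⟨0, hn⟩⟩
  have hG : 0 < Real.Gamma ((n : ℝ) / 2) := Real.Gamma_pos_of_pos (by linarith)
  refine eq_withDensity_exp (by unfold sphereArea; positivity) hn' fun y => ?_
  rw [Measure.map_apply (by fun_prop) measurableSet_Iic]
  have hae : ∀ᵐ x : Sp n, x ≠ 0 := by
    simp [ae_iff, measure_singleton]
  have h1 : volume ((fun x : Sp n => Real.log ‖x‖) ⁻¹' Iic y) =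
      volume (Metric.closedBall (0 : Sp n) (Real.exp y)) := by
    refine measure_congr (eventuallyEq_set.2 (hae.mono fun x hx => ?_))
    simp only [mem_Iic, mem_preimage, Metric.mem_closedBall, dist_zero_right]
    exact Real.log_le_iff_le_exp (norm_pos_iff.2 hx)
  rw [h1, EuclideanSpace.volume_closedBall, Fintype.card_fin, ← ENNReal.ofReal_pow
    (Real.exp_pos _).le, ← ENNReal.ofReal_mul (by positivity), sphereArea,
    Real.Gamma_add_one (by positivity), ← Real.exp_nat_mul, Real.sqrt_eq_rpow, ← Real.rpow_natCast,
    ← Real.rpow_mul Real.pi_pos.le]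
  congr 1
  rw [one_div_mul_eq_div]
  field_simp

/-! ### Gradients of smooth functions -/

lemma inner_gradX {n : ℕ} {φ : Sp n × ℝ → ℝ} {p : Sp n × ℝ} (hφ : DifferentiableAt ℝ φ p)
    (v : Sp n) : inner ℝ (gradX φ p) v = fderiv ℝ φ p (v, 0) := by
  have h : HasFDerivAt (fun y : Sp n => φ (y, p.2))
      ((fderiv ℝ φ p).comp (ContinuousLinearMap.inl ℝ (Sp n) ℝ)) p.1 :=
    HasFDerivAt.comp (g := φ) (f := fun y : Sp n => (y, p.2)) p.1 hφ.hasFDerivAt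
      (hasFDerivAt_prodMk_left p.1 p.2)
  rw [gradX, gradient, InnerProductSpace.toDual_symm_apply, h.fderiv]
  simp

lemma gradT_eq {n : ℕ} {φ : Sp n × ℝ → ℝ} {p : Sp n × ℝ} (hφ : DifferentiableAt ℝ φ p) :
    gradT φ p = fderiv ℝ φ p (0, 1) := by
  have h : HasFDerivAt (fun τ : ℝ => φ (p.1, τ))
      ((fderiv ℝ φ p).comp (ContinuousLinearMap.inr ℝ (Sp n) ℝ)) p.2 :=
    HasFDerivAt.comp (g := φ) (f := fun τ : ℝ => (p.1, τ)) p.2 hφ.hasFDerivAt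
      (hasFDerivAt_prodMk_right p.1 p.2)
  rw [gradT, h.hasDerivAt.deriv]
  simp

lemma fderiv_apply_eq {n : ℕ} {φ : Sp n × ℝ → ℝ} {p : Sp n × ℝ} (hφ : DifferentiableAt ℝ φ p)
    (v : Sp n) (τ : ℝ) : fderiv ℝ φ p (v, τ) = inner ℝ (gradX φ p) v + gradT φ p * τ := by
  rw [inner_gradX hφ, gradT_eq hφ]
  have h : (v, τ) = ((v, 0) : Sp n × ℝ) + τ • ((0, 1) : Sp n × ℝ) := by simp
  rw [h, map_add, map_smul, smul_eq_mul, mul_comm]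

lemma gradX_eq {n : ℕ} {φ : Sp n × ℝ → ℝ} {p : Sp n × ℝ} (hφ : DifferentiableAt ℝ φ p) :
    gradX φ p = (InnerProductSpace.toDual ℝ (Sp n)).symm
      ((fderiv ℝ φ p).comp (ContinuousLinearMap.inl ℝ (Sp n) ℝ)) := by
  refine ext_inner_right ℝ fun v => ?_
  rw [inner_gradX hφ, InnerProductSpace.toDual_symm_apply]
  simp

namespace IsTest

variable {n : ℕ} {φ : Sp n × ℝ → ℝ} (hφ : IsTest φ)
include hφ

lemma differentiable : Differentiable ℝ φ := hφ.1.differentiable (by simp)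

lemma continuous_gradX : Continuous (gradX φ) := by
  have h : gradX φ = fun p => (InnerProductSpace.toDual ℝ (Sp n)).symm
      ((fderiv ℝ φ p).comp (ContinuousLinearMap.inl ℝ (Sp n) ℝ)) :=
    funext fun p => gradX_eq (hφ.differentiable p)
  rw [h]
  refine (InnerProductSpace.toDual ℝ (Sp n)).symm.continuous.comp ?_
  exact (hφ.1.continuous_fderiv (by simp)).clm_comp continuous_const

lemma continuous_gradT : Continuous (gradT φ) := by
  have h : gradT φ = fun p => fderiv ℝ φ p (0, 1) :=
    funext fun p => gradT_eq (hφ.differentiable p)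
  rw [h]
  exact (hφ.1.continuous_fderiv (by simp)).clm_apply continuous_const

lemma hasDerivAt_comp {γ : ℝ → Sp n × ℝ} {v : Sp n} {w τ : ℝ} (hγ : HasDerivAt γ (v, w) τ) :
    HasDerivAt (fun τ => φ (γ τ)) (inner ℝ (gradX φ (γ τ)) v + gradT φ (γ τ) * w) τ := by
  rw [← fderiv_apply_eq (hφ.differentiable _)]
  exact (hφ.differentiable (γ τ)).hasFDerivAt.comp_hasDerivAt τ hγ

end IsTest

/-! ### Limits of integrals along lines -/

/-- Convergence in a weighted `L²` space on an interval implies convergence of integrals, if the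
inverse of the weight is integrable. -/
lemma tendsto_intervalIntegral_of_weighted {g : ℕ → ℝ → ℝ} {h w : ℝ → ℝ} {a b : ℝ} (hab : a ≤ b)
    (hg : ∀ j, Continuous (g j)) (hh : Measurable h) (hwm : Measurable w)
    (hw : ∀ t ∈ Ioc a b, 0 < w t) (hwi : IntegrableOn (fun t => (w t)⁻¹) (Ioc a b))
    (hlim : Tendsto (fun j => ∫⁻ t in Ioc a b, ENNReal.ofReal ((h t - g j t) ^ 2 * w t)) atTop
      (𝓝 0)) :
    IntervalIntegrable h volume a b ∧
      Tendsto (fun j => ∫ t in a..b, g j t) atTop (𝓝 (∫ t in a..b, h t)) := by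
  -- Cauchy–Schwarz applied to `|h - g j| √w` and `1/√w`.
  have hle : ∀ j, ∫⁻ t in Ioc a b, ‖g j t - h t‖ₑ ≤
      (∫⁻ t in Ioc a b, ENNReal.ofReal ((h t - g j t) ^ 2 * w t)) ^ (1 / 2 : ℝ) *
      (∫⁻ t in Ioc a b, ENNReal.ofReal (w t)⁻¹) ^ (1 / 2 : ℝ) := fun j => by
    have hgm := (hg j).measurable
    have hCS := ENNReal.lintegral_mul_le_Lp_mul_Lq (volume.restrict (Ioc a b))
      Real.HolderConjugate.two_two (f := fun t => ENNReal.ofReal (|h t - g j t| * √(w t)))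
      (g := fun t => ENNReal.ofReal (√(w t))⁻¹) (by fun_prop) (by fun_prop)
    refine le_trans (le_of_eq ?_) (hCS.trans (le_of_eq ?_))
    · refine setLIntegral_congr_fun measurableSet_Ioc fun t ht => ?_
      have := Real.sqrt_pos.2 (hw t ht)
      simp only [Pi.mul_apply]
      rw [← ENNReal.ofReal_mul (by positivity), mul_assoc, mul_inv_cancel₀ this.ne', mul_one,
        Real.enorm_eq_ofReal_abs, abs_sub_comm]
    · congr 2
      · refine setLIntegral_congr_fun measurableSet_Ioc fun t ht => ?_
        rw [ENNReal.ofReal_rpow_of_nonneg (by positivity) (by norm_num), Real.rpow_two, mul_pow,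
          sq_abs, Real.sq_sqrt (hw t ht).le]
      · refine setLIntegral_congr_fun measurableSet_Ioc fun t ht => ?_
        rw [ENNReal.ofReal_rpow_of_nonneg (by positivity) (by norm_num), Real.rpow_two, inv_pow,
          Real.sq_sqrt (hw t ht).le]
  have hwfin : (∫⁻ t in Ioc a b, ENNReal.ofReal (w t)⁻¹) ≠ ⊤ := by
    have h1 := hwi.2
    refine ne_of_lt (lt_of_le_of_lt (lintegral_mono fun t => ?_) h1)
    exact Real.ofReal_le_enorm _
  have hL1 : Tendsto (fun j => ∫⁻ t in Ioc a b, ‖g j t - h t‖ₑ) atTop (𝓝 0) := by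
    have h1 := (ENNReal.continuous_rpow_const (y := 1 / 2)).continuousAt.tendsto.comp hlim
    rw [ENNReal.zero_rpow_of_pos (by norm_num)] at h1
    have h2 := ENNReal.Tendsto.mul_const h1 (b := (∫⁻ t in Ioc a b, ENNReal.ofReal (w t)⁻¹) ^
      (1 / 2 : ℝ)) (Or.inr (ENNReal.rpow_ne_top_of_nonneg (by norm_num) hwfin))
    rw [zero_mul] at h2
    exact tendsto_of_tendsto_of_tendsto_of_le_of_le tendsto_const_nhds h2 (fun _ => zero_le)
      hle
  have hgi : ∀ j, IntegrableOn (g j) (Ioc a b) := fun j =>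
    ((hg j).intervalIntegrable a b).1
  refine ⟨?_, ?_⟩
  · rw [intervalIntegrable_iff_integrableOn_Ioc_of_le hab]
    obtain ⟨j, hj⟩ := (hL1.eventually (gt_mem_nhds ENNReal.zero_lt_top)).exists
    have h1 : IntegrableOn (fun t => g j t - h t) (Ioc a b) :=
      ⟨((hg j).measurable.sub hh).aestronglyMeasurable, hj⟩
    refine ((hgi j).sub h1).congr (ae_of_all _ fun t => ?_)
    simp
  · simp only [intervalIntegral.integral_of_le hab]
    exact tendsto_integral_of_L1 h hh.aestronglyMeasurable (Eventually.of_forall hgi) hL1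

/-! ### Almost everywhere convergence along a subsequence -/

lemma ae_tsum_ne_top {α : Type*} [MeasurableSpace α] {μ : Measure α} {F : ℕ → α → ENNReal}
    (hF : ∀ j, AEMeasurable (F j) μ) (h : ∑' j, ∫⁻ x, F j x ∂μ ≠ ⊤) :
    ∀ᵐ x ∂μ, ∑' j, F j x ≠ ⊤ := by
  rw [← lintegral_tsum hF] at h
  filter_upwards [ae_lt_top' (AEMeasurable.tsum hF) h] with x hx
  exact hx.ne

lemma tsum_ne_top_of_le_half_pow {a : ℕ → ENNReal} (h : ∀ j, a j ≤ 2⁻¹ ^ j) :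
    ∑' j, a j ≠ ⊤ := by
  refine ne_top_of_le_ne_top ?_ (ENNReal.tsum_le_tsum h)
  rw [ENNReal.tsum_geometric_two]
  exact ENNReal.ofNat_ne_top

lemma tendsto_of_tendsto_ofReal_sq {a : ℕ → ℝ} {b c : ℝ} (hc : 0 < c)
    (h : Tendsto (fun j => ENNReal.ofReal ((b - a j) ^ 2 * c)) atTop (𝓝 0)) :
    Tendsto a atTop (𝓝 b) := by
  have h1 := (ENNReal.tendsto_toReal ENNReal.zero_ne_top).comp h
  have h2 : Tendsto (fun j => (b - a j) ^ 2 * c) atTop (𝓝 0) := by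
    refine h1.congr fun j => ?_
    simp only [Function.comp]
    rw [ENNReal.toReal_ofReal (by positivity)]
  have h3 := (h2.div_const c).sqrt
  rw [zero_div, Real.sqrt_zero] at h3
  have h4 : Tendsto (fun j => |a j - b|) atTop (𝓝 0) := by
    refine h3.congr fun j => ?_
    rw [mul_div_cancel_right₀ _ hc.ne', Real.sqrt_sq_eq_abs, abs_sub_comm]
  rw [tendsto_iff_dist_tendsto_zero]
  simpa only [Real.dist_eq] using h4

/-- The integrand of the squared energy distance between a gradient field and the gradient of a
function. -/
noncomputable def gradDist {n : ℕ} (s : ℝ) (Gx : Sp n × ℝ → Sp n) (Gt : Sp n × ℝ → ℝ)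
    (φ : Sp n × ℝ → ℝ) (p : Sp n × ℝ) : ENNReal :=
  ENNReal.ofReal ((‖Gx p - gradX φ p‖ ^ 2 + (Gt p - gradT φ p) ^ 2) * p.2 ^ s)

lemma measurable_gradDist {n : ℕ} {s : ℝ} {Gx : Sp n × ℝ → Sp n} {Gt φ : Sp n × ℝ → ℝ}
    (hGx : Measurable Gx) (hGt : Measurable Gt) (hφ : IsTest φ) :
    Measurable (gradDist s Gx Gt φ) := by
  have h1 := hφ.continuous_gradX.measurable
  have h2 := hφ.continuous_gradT.measurable
  unfold gradDist; fun_prop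

/-- A subsequence of the approximating test functions converges almost everywhere and has summable
energy distances. -/
lemma MemW.exists_seq {n : ℕ} {s : ℝ} {u : Sp n × ℝ → ℝ} {Gx : Sp n × ℝ → Sp n}
    {Gt : Sp n × ℝ → ℝ} {f : Sp n → ℝ} (h : MemW s u Gx Gt f) :
    ∃ ψ : ℕ → Sp n × ℝ → ℝ, (∀ j, IsTest (ψ j)) ∧
      (∀ᵐ p ∂(volume.restrict (upperHalf n)), Tendsto (fun j => ψ j p) atTop (𝓝 (u p))) ∧
      (∀ᵐ x, Tendsto (fun j => ψ j (x, 0)) atTop (𝓝 (f x))) ∧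
      ∑' j, ∫⁻ p in upperHalf n, gradDist s Gx Gt (ψ j) p ≠ ⊤ := by
  obtain ⟨φ, hφ, hE, hu, hf⟩ := h.approx
  -- All three errors are made at most `2⁻ʲ`, the local ones on the ball of radius `j`. Summability
  -- gives pointwise convergence almost everywhere, and every compact region is eventually covered.
  have hex : ∀ j : ℕ, ∃ k, (∫⁻ p in upperHalf n, gradDist s Gx Gt (φ k) p) ≤ 2⁻¹ ^ j ∧
      (∫⁻ p in upperHalf n ∩ Metric.closedBall 0 j,
        ENNReal.ofReal ((u p - φ k p) ^ 2 * p.2 ^ s)) ≤ 2⁻¹ ^ j ∧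
      (∫⁻ x in Metric.closedBall (0 : Sp n) j,
        ENNReal.ofReal ((f x - φ k (x, 0)) ^ 2)) ≤ 2⁻¹ ^ j := fun j => by
    have hpos : (0 : ENNReal) < 2⁻¹ ^ j := ENNReal.pow_pos (by simp) j
    have e1 := hE.eventually (ge_mem_nhds hpos)
    have e2 := (hu _ (isCompact_closedBall 0 (j : ℝ))).eventually (ge_mem_nhds hpos)
    have e3 := (hf _ (isCompact_closedBall 0 (j : ℝ))).eventually (ge_mem_nhds hpos)
    obtain ⟨k, h1, h2, h3⟩ := (e1.and (e2.and e3)).exists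
    exact ⟨k, h1, h2, h3⟩
  choose k hk1 hk2 hk3 using hex
  refine ⟨fun j => φ (k j), fun j => hφ _, ?_, ?_, tsum_ne_top_of_le_half_pow hk1⟩
  · have hK : ∀ j : ℕ, MeasurableSet (Metric.closedBall (0 : Sp n × ℝ) j) := fun j =>
      Metric.isClosed_closedBall.measurableSet
    have hs := ae_tsum_ne_top (μ := volume.restrict (upperHalf n))
      (F := fun j => (Metric.closedBall 0 (j : ℝ)).indicator fun p =>
        ENNReal.ofReal ((u p - φ (k j) p) ^ 2 * p.2 ^ s)) (fun j => ?_) ?_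
    · filter_upwards [hs, ae_restrict_mem (measurableSet_upperHalf n)] with p hp hpu
      refine tendsto_of_tendsto_ofReal_sq (Real.rpow_pos_of_pos hpu s) ?_
      refine (ENNReal.tendsto_atTop_zero_of_tsum_ne_top hp).congr' ?_
      obtain ⟨N, hN⟩ := exists_nat_ge ‖p‖
      filter_upwards [eventually_ge_atTop N] with j hj
      rw [indicator_of_mem]
      simp only [Metric.mem_closedBall, dist_zero_right]
      exact hN.trans (Nat.cast_le.2 hj)
    · refine AEMeasurable.indicator ?_ (hK j)
      have h1 := h.aesm_u.aemeasurable
      have h2 := (hφ (k j)).differentiable.continuous.measurable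
      fun_prop
    · refine tsum_ne_top_of_le_half_pow fun j => ?_
      rw [lintegral_indicator (hK j), Measure.restrict_restrict (hK j), inter_comm]
      exact hk2 j
  · have hK : ∀ j : ℕ, MeasurableSet (Metric.closedBall (0 : Sp n) j) := fun j =>
      Metric.isClosed_closedBall.measurableSet
    have hs := ae_tsum_ne_top (μ := (volume : Measure (Sp n)))
      (F := fun j => (Metric.closedBall 0 (j : ℝ)).indicator fun x =>
        ENNReal.ofReal ((f x - φ (k j) (x, 0)) ^ 2)) (fun j => ?_) ?_
    · filter_upwards [hs] with x hx
      refine tendsto_of_tendsto_ofReal_sq one_pos ?_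
      simp only [mul_one]
      refine (ENNReal.tendsto_atTop_zero_of_tsum_ne_top hx).congr' ?_
      obtain ⟨N, hN⟩ := exists_nat_ge ‖x‖
      filter_upwards [eventually_ge_atTop N] with j hj
      rw [indicator_of_mem]
      simp only [Metric.mem_closedBall, dist_zero_right]
      exact hN.trans (Nat.cast_le.2 hj)
    · refine AEMeasurable.indicator ?_ (hK j)
      have h1 := h.aesm_trace.aemeasurable
      have h2 := (hφ (k j)).differentiable.continuous.measurable
      fun_prop
    · refine tsum_ne_top_of_le_half_pow fun j => ?_
      rw [lintegral_indicator (hK j)]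
      exact hk3 j

/-! ### Rays -/

/-- The point with logarithmic height `τ` on the ray through `(y, 1)`. -/
noncomputable def ray {n : ℕ} (y : Sp n) (τ : ℝ) : Sp n × ℝ := (Real.exp τ • y, Real.exp τ)

lemma continuous_ray {n : ℕ} : Continuous fun q : Sp n × ℝ => ray q.1 q.2 := by
  unfold ray; fun_prop

lemma lintegral_comp_exp (g : ℝ → ENNReal) :
    ∫⁻ t in Ioi 0, g t = ∫⁻ τ, ENNReal.ofReal (Real.exp τ) * g (Real.exp τ) := by
  have h := lintegral_image_eq_lintegral_abs_deriv_mul (f := Real.exp) (f' := Real.exp)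
    MeasurableSet.univ (fun x _ => (Real.hasDerivAt_exp x).hasDerivWithinAt)
    Real.exp_injective.injOn g
  rw [image_univ, Real.range_exp, Measure.restrict_univ] at h
  simpa only [Real.abs_exp] using h

/-- Ray coordinates on the upper half space. -/
lemma lintegral_ray {n : ℕ} {F : Sp n × ℝ → ENNReal} (hF : Measurable F) :
    ∫⁻ p in upperHalf n, F p =
      ∫⁻ y, ∫⁻ τ, F (ray y τ) * ENNReal.ofReal (Real.exp (((n : ℝ) + 1) * τ)) := by
  rw [volume_restrict_upperHalf, lintegral_prod_symm' _ hF, lintegral_comp_exp,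
    lintegral_lintegral_swap]
  · refine lintegral_congr fun τ => ?_
    have h := Measure.map_addHaar_smul (volume : Measure (Sp n)) (Real.exp_pos τ).ne'
    rw [finrank_euclideanSpace_fin] at h
    have hFm : Measurable fun x => F (x, Real.exp τ) := hF.comp (by fun_prop)
    have h2 : ∫⁻ y, F (ray y τ) = ENNReal.ofReal |(Real.exp τ ^ n)⁻¹| *
        ∫⁻ x, F (x, Real.exp τ) := by
      rw [← smul_eq_mul, ← lintegral_smul_measure, ← h, lintegral_map hFm (measurable_const_smul _)]
      rfl
    -- The Jacobian `e^{(n+1)τ}` is the product of `e^τ` from `t = e^τ` and `e^{nτ}` from `x = e^τ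
    -- y`.
    have h3 : ENNReal.ofReal (Real.exp τ) = ENNReal.ofReal |(Real.exp τ ^ n)⁻¹| *
        ENNReal.ofReal (Real.exp (((n : ℝ) + 1) * τ)) := by
      rw [← ENNReal.ofReal_mul (abs_nonneg _), abs_of_pos (by positivity), ← Real.exp_nat_mul,
        ← Real.exp_neg, ← Real.exp_add]
      congr 2; ring
    rw [lintegral_mul_const, h2, h3]
    · ring
    · exact hF.comp ((continuous_ray (n := n)).measurable.comp (measurable_prodMk_right (y := τ)))
  · have := hF.comp (continuous_ray (n := n)).measurable
    refine Measurable.aemeasurable ?_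
    simp only [Function.uncurry_def]
    exact this.mul (by fun_prop)

lemma ray_mem_upperHalf {n : ℕ} (y : Sp n) (τ : ℝ) : ray y τ ∈ upperHalf n := Real.exp_pos τ

/-- In ray coordinates the exceptional set has zero measure for a strictly positive weight, so
almost every slice of it is null. -/
lemma ae_ray_of_ae {n : ℕ} {Q : Sp n × ℝ → Prop}
    (h : ∀ᵐ p ∂(volume.restrict (upperHalf n)), Q p) : ∀ᵐ y, ∀ᵐ τ, Q (ray y τ) := by
  obtain ⟨N, hNQ, hNm, hN⟩ := exists_measurable_superset_of_null h
  have h1 : ∫⁻ p in upperHalf n, N.indicator 1 p = 0 := by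
    rw [lintegral_indicator_one hNm, hN]
  rw [lintegral_ray (measurable_one.indicator hNm), lintegral_eq_zero_iff'] at h1
  · filter_upwards [h1] with y hy
    simp only [Pi.zero_apply] at hy
    rw [lintegral_eq_zero_iff'] at hy
    · filter_upwards [hy] with τ hτ
      by_contra hQ
      have : ray y τ ∈ N := hNQ hQ
      rw [indicator_of_mem this] at hτ
      simp only [Pi.one_apply, one_mul, Pi.zero_apply, ENNReal.ofReal_eq_zero] at hτ
      exact absurd hτ (not_le.2 (Real.exp_pos _))
    · refine (((measurable_one.indicator hNm).comp ?_).mul (by fun_prop)).aemeasurable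
      exact (continuous_ray (n := n)).measurable.comp (measurable_prodMk_left (x := y))
  · refine Measurable.aemeasurable ?_
    refine Measurable.lintegral_prod_right' (f := fun q : Sp n × ℝ =>
      N.indicator 1 (ray q.1 q.2) * ENNReal.ofReal (Real.exp (((n : ℝ) + 1) * q.2))) ?_
    exact ((measurable_one.indicator hNm).comp continuous_ray.measurable).mul (by fun_prop)

lemma euclLen_ray {n : ℕ} (y : Sp n) (τ : ℝ) :
    euclLen (ray y τ) = Real.exp τ * √(1 + ‖y‖ ^ 2) := by
  have : ray y τ = Real.exp τ • ((y, 1) : Sp n × ℝ) := by simp [ray]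
  rw [this, euclLen_smul (Real.exp_pos τ).le, euclLen]
  congr 2
  simp only
  ring

/-- The derivative of a field along the ray through `(y, 1)`. -/
noncomputable def rayDeriv {n : ℕ} (Gx : Sp n × ℝ → Sp n) (Gt : Sp n × ℝ → ℝ) (y : Sp n) (τ : ℝ) :
    ℝ :=
  inner ℝ (Gx (ray y τ)) (Real.exp τ • y) + Gt (ray y τ) * Real.exp τ

/-- Cauchy–Schwarz with the position vector, since `e^{2τ}(1 + |y|²)` is `|p|²` at the point `p` of
the ray. It bounds the radial part of a field by the whole field, so the limit gradient need not be
known to be radial. -/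
lemma rayDeriv_sq_le {n : ℕ} (Gx : Sp n × ℝ → Sp n) (Gt : Sp n × ℝ → ℝ) (y : Sp n) (τ : ℝ) :
    rayDeriv Gx Gt y τ ^ 2 ≤
      (‖Gx (ray y τ)‖ ^ 2 + Gt (ray y τ) ^ 2) * (Real.exp τ ^ 2 * (1 + ‖y‖ ^ 2)) := by
  have h1 := abs_real_inner_le_norm (Gx (ray y τ)) (Real.exp τ • y)
  rw [norm_smul, Real.norm_of_nonneg (Real.exp_pos τ).le] at h1
  have h2 : |rayDeriv Gx Gt y τ| ≤
      ‖Gx (ray y τ)‖ * (Real.exp τ * ‖y‖) + |Gt (ray y τ)| * Real.exp τ := by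
    refine (abs_add_le _ _).trans (add_le_add h1 (le_of_eq ?_))
    rw [abs_mul, Real.abs_exp]
  rw [← sq_abs]
  refine (pow_le_pow_left₀ (abs_nonneg _) h2 2).trans ?_
  have h3 := sq_nonneg (‖Gx (ray y τ)‖ - |Gt (ray y τ)| * ‖y‖)
  have h4 : |Gt (ray y τ)| ^ 2 = Gt (ray y τ) ^ 2 := sq_abs _
  rw [← h4]
  have h5 := mul_nonneg (sq_nonneg (Real.exp τ)) h3
  linear_combination h5

lemma rayDeriv_sub {n : ℕ} (Gx Hx : Sp n × ℝ → Sp n) (Gt Ht : Sp n × ℝ → ℝ) (y : Sp n) (τ : ℝ) :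
    rayDeriv Gx Gt y τ - rayDeriv Hx Ht y τ =
      rayDeriv (fun p => Gx p - Hx p) (fun p => Gt p - Ht p) y τ := by
  simp only [rayDeriv, inner_sub_left]; ring

lemma IsTest.hasDerivAt_ray {n : ℕ} {φ : Sp n × ℝ → ℝ} (hφ : IsTest φ) (y : Sp n) (τ : ℝ) :
    HasDerivAt (fun τ => φ (ray y τ)) (rayDeriv (gradX φ) (gradT φ) y τ) τ := by
  have h : HasDerivAt (ray y) (Real.exp τ • y, Real.exp τ) τ :=
    ((Real.hasDerivAt_exp τ).smul_const y).prodMk (Real.hasDerivAt_exp τ)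
  exact hφ.hasDerivAt_comp h

/-- Along almost every ray, the limit of the test functions is the integral of the limit of their
gradients. -/
lemma ae_ray_eq_integral {n : ℕ} {s : ℝ} {u : Sp n × ℝ → ℝ} {Gx : Sp n × ℝ → Sp n}
    {Gt : Sp n × ℝ → ℝ} (hGx : Measurable Gx) (hGt : Measurable Gt) {ψ : ℕ → Sp n × ℝ → ℝ}
    (hψ : ∀ j, IsTest (ψ j))
    (hu : ∀ᵐ p ∂(volume.restrict (upperHalf n)), Tendsto (fun j => ψ j p) atTop (𝓝 (u p)))
    (hE : ∑' j, ∫⁻ p in upperHalf n, gradDist s Gx Gt (ψ j) p ≠ ⊤) :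
    ∀ᵐ y, (∀ a b, IntervalIntegrable (rayDeriv Gx Gt y) volume a b) ∧
      ∃ c τ₀, ∀ᵐ τ, u (ray y τ) = c + ∫ t in τ₀..τ, rayDeriv Gx Gt y t := by
  have hE' : ∀ᵐ y : Sp n, ∑' j, ∫⁻ τ, gradDist s Gx Gt (ψ j) (ray y τ) *
      ENNReal.ofReal (Real.exp (((n : ℝ) + 1) * τ)) ≠ ⊤ := by
    refine ae_tsum_ne_top (fun j => Measurable.aemeasurable ?_) ?_
    · refine Measurable.lintegral_prod_right' (f := fun q : Sp n × ℝ =>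
        gradDist s Gx Gt (ψ j) (ray q.1 q.2) * ENNReal.ofReal (Real.exp (((n : ℝ) + 1) * q.2))) ?_
      exact ((measurable_gradDist hGx hGt (hψ j)).comp continuous_ray.measurable).mul (by fun_prop)
    · refine ne_of_eq_of_ne (tsum_congr fun j => ?_) hE
      rw [lintegral_ray (measurable_gradDist hGx hGt (hψ j))]
  filter_upwards [hE', ae_ray_of_ae hu] with y hy huy
  have hray : Continuous (ray y) := continuous_ray.comp (by fun_prop : Continuous fun τ => (y, τ))
  have hGm : Measurable (rayDeriv Gx Gt y) := by
    have h1 := hGx.comp hray.measurable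
    have h2 := hGt.comp hray.measurable
    exact (h1.inner (by fun_prop)).add (h2.mul (by fun_prop))
  have hψc : ∀ j, Continuous (rayDeriv (gradX (ψ j)) (gradT (ψ j)) y) := fun j => by
    have h1 := (hψ j).continuous_gradX.comp hray
    have h2 := (hψ j).continuous_gradT.comp hray
    exact (h1.inner (by fun_prop)).add (h2.mul (by fun_prop))
  have hlim := ENNReal.tendsto_atTop_zero_of_tsum_ne_top hy
  -- The Jacobian `e^{(n+1)τ}` times `tˢ = e^{sτ}`, divided by the factor `|p|²` lost in passing to
  -- the derivative along the ray. It is continuous and positive, so its inverse is integrable on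
  -- bounded intervals.
  set w : ℝ → ℝ := fun τ => Real.exp (((n : ℝ) - 1 + s) * τ) / (1 + ‖y‖ ^ 2) with hw
  have hw0 : ∀ τ, 0 < w τ := fun τ => by positivity
  have hwc : Continuous w := by
    refine Continuous.div_const ?_ _
    fun_prop
  have key : ∀ a b, a ≤ b → IntervalIntegrable (rayDeriv Gx Gt y) volume a b ∧
      Tendsto (fun j => ∫ t in a..b, rayDeriv (gradX (ψ j)) (gradT (ψ j)) y t) atTop
        (𝓝 (∫ t in a..b, rayDeriv Gx Gt y t)) := by
    intro a b hab
    refine tendsto_intervalIntegral_of_weighted hab hψc hGm hwc.measurable (fun t _ => hw0 t) ?_ ?_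
    · exact (((hwc.inv₀ fun t => (hw0 t).ne').intervalIntegrable a b).1)
    · refine tendsto_of_tendsto_of_tendsto_of_le_of_le tendsto_const_nhds hlim (fun _ => zero_le)
        fun j => ?_
      refine (setLIntegral_le_lintegral _ _).trans (lintegral_mono fun τ => ?_)
      rw [gradDist, ← ENNReal.ofReal_mul' (Real.exp_pos _).le]
      refine ENNReal.ofReal_le_ofReal ?_
      rw [rayDeriv_sub]
      have h1 := mul_le_mul_of_nonneg_right (rayDeriv_sq_le (fun p => Gx p - gradX (ψ j) p)
        (fun p => Gt p - gradT (ψ j) p) y τ) (hw0 τ).le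
      refine h1.trans (le_of_eq ?_)
      have h2 : (ray y τ).2 ^ s * Real.exp (((n : ℝ) + 1) * τ) =
          Real.exp τ ^ 2 * Real.exp (((n : ℝ) - 1 + s) * τ) := by
        simp only [ray]
        rw [← Real.exp_mul, ← Real.exp_nat_mul, ← Real.exp_add, ← Real.exp_add]
        congr 1; push_cast; ring
      rw [mul_assoc _ ((ray y τ).2 ^ s), h2, hw]
      field_simp
  have key' : ∀ a b, IntervalIntegrable (rayDeriv Gx Gt y) volume a b ∧
      Tendsto (fun j => ∫ t in a..b, rayDeriv (gradX (ψ j)) (gradT (ψ j)) y t) atTop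
        (𝓝 (∫ t in a..b, rayDeriv Gx Gt y t)) := fun a b => by
    rcases le_total a b with hab | hab
    · exact key a b hab
    · refine ⟨(key b a hab).1.symm, ?_⟩
      simp only [intervalIntegral.integral_symm b a]
      exact (key b a hab).2.neg
  refine ⟨fun a b => (key' a b).1, ?_⟩
  obtain ⟨τ₀, hτ₀⟩ := huy.exists
  refine ⟨u (ray y τ₀), τ₀, huy.mono fun τ hτ => ?_⟩
  refine tendsto_nhds_unique hτ ((hτ₀.add (key' τ₀ τ).2).congr fun j => ?_)
  rw [intervalIntegral.integral_eq_sub_of_hasDerivAt (fun t _ => (hψ j).hasDerivAt_ray y t)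
    ((hψc j).intervalIntegrable _ _)]
  ring

/-- On almost every vertical line, the limit of the test functions is the trace plus the integral
of the vertical derivative. -/
lemma ae_vertical_eq_integral {n : ℕ} {s : ℝ} (hs : s < 1) {u : Sp n × ℝ → ℝ}
    {Gx : Sp n × ℝ → Sp n} {Gt : Sp n × ℝ → ℝ} {f : Sp n → ℝ} (hGx : Measurable Gx)
    (hGt : Measurable Gt) {ψ : ℕ → Sp n × ℝ → ℝ} (hψ : ∀ j, IsTest (ψ j))
    (hu : ∀ᵐ p ∂(volume.restrict (upperHalf n)), Tendsto (fun j => ψ j p) atTop (𝓝 (u p)))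
    (hf : ∀ᵐ x, Tendsto (fun j => ψ j (x, 0)) atTop (𝓝 (f x)))
    (hE : ∑' j, ∫⁻ p in upperHalf n, gradDist s Gx Gt (ψ j) p ≠ ⊤) :
    ∀ᵐ x, IntervalIntegrable (fun t => Gt (x, t)) volume 0 1 ∧
      ∀ᵐ t, t ∈ Ioc (0 : ℝ) 1 → u (x, t) = f x + ∫ τ in (0 : ℝ)..t, Gt (x, τ) := by
  rw [volume_restrict_upperHalf] at hu hE
  have hE' : ∀ᵐ x : Sp n, ∑' j, ∫⁻ t in Ioi 0, gradDist s Gx Gt (ψ j) (x, t) ≠ ⊤ := by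
    refine ae_tsum_ne_top (fun j => Measurable.aemeasurable ?_) ?_
    · exact (measurable_gradDist hGx hGt (hψ j)).lintegral_prod_right'
    · refine ne_of_eq_of_ne (tsum_congr fun j => ?_) hE
      rw [lintegral_prod _ (measurable_gradDist hGx hGt (hψ j)).aemeasurable]
  filter_upwards [hE', hf, Measure.ae_ae_of_ae_prod hu] with x hx hfx hux
  have hGm : Measurable fun t => Gt (x, t) := hGt.comp (by fun_prop)
  have hψc : ∀ j, Continuous fun t => gradT (ψ j) (x, t) := fun j =>
    (hψ j).continuous_gradT.comp (by fun_prop)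
  have hlim := ENNReal.tendsto_atTop_zero_of_tsum_ne_top hx
  have key : ∀ b, 0 ≤ b → IntervalIntegrable (fun t => Gt (x, t)) volume 0 b ∧
      Tendsto (fun j => ∫ t in (0 : ℝ)..b, gradT (ψ j) (x, t)) atTop
        (𝓝 (∫ t in (0 : ℝ)..b, Gt (x, t))) := by
    intro b hb
    refine tendsto_intervalIntegral_of_weighted (w := fun t => t ^ s) hb hψc hGm (by fun_prop)
      (fun t ht => Real.rpow_pos_of_pos ht.1 s) ?_ ?_
    -- The inverse weight `t⁻ˢ` is integrable down to the boundary because `s < 1`; this makes the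
    -- trace meaningful.
    · have h1 := (intervalIntegral.intervalIntegrable_rpow' (a := 0) (b := b) (r := -s)
        (by linarith)).1
      refine h1.congr_fun (fun t ht => ?_) measurableSet_Ioc
      exact Real.rpow_neg ht.1.le s
    · refine tendsto_of_tendsto_of_tendsto_of_le_of_le tendsto_const_nhds hlim (fun _ => zero_le)
        fun j => ?_
      refine (lintegral_mono_set Ioc_subset_Ioi_self).trans
        (setLIntegral_mono' measurableSet_Ioi fun t ht => ?_)
      refine ENNReal.ofReal_le_ofReal (mul_le_mul_of_nonneg_right ?_ (Real.rpow_nonneg (le_of_lt ht) s))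
      exact le_add_of_nonneg_left (sq_nonneg _)
  refine ⟨(key 1 zero_le_one).1, ?_⟩
  filter_upwards [(ae_restrict_iff' measurableSet_Ioi).1 hux] with t ht htI
  refine tendsto_nhds_unique (ht htI.1) ((hfx.add (key t htI.1.le).2).congr fun j => ?_)
  have hd : ∀ τ ∈ uIcc 0 t, HasDerivAt (fun τ => ψ j (x, τ)) (gradT (ψ j) (x, τ)) τ := fun τ _ => by
    have h := (hψ j).hasDerivAt_comp (γ := fun τ => (x, τ)) (v := 0) (w := 1) (τ := τ)
      ((hasDerivAt_const τ x).prodMk (hasDerivAt_id τ))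
    simpa using h
  rw [intervalIntegral.integral_eq_sub_of_hasDerivAt hd ((hψc j).intervalIntegrable _ _)]
  ring

/-! ### Primitives on the line and transfer of null sets. -/

lemma LocAC.const_add_integral {h : ℝ → ℝ} (hh : ∀ a b, IntervalIntegrable h volume a b)
    (c τ₀ : ℝ) : LocAC fun τ => c + ∫ t in τ₀..τ, h t := by
  intro a b
  have h1 := (hh (min τ₀ (min a b)) (max τ₀ (max a b))).absolutelyContinuousOnInterval_intervalIntegral
    (c := τ₀) (by rw [uIcc_of_le (by simp)]; simp)
  have h2 : AbsolutelyContinuousOnInterval (fun _ : ℝ => c) a b :=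
    contDiff_const.contDiffOn.absolutelyContinuousOnInterval
  refine h2.fun_add (h1.mono ?_)
  rw [uIcc_of_le (a := min τ₀ (min a b)) (by simp)]
  exact Icc_subset_Icc (min_le_right _ _) (le_max_right _ _)

lemma ae_hasDerivAt_const_add_integral {h : ℝ → ℝ} (hh : ∀ a b, IntervalIntegrable h volume a b)
    (c τ₀ : ℝ) : ∀ᵐ x, HasDerivAt (fun τ => c + ∫ t in τ₀..τ, h t) (h x) x := by
  have h1 : ∀ k : ℕ, ∀ᵐ x, x ∈ uIcc (-(k : ℝ)) k → ∀ c ∈ uIcc (-(k : ℝ)) k,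
      HasDerivAt (fun x => ∫ t in c..x, h t) (h x) x := fun k => (hh _ _).ae_hasDerivAt_integral
  filter_upwards [ae_all_iff.2 h1] with x hx
  obtain ⟨k, hk⟩ := exists_nat_ge (max |x| |τ₀|)
  have hmem : ∀ y : ℝ, |y| ≤ k → y ∈ uIcc (-(k : ℝ)) k := fun y hy => by
    rw [uIcc_of_le (by linarith [abs_nonneg y])]
    exact abs_le.1 hy
  exact (hx k (hmem x ((le_max_left _ _).trans hk)) τ₀
    (hmem τ₀ ((le_max_right _ _).trans hk))).const_add c

lemma ae_add_right {Q : ℝ → Prop} (h : ∀ᵐ τ, Q τ) (c : ℝ) : ∀ᵐ τ, Q (τ + c) :=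
  (measurePreserving_add_right volume c).quasiMeasurePreserving.ae h

/-- The law of `ln |p|` under `tˢ dx dt` has a density, and `tˢ > 0` on the half space; so null sets
of radii pull back to null sets. -/
lemma ae_log_euclLen {n : ℕ} {s : ℝ} (hs : -1 < s) {Q : ℝ → Prop} (h : ∀ᵐ σ, Q σ) :
    ∀ᵐ p ∂(volume.restrict (upperHalf n)), Q (Real.log (euclLen p)) := by
  have h1 : ∀ᵐ σ ∂((halfMeasure n s).map fun p => Real.log (euclLen p)), Q σ := by
    rw [map_log_euclLen n hs]
    exact (withDensity_absolutelyContinuous _ _).ae_le h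
  have h2 := ae_of_ae_map measurable_log_euclLen.aemeasurable h1
  rw [halfMeasure, ae_withDensity_iff (measurable_rpow_snd s)] at h2
  filter_upwards [h2, ae_restrict_mem (measurableSet_upperHalf n)] with p hp hpu
  refine hp ?_
  have : 0 < p.2 ^ s := Real.rpow_pos_of_pos hpu s
  simpa using this

lemma halfMeasure_euclLen_le_lt_top {n : ℕ} {s : ℝ} (hs : -1 < s) (y : ℝ) :
    halfMeasure n s {p | Real.log (euclLen p) ≤ y} < ⊤ := by
  have hG1 : 0 < Real.Gamma ((1 + s) / 2) := Real.Gamma_pos_of_pos (by linarith)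
  have hn : (0 : ℝ) ≤ n := n.cast_nonneg
  have hG2 : 0 < Real.Gamma (((n : ℝ) + 1 + s) / 2) := Real.Gamma_pos_of_pos (by linarith)
  have h := map_log_euclLen n hs
  have h1 := Measure.map_apply (μ := halfMeasure n s) measurable_log_euclLen
    (measurableSet_Iic (a := y))
  rw [h, withDensity_exp_Iic (by unfold halfSphereArea; positivity) (by linarith)] at h1
  have h2 : (fun p : Sp n × ℝ => Real.log (euclLen p)) ⁻¹' Iic y =
    {p | Real.log (euclLen p) ≤ y} := rfl
  rw [← h2, ← h1]
  exact ENNReal.ofReal_lt_top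

/-! ### Finiteness of the energy. -/

/-- The squared gradient is bounded with compact support, and half balls have finite `tˢ`-measure
since `s > -1`. -/
lemma IsTest.lintegral_grad_ne_top {n : ℕ} {s : ℝ} (hs : -1 < s) {φ : Sp n × ℝ → ℝ}
    (hφ : IsTest φ) : ∫⁻ p in upperHalf n,
      ENNReal.ofReal ((‖gradX φ p‖ ^ 2 + gradT φ p ^ 2) * p.2 ^ s) ≠ ⊤ := by
  set F : Sp n × ℝ → ℝ := fun p => ‖gradX φ p‖ ^ 2 + gradT φ p ^ 2 with hF
  have hFc : Continuous F := (hφ.continuous_gradX.norm.pow 2).add (hφ.continuous_gradT.pow 2)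
  have hFs : HasCompactSupport F := by
    refine (hφ.2.fderiv (𝕜 := ℝ)).mono fun p hp => ?_
    contrapose! hp
    have h0 : fderiv ℝ φ p = 0 := by simpa using hp
    simp [hF, gradX_eq (hφ.differentiable p), gradT_eq (hφ.differentiable p), h0]
  obtain ⟨C, hC⟩ := hFs.exists_bound_of_continuous hFc
  obtain ⟨R, hR⟩ := hFs.isCompact.exists_bound_of_continuousOn (f := euclLen)
    continuous_euclLen.continuousOn
  have h1 : ∫⁻ p in upperHalf n, ENNReal.ofReal (F p * p.2 ^ s) =
      ∫⁻ p, ENNReal.ofReal (F p) ∂halfMeasure n s := by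
    rw [lintegral_halfMeasure s (by have := hFc.measurable; fun_prop)]
    refine lintegral_congr fun p => ?_
    rw [ENNReal.ofReal_mul (by positivity)]
  rw [h1]
  have hms : MeasurableSet {p : Sp n × ℝ | Real.log (euclLen p) ≤ R} :=
    measurableSet_le measurable_log_euclLen measurable_const
  have h2 : ∀ p, ENNReal.ofReal (F p) ≤
      {p : Sp n × ℝ | Real.log (euclLen p) ≤ R}.indicator (fun _ => ENNReal.ofReal C) p := by
    intro p
    by_cases hp : p ∈ {p : Sp n × ℝ | Real.log (euclLen p) ≤ R}
    · rw [indicator_of_mem hp]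
      exact ENNReal.ofReal_le_ofReal ((le_abs_self _).trans (hC p))
    · rw [indicator_of_notMem hp]
      have : F p = 0 := by
        by_contra hne
        refine hp ?_
        have h3 := hR p (subset_tsupport _ hne)
        rw [Real.norm_of_nonneg (euclLen_nonneg p)] at h3
        exact (Real.log_le_self (euclLen_nonneg p)).trans h3
      simp [this]
  refine ne_of_lt (lt_of_le_of_lt (lintegral_mono h2) ?_)
  rw [lintegral_indicator_const hms]
  exact ENNReal.mul_lt_top ENNReal.ofReal_lt_top (halfMeasure_euclLen_le_lt_top hs R)

lemma MemW.lintegral_energy_ne_top {n : ℕ} {s : ℝ} (hs : -1 < s) {u : Sp n × ℝ → ℝ}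
    {Gx : Sp n × ℝ → Sp n} {Gt : Sp n × ℝ → ℝ} {f : Sp n → ℝ} (h : MemW s u Gx Gt f) :
    ∫⁻ p in upperHalf n, ENNReal.ofReal ((‖Gx p‖ ^ 2 + Gt p ^ 2) * p.2 ^ s) ≠ ⊤ := by
  obtain ⟨φ, hφ, hE, -⟩ := h.approx
  obtain ⟨k, hk⟩ := (hE.eventually (gt_mem_nhds ENNReal.zero_lt_top)).exists
  have hgx := (hφ k).continuous_gradX.measurable
  have hgt := (hφ k).continuous_gradT.measurable
  have h1 : ∀ p ∈ upperHalf n, ENNReal.ofReal ((‖Gx p‖ ^ 2 + Gt p ^ 2) * p.2 ^ s) ≤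
      ENNReal.ofReal 2 *
        ENNReal.ofReal ((‖Gx p - gradX (φ k) p‖ ^ 2 + (Gt p - gradT (φ k) p) ^ 2) * p.2 ^ s) +
      ENNReal.ofReal 2 * ENNReal.ofReal ((‖gradX (φ k) p‖ ^ 2 + gradT (φ k) p ^ 2) * p.2 ^ s) := fun p hp => by
    have hps : 0 ≤ p.2 ^ s := Real.rpow_nonneg (le_of_lt hp) s
    rw [← ENNReal.ofReal_mul zero_le_two, ← ENNReal.ofReal_mul zero_le_two,
      ← ENNReal.ofReal_add (by positivity) (by positivity)]
    refine ENNReal.ofReal_le_ofReal ?_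
    have h3 : ‖Gx p‖ ^ 2 ≤ 2 * ‖Gx p - gradX (φ k) p‖ ^ 2 + 2 * ‖gradX (φ k) p‖ ^ 2 := by
      have h4 : ‖Gx p‖ ≤ ‖Gx p - gradX (φ k) p‖ + ‖gradX (φ k) p‖ := by
        simpa using norm_add_le (Gx p - gradX (φ k) p) (gradX (φ k) p)
      nlinarith [norm_nonneg (Gx p), sq_nonneg (‖Gx p - gradX (φ k) p‖ - ‖gradX (φ k) p‖)]
    have h5 : Gt p ^ 2 ≤ 2 * (Gt p - gradT (φ k) p) ^ 2 + 2 * gradT (φ k) p ^ 2 := by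
      nlinarith [sq_nonneg (Gt p - gradT (φ k) p - gradT (φ k) p)]
    have h6 := mul_le_mul_of_nonneg_right (add_le_add h3 h5) hps
    linarith
  refine ne_of_lt (lt_of_le_of_lt (setLIntegral_mono' (measurableSet_upperHalf n) h1) ?_)
  rw [lintegral_add_right _ (by fun_prop), lintegral_const_mul' _ _ (by simp),
    lintegral_const_mul' _ _ (by simp)]
  exact ENNReal.add_lt_top.2 ⟨ENNReal.mul_lt_top (by simp) hk,
    ENNReal.mul_lt_top (by simp) ((hφ k).lintegral_grad_ne_top hs).lt_top⟩

/-- The Bochner integral is `0` for a non-integrable function. Finiteness of the energy on the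
completion guarantees that `energy` is the true integral. -/
lemma MemW.ofReal_energy {n : ℕ} {s : ℝ} (hs : -1 < s) {u : Sp n × ℝ → ℝ}
    {Gx : Sp n × ℝ → Sp n} {Gt : Sp n × ℝ → ℝ} {f : Sp n → ℝ} (h : MemW s u Gx Gt f) :
    ENNReal.ofReal (energy s Gx Gt) =
      ∫⁻ p in upperHalf n, ENNReal.ofReal ((‖Gx p‖ ^ 2 + Gt p ^ 2) * p.2 ^ s) := by
  have hx := h.aesm_gradX
  have ht := h.aesm_gradT
  have h0 : 0 ≤ᵐ[volume.restrict (upperHalf n)] fun p => (‖Gx p‖ ^ 2 + Gt p ^ 2) * p.2 ^ s := by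
    filter_upwards [ae_restrict_mem (measurableSet_upperHalf n)] with p hp
    have hps : 0 ≤ p.2 ^ s := Real.rpow_nonneg (le_of_lt hp) s
    simp only [Pi.zero_apply]; positivity
  refine ofReal_integral_eq_lintegral_ofReal ⟨?_, ?_⟩ h0
  · have h3 : AEStronglyMeasurable (fun p : Sp n × ℝ => p.2 ^ s)
        (volume.restrict (upperHalf n)) := by
      have : Measurable fun p : Sp n × ℝ => p.2 ^ s := by fun_prop
      exact this.aestronglyMeasurable
    exact ((hx.norm.pow 2).add (ht.pow 2)).mul h3
  · rw [hasFiniteIntegral_iff_ofReal h0]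
    exact (h.lintegral_energy_ne_top hs).lt_top

/-- A radial element of the completion has a locally absolutely continuous profile in the
logarithmic radial variable, whose weighted energy is at most the energy of the function. -/
theorem MemW.exists_profile {n : ℕ} {s : ℝ} (hs : s ∈ Ioo (-1 : ℝ) 1) (hn : 0 < n)
    {u : Sp n × ℝ → ℝ} {Gx : Sp n × ℝ → Sp n} {Gt : Sp n × ℝ → ℝ} {f : Sp n → ℝ}
    (h : MemW s u Gx Gt f) (hr : IsRadial u) :
    ∃ V : ℝ → ℝ, LocAC V ∧ (∀ᵐ x, f x = V (Real.log ‖x‖)) ∧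
      MemLp (fun y => Real.exp (((n : ℝ) - 1 + s) / 2 * y) * deriv V y) 2 ∧
      halfSphereArea n s * ∫ y, (Real.exp (((n : ℝ) - 1 + s) / 2 * y) * deriv V y) ^ 2 ≤
        energy s Gx Gt := by
  obtain ⟨v, -, huv⟩ := hr
  obtain ⟨ψ, hψ, hψu, hψf, hψE⟩ := h.exists_seq
  have hn' : (0 : ℝ) < n := Nat.cast_pos.2 hn
  have hfin := h.ofReal_energy hs.1
  -- Measurable representatives are taken so that the fields can be restricted to individual rays
  -- and vertical lines.
  set Hx := h.aesm_gradX.mk Gx with hHx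
  set Ht := h.aesm_gradT.mk Gt with hHt
  have eHx : Gx =ᵐ[volume.restrict (upperHalf n)] Hx := h.aesm_gradX.ae_eq_mk
  have eHt : Gt =ᵐ[volume.restrict (upperHalf n)] Ht := h.aesm_gradT.ae_eq_mk
  have mHx : Measurable Hx := h.aesm_gradX.stronglyMeasurable_mk.measurable
  have mHt : Measurable Ht := h.aesm_gradT.stronglyMeasurable_mk.measurable
  have hψE' : ∑' j, ∫⁻ p in upperHalf n, gradDist s Hx Ht (ψ j) p ≠ ⊤ := by
    refine ne_of_eq_of_ne (tsum_congr fun j => lintegral_congr_ae ?_) hψE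
    filter_upwards [eHx, eHt] with p h1 h2
    simp only [gradDist, h1, h2]
  have hψv : ∀ᵐ p ∂(volume.restrict (upperHalf n)),
      Tendsto (fun j => ψ j p) atTop (𝓝 (v (euclLen p))) := by
    filter_upwards [hψu, huv] with p h1 h2
    rwa [← h2]
  have hrays := ae_ray_eq_integral mHx mHt hψ hψv hψE'
  have hlen : ∀ y : Sp n, 0 < √(1 + ‖y‖ ^ 2) := fun y => by positivity
  have hexp : ∀ (y : Sp n) τ, euclLen (ray y τ) = Real.exp (τ + Real.log √(1 + ‖y‖ ^ 2)) :=
    fun y τ => by rw [euclLen_ray, Real.exp_add, Real.exp_log (hlen y)]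
  -- A single good ray defines the profile; radiality carries it to the whole half space. The shift
  -- `c₀` converts the height parameter on this ray to the logarithmic radius.
  obtain ⟨y₀, hloc, c, τ₀, hτ₀⟩ := hrays.exists
  set c₀ := Real.log √(1 + ‖y₀‖ ^ 2) with hc₀
  set V : ℝ → ℝ := fun σ => c + ∫ t in (τ₀ + c₀)..σ, rayDeriv Hx Ht y₀ (t - c₀) with hV
  have hlocV : ∀ a b, IntervalIntegrable (fun t => rayDeriv Hx Ht y₀ (t - c₀)) volume a b :=
    fun a b => by
      have := (hloc (a - c₀) (b - c₀)).comp_sub_right c₀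
      simpa using this
  have hVac : LocAC V := LocAC.const_add_integral hlocV _ _
  have hvV : ∀ᵐ σ, v (Real.exp σ) = V σ := by
    filter_upwards [ae_add_right hτ₀ (-c₀)] with σ hσ
    rw [hexp, ← hc₀, neg_add_cancel_right] at hσ
    rw [hσ, hV]
    simp only
    rw [intervalIntegral.integral_comp_sub_right (fun t => rayDeriv Hx Ht y₀ t) c₀,
      add_sub_cancel_right, sub_eq_add_neg]
  have hVlog : ∀ᵐ p ∂(volume.restrict (upperHalf n)),
      v (euclLen p) = V (Real.log (euclLen p)) := by
    filter_upwards [ae_log_euclLen hs.1 hvV, ae_restrict_mem (measurableSet_upperHalf n)]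
      with p hp hpu
    rwa [Real.exp_log (euclLen_pos hpu)] at hp
  -- On almost every other ray, the shifted profile and the primitive of the field agree almost
  -- everywhere. Both are continuous, so they agree identically and their derivatives coincide.
  have hderiv : ∀ᵐ y, ∀ᵐ τ, deriv V (Real.log (euclLen (ray y τ))) = rayDeriv Hx Ht y τ := by
    filter_upwards [hrays, ae_ray_of_ae hVlog] with y hy hyV
    obtain ⟨hlocy, c', τ', hy⟩ := hy
    set cy := Real.log √(1 + ‖y‖ ^ 2) with hcy
    have hlogray : ∀ τ, Real.log (euclLen (ray y τ)) = τ + cy := fun τ => by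
      rw [hexp, Real.log_exp]
    have hae : (fun τ => V (τ + cy)) =ᵐ[volume]
        fun τ => c' + ∫ t in τ'..τ, rayDeriv Hx Ht y t := by
      filter_upwards [hy, hyV] with τ h1 h2
      rw [← h1, h2, hlogray]
    have heq := (Continuous.ae_eq_iff_eq volume (hVac.continuous.comp (continuous_add_const cy))
      (LocAC.const_add_integral hlocy c' τ').continuous).1 hae
    filter_upwards [ae_hasDerivAt_const_add_integral hlocy c' τ'] with τ hτ
    rw [hlogray, ← hτ.deriv, ← heq]
    exact (deriv_comp_add_const V cy τ).symm
  set a := ((n : ℝ) - 1 + s) / 2 with ha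
  have hmeasV : Measurable (deriv V) := measurable_deriv V
  have hA : 0 < halfSphereArea n s := by
    have hG1 : 0 < Real.Gamma ((1 + s) / 2) := Real.Gamma_pos_of_pos (by linarith [hs.1])
    have hG2 : 0 < Real.Gamma (((n : ℝ) + 1 + s) / 2) := Real.Gamma_pos_of_pos (by linarith [hs.1])
    unfold halfSphereArea; positivity
  have hlen2 : ENNReal.ofReal (halfSphereArea n s) *
      ∫⁻ y, ENNReal.ofReal ((Real.exp (a * y) * deriv V y) ^ 2) ≤
      ENNReal.ofReal (energy s Gx Gt) := by
    set Fn : Sp n × ℝ → ENNReal := fun p =>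
      ENNReal.ofReal (deriv V (Real.log (euclLen p)) ^ 2 * Real.exp (-2 * Real.log (euclLen p)))
      with hFn
    have hFm : Measurable fun σ => ENNReal.ofReal (deriv V σ ^ 2 * Real.exp (-2 * σ)) := by fun_prop
    have hFnm : Measurable Fn := hFm.comp measurable_log_euclLen
    have e1 : ∫⁻ p, Fn p ∂halfMeasure n s = ENNReal.ofReal (halfSphereArea n s) *
        ∫⁻ y, ENNReal.ofReal ((Real.exp (a * y) * deriv V y) ^ 2) := by
      rw [hFn, ← lintegral_map hFm measurable_log_euclLen, map_log_euclLen n hs.1,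
        lintegral_withDensity_eq_lintegral_mul _ (by fun_prop) hFm,
        ← lintegral_const_mul _ (by fun_prop)]
      refine lintegral_congr fun y => ?_
      rw [Pi.mul_apply, ← ENNReal.ofReal_mul (by positivity), ← ENNReal.ofReal_mul hA.le]
      congr 1
      have : Real.exp (((n : ℝ) + 1 + s) * y) * Real.exp (-2 * y) = Real.exp (a * y) ^ 2 := by
        rw [← Real.exp_add, ← Real.exp_nat_mul]; congr 1; rw [ha]; push_cast; ring
      rw [mul_pow, ← this]; ring
    have e2 : ∫⁻ p in upperHalf n, ENNReal.ofReal ((‖Gx p‖ ^ 2 + Gt p ^ 2) * p.2 ^ s) =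
        ∫⁻ p in upperHalf n, ENNReal.ofReal ((‖Hx p‖ ^ 2 + Ht p ^ 2) * p.2 ^ s) := by
      refine lintegral_congr_ae ?_
      filter_upwards [eHx, eHt] with p h1 h2
      simp only [h1, h2]
    rw [← e1, hfin, e2, lintegral_halfMeasure s hFnm, lintegral_ray (by fun_prop),
      lintegral_ray (by fun_prop)]
    -- The energy comparison holds pointwise on rays: `V'² / |p|²` is at most the squared length of
    -- the field.
    refine lintegral_mono_ae (hderiv.mono fun y hy => lintegral_mono_ae (hy.mono fun τ hτ => ?_))
    refine mul_le_mul_left ?_ _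
    have hps : 0 < (ray y τ).2 ^ s := Real.rpow_pos_of_pos (ray_mem_upperHalf y τ) s
    rw [hFn, ← ENNReal.ofReal_mul (by positivity)]
    refine ENNReal.ofReal_le_ofReal (mul_le_mul_of_nonneg_right ?_ hps.le)
    rw [hτ]
    have h1 := rayDeriv_sq_le Hx Ht y τ
    have h2 : Real.exp τ ^ 2 * (1 + ‖y‖ ^ 2) =
        Real.exp (2 * Real.log (euclLen (ray y τ))) := by
      rw [two_mul, Real.exp_add, Real.exp_log (euclLen_pos (ray_mem_upperHalf y τ)), euclLen_ray,
        ← pow_two, mul_pow, Real.sq_sqrt (by positivity)]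
    rw [h2] at h1
    rw [neg_mul, Real.exp_neg, ← div_eq_mul_inv]
    exact (div_le_iff₀ (Real.exp_pos _)).2 h1
  have hmeas2 : Measurable fun y => Real.exp (a * y) * deriv V y := by fun_prop
  have hsqint : Integrable fun y => (Real.exp (a * y) * deriv V y) ^ 2 := by
    refine ⟨(hmeas2.pow_const 2).aestronglyMeasurable, ?_⟩
    rw [hasFiniteIntegral_iff_ofReal (ae_of_all _ fun y => sq_nonneg _)]
    refine lt_of_le_of_ne le_top fun htop => ?_
    rw [htop, ENNReal.mul_top (by simpa using hA)] at hlen2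
    exact absurd hlen2 (by simp)
  refine ⟨V, hVac, ?_, (memLp_two_iff_integrable_sq hmeas2.aestronglyMeasurable).2 hsqint, ?_⟩
  · have hvert := ae_vertical_eq_integral hs.2 mHx mHt hψ hψv hψf hψE'
    have hne : ∀ᵐ x : Sp n, x ≠ 0 := by
      have : Nonempty (Fin n) := ⟨⟨0, hn⟩⟩
      simp [ae_iff, measure_singleton]
    have hVl := hVlog
    rw [volume_restrict_upperHalf] at hVl
    filter_upwards [hvert, Measure.ae_ae_of_ae_prod hVl, hne] with x hx hxV hx0
    obtain ⟨hint, hx⟩ := hx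
    -- On a good vertical line the identity `V(ln |(x,t)|) - ∫₀ᵗ = f(x)` holds for almost every
    -- small `t`, hence for `t` arbitrarily close to `0`. The left side converges to `V(ln |x|)`,
    -- which identifies the trace.
    have hfreq : ∃ᶠ t in 𝓝[>] (0 : ℝ),
        V (Real.log (euclLen (x, t))) - ∫ τ in (0 : ℝ)..t, Ht (x, τ) = f x := by
      have h1 : ∀ᵐ t, t ∈ Ioc (0 : ℝ) 1 →
          V (Real.log (euclLen (x, t))) - ∫ τ in (0 : ℝ)..t, Ht (x, τ) = f x := by
        filter_upwards [hx, (ae_restrict_iff' measurableSet_Ioi).1 hxV] with t h1 h2 ht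
        rw [← h2 ht.1, h1 ht, add_sub_cancel_right]
      intro hev
      obtain ⟨δ, hδ, hδ'⟩ := mem_nhdsGT_iff_exists_Ioo_subset.1 hev
      have hδ0 : 0 < min δ 1 := lt_min hδ one_pos
      have h2 : volume (Ioo 0 (min δ 1)) ≠ 0 := by
        rw [Real.volume_Ioo]; simpa using hδ0
      refine h2 (measure_mono_null (fun t ht => ?_) h1)
      simp only [mem_compl_iff, mem_ofPred_eq, Classical.not_imp]
      exact ⟨⟨ht.1, ht.2.le.trans (min_le_right _ _)⟩,
        hδ' ⟨ht.1, ht.2.trans_le (min_le_left _ _)⟩⟩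
    have hlim1 : Tendsto (fun t => V (Real.log (euclLen (x, t)))) (𝓝[>] (0 : ℝ))
        (𝓝 (V (Real.log (euclLen (x, (0 : ℝ)))))) := by
      have h0 : euclLen (x, (0 : ℝ)) ≠ 0 := by
        simp [euclLen, Real.sqrt_sq (norm_nonneg x), hx0]
      have hc : ContinuousAt (fun t : ℝ => V (Real.log (euclLen (x, t)))) 0 := by
        refine hVac.continuous.continuousAt.comp (ContinuousAt.log ?_ h0)
        exact (continuous_euclLen.comp (by fun_prop)).continuousAt
      exact hc.tendsto.mono_left nhdsWithin_le_nhds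
    have hlim2 : Tendsto (fun t => ∫ τ in (0 : ℝ)..t, Ht (x, τ)) (𝓝[>] (0 : ℝ)) (𝓝 0) := by
      have h1 := (hint.absolutelyContinuousOnInterval_intervalIntegral (c := 0)
        (by simp)).continuousOn
      rw [uIcc_of_le zero_le_one] at h1
      have h2 := (h1 0 (by simp)).tendsto
      rw [intervalIntegral.integral_same] at h2
      exact h2.mono_left (nhdsWithin_le_of_mem (mem_of_superset
        (Ioo_mem_nhdsGT one_pos) Ioo_subset_Icc_self))
    have hlim3 := hlim1.sub hlim2
    have h0 : euclLen (x, (0 : ℝ)) = ‖x‖ := by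
      simp [euclLen, Real.sqrt_sq (norm_nonneg x)]
    rw [sub_zero, h0] at hlim3
    by_contra hne
    have hev := hlim3.eventually_ne (Ne.symm hne)
    obtain ⟨t, ht1, ht2⟩ := (hfreq.and_eventually hev).exists
    exact ht2 ht1
  · have h1 : 0 ≤ᵐ[volume] fun y => (Real.exp (a * y) * deriv V y) ^ 2 :=
      ae_of_all _ fun y => sq_nonneg _
    rw [← ofReal_integral_eq_lintegral_ofReal hsqint h1, ← ENNReal.ofReal_mul hA.le] at hlen2
    refine (ENNReal.ofReal_le_ofReal_iff ?_).1 hlen2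
    refine setIntegral_nonneg (measurableSet_upperHalf n) fun p hp => ?_
    have hps : 0 ≤ p.2 ^ s := Real.rpow_nonneg (le_of_lt hp) s
    positivity

/-! ### Integrals of radial functions on `ℝⁿ` -/

lemma sphereArea_pos {n : ℕ} (hn : 0 < n) : 0 < sphereArea n := by
  have hn' : (0 : ℝ) < n := Nat.cast_pos.2 hn
  have hG : 0 < Real.Gamma ((n : ℝ) / 2) := Real.Gamma_pos_of_pos (by linarith)
  unfold sphereArea; positivity

lemma halfSphereArea_pos (n : ℕ) {s : ℝ} (hs : -1 < s) : 0 < halfSphereArea n s := by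
  have hn : (0 : ℝ) ≤ n := n.cast_nonneg
  have hG1 : 0 < Real.Gamma ((1 + s) / 2) := Real.Gamma_pos_of_pos (by linarith)
  have hG2 : 0 < Real.Gamma (((n : ℝ) + 1 + s) / 2) := Real.Gamma_pos_of_pos (by linarith)
  unfold halfSphereArea; positivity

section trace

variable {n : ℕ} (hn : 0 < n) {H : ℝ → ℝ} (hH : Measurable H)
include hn hH

lemma integral_comp_log_norm :
    ∫ x : Sp n, H (Real.log ‖x‖) = sphereArea n * ∫ y, H y * Real.exp ((n : ℝ) * y) := by
  have hω := sphereArea_pos hn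
  have hm : Measurable fun x : Sp n => Real.log ‖x‖ := by fun_prop
  rw [← integral_map (f := H) hm.aemeasurable hH.aestronglyMeasurable, map_log_norm hn,
    integral_withDensity_eq_integral_toReal_smul (by fun_prop) (ae_of_all _ fun _ =>
      ENNReal.ofReal_lt_top), ← integral_const_mul]
  refine integral_congr_ae (ae_of_all _ fun y => ?_)
  simp only [smul_eq_mul]
  rw [ENNReal.toReal_ofReal (by positivity)]
  ring

lemma integrable_comp_log_norm :
    Integrable (fun x : Sp n => H (Real.log ‖x‖)) ↔
      Integrable fun y => H y * Real.exp ((n : ℝ) * y) := by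
  have hω := sphereArea_pos hn
  have hm : Measurable fun x : Sp n => Real.log ‖x‖ := by fun_prop
  have h1 := integrable_map_measure (μ := (volume : Measure (Sp n))) (f := fun x : Sp n => Real.log ‖x‖) (g := H)
    hH.aestronglyMeasurable hm.aemeasurable
  rw [map_log_norm hn] at h1
  rw [show (fun x : Sp n => H (Real.log ‖x‖)) = H ∘ fun x : Sp n => Real.log ‖x‖ from rfl, ← h1,
    integrable_withDensity_iff_integrable_smul' (by fun_prop) (ae_of_all _ fun _ =>
      ENNReal.ofReal_lt_top)]
  refine Iff.trans ?_ (integrable_const_mul_iff (isUnit_iff_ne_zero.2 hω.ne') _)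
  refine integrable_congr (ae_of_all _ fun y => ?_)
  simp only [smul_eq_mul]
  rw [ENNReal.toReal_ofReal (by positivity)]
  ring

lemma lintegral_comp_log_norm_lt_top {G : ℝ → ℝ} (hG : Integrable G)
    (hle : ∀ y, H y * Real.exp ((n : ℝ) * y) ≤ G y) :
    ∫⁻ x : Sp n, ENNReal.ofReal (H (Real.log ‖x‖)) < ⊤ := by
  have hω := sphereArea_pos hn
  have hm : Measurable fun x : Sp n => Real.log ‖x‖ := by fun_prop
  rw [← lintegral_map (f := fun y => ENNReal.ofReal (H y)) (by fun_prop) hm, map_log_norm hn,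
    lintegral_withDensity_eq_lintegral_mul _ (by fun_prop) (by fun_prop)]
  refine lt_of_le_of_lt (lintegral_mono fun y => ?_)
    ((hG.const_mul (sphereArea n)).lintegral_lt_top)
  rw [Pi.mul_apply, ← ENNReal.ofReal_mul (by positivity)]
  refine ENNReal.ofReal_le_ofReal ?_
  have := mul_le_mul_of_nonneg_left (hle y) hω.le
  linarith

end trace

lemma ae_exp_log_norm {n : ℕ} (hn : 0 < n) : ∀ᵐ x : Sp n, Real.exp (Real.log ‖x‖) = ‖x‖ := by
  have : Nonempty (Fin n) := ⟨⟨0, hn⟩⟩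
  have hne : ∀ᵐ x : Sp n, x ≠ 0 := by simp [ae_iff, measure_singleton]
  filter_upwards [hne] with x hx
  exact Real.exp_log (norm_pos_iff.2 hx)

/-! ### Positive parts of the entropies -/

/-- The tail bound gives `ln V² ≤ ln M - (N - θ) y`. For `y ≥ 0` the second term only helps. For `y
< 0` the density is at most `M e^{θy}`, and half of this exponential absorbs the linear factor. -/
lemma exists_integrable_exp_entropy_le {V : ℝ → ℝ} (hV : LocAC V) {N θ : ℝ} (hθ : 0 < θ)
    (hN : θ ≤ N) (h1 : MemLp (fun x => Real.exp (N / 2 * x) * V x) 2)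
    (h2 : MemLp (fun x => Real.exp ((N / 2 - θ) * x) * deriv V x) 2) :
    ∃ G : ℝ → ℝ, Integrable G ∧
      ∀ y, V y ^ 2 * Real.log (V y ^ 2) * Real.exp (N * y) ≤ G y := by
  obtain ⟨M, hM1, hM⟩ : ∃ M : ℝ, 1 ≤ M ∧ ∀ y, Real.exp ((N - θ) * y) * V y ^ 2 ≤ M := by
    refine ⟨max 1 (2 * (√(∫ x, (Real.exp (N / 2 * x) * V x) ^ 2) *
        √(∫ x, (Real.exp ((N / 2 - θ) * x) * deriv V x) ^ 2))), le_max_left _ _, fun y => ?_⟩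
    refine le_trans ?_ (le_max_right _ _)
    have h := hV.exp_mul_sq_le (α := N / 2) (β := N / 2 - θ) (by linarith) (by linarith) h1 h2 y
    rw [show N / 2 + (N / 2 - θ) = N - θ by ring] at h
    refine h.trans ?_
    gcongr ?_ * (?_ * ?_)
    exact Real.sqrt_le_sqrt (setIntegral_le_integral h1.integrable_sq
      (ae_of_all _ fun _ => sq_nonneg _))
  have hM0 : 0 < M := by linarith
  have hlogM : 0 ≤ Real.log M := Real.log_nonneg hM1
  refine ⟨fun y => Real.log M * (Real.exp (N / 2 * y) * V y) ^ 2 +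
    (Iic (0 : ℝ)).indicator (fun y => M * (N - θ) * (2 / θ) * Real.exp (θ / 2 * y)) y,
    (h1.integrable_sq.const_mul _).add ?_, fun y => ?_⟩
  · rw [integrable_indicator_iff measurableSet_Iic]
    exact (integrableOn_exp_mul_Iic (by positivity) 0).const_mul _
  · have e1 : Real.exp (N * y) = Real.exp (N / 2 * y) ^ 2 := by
      rw [← Real.exp_nat_mul]; congr 1; push_cast; ring
    have e2 : (Real.exp (N / 2 * y) * V y) ^ 2 = V y ^ 2 * Real.exp (N * y) := by
      rw [e1]; ring
    beta_reduce
    rw [e2]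
    have hnn : 0 ≤ V y ^ 2 * Real.exp (N * y) := by positivity
    have hind : ∀ F : ℝ → ℝ, (∀ y, 0 ≤ F y) → 0 ≤ (Iic (0 : ℝ)).indicator F y := fun F hF =>
      indicator_nonneg (fun x _ => hF x) y
    have hNθ : 0 ≤ N - θ := by linarith
    have hFnn : ∀ y, 0 ≤ M * (N - θ) * (2 / θ) * Real.exp (θ / 2 * y) := fun y => by positivity
    rcases eq_or_ne (V y) 0 with h0 | h0
    · have := hind _ hFnn
      simp only [h0]
      simpa using this
    · have hV2 : 0 < V y ^ 2 := by positivity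
      have hlog : Real.log (V y ^ 2) ≤ Real.log M - (N - θ) * y := by
        have := Real.log_le_log (by positivity) (hM y)
        rw [Real.log_mul (Real.exp_pos _).ne' hV2.ne', Real.log_exp] at this
        linarith
      have h3 := mul_le_mul_of_nonneg_left hlog hnn
      by_cases hy : y ∈ Iic (0 : ℝ)
      · rw [indicator_of_mem hy]
        have h4 : V y ^ 2 * Real.exp (N * y) ≤ M * Real.exp (θ * y) := by
          have e3 : Real.exp (N * y) = Real.exp ((N - θ) * y) * Real.exp (θ * y) := by
            rw [← Real.exp_add]; congr 1; ring
          have := mul_le_mul_of_nonneg_right (hM y) (Real.exp_pos (θ * y)).le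
          rw [e3]; linarith
        have h5 : -y ≤ 2 / θ * Real.exp (-(θ / 2 * y)) := by
          have := Real.add_one_le_exp (-(θ / 2 * y))
          rw [div_mul_eq_mul_div, le_div_iff₀ hθ]
          linarith
        have hy' : 0 ≤ -y := by
          have : y ≤ 0 := hy
          linarith
        have h6 : V y ^ 2 * Real.exp (N * y) * ((N - θ) * -y) ≤
            M * Real.exp (θ * y) * ((N - θ) * (2 / θ * Real.exp (-(θ / 2 * y)))) :=
          mul_le_mul h4 (mul_le_mul_of_nonneg_left h5 hNθ) (by positivity) (by positivity)
        have e4 : Real.exp (θ * y) * Real.exp (-(θ / 2 * y)) = Real.exp (θ / 2 * y) := by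
          rw [← Real.exp_add]; congr 1; ring
        rw [← e4]
        linarith
      · rw [indicator_of_notMem hy]
        have hy' : 0 ≤ y := le_of_lt (not_le.1 hy)
        have := mul_nonneg hnn (mul_nonneg hNθ hy')
        linarith

/-- Here the density `(e^{ay} V)²` is bounded, and `ln t ≤ t` suffices. -/
lemma exists_integrable_hardy_entropy_le {V : ℝ → ℝ} (hV : LocAC V) {a : ℝ} (ha : 0 ≤ a)
    (h1 : MemLp (fun x => Real.exp (a * x) * V x) 2)
    (h2 : MemLp (fun x => Real.exp (a * x) * deriv V x) 2) :
    ∃ G : ℝ → ℝ, Integrable G ∧ ∀ y, (Real.exp (a * y) * V y) ^ 2 *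
      Real.log ((Real.exp (a * y) * V y) ^ 2) ≤ G y := by
  obtain ⟨M, hM⟩ : ∃ M : ℝ, ∀ y, (Real.exp (a * y) * V y) ^ 2 ≤ M := by
    refine ⟨2 * (√(∫ x, (Real.exp (a * x) * V x) ^ 2) *
        √(∫ x, (Real.exp (a * x) * deriv V x) ^ 2)), fun y => ?_⟩
    have h := hV.exp_mul_sq_le (α := a) (β := a) ha (by linarith) h1 h2 y
    have e : (Real.exp (a * y) * V y) ^ 2 = Real.exp ((a + a) * y) * V y ^ 2 := by
      rw [mul_pow, ← Real.exp_nat_mul]; congr 2; push_cast; ring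
    rw [e]
    refine h.trans ?_
    gcongr ?_ * (?_ * ?_)
    exact Real.sqrt_le_sqrt (setIntegral_le_integral h1.integrable_sq
      (ae_of_all _ fun _ => sq_nonneg _))
  refine ⟨fun y => M * (Real.exp (a * y) * V y) ^ 2, h1.integrable_sq.const_mul M, fun y => ?_⟩
  beta_reduce
  rw [mul_comm M]
  refine mul_le_mul_of_nonneg_left ?_ (sq_nonneg _)
  exact (Real.log_le_self (sq_nonneg _)).trans (hM y)

/-! ### The constants -/

lemma constLS_pos {n : ℕ} {s : ℝ} (hs : s ∈ Ioo (-1 : ℝ) 1) (hn : 0 < n) : 0 < constLS n s := by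
  have hn' : (0 : ℝ) < n := Nat.cast_pos.2 hn
  have h1 : 0 < 1 - s := by linarith [hs.2]
  have hG := Real.Gamma_pos_of_pos (show (0 : ℝ) < (n : ℝ) / 2 by positivity)
  have hG1 := Real.Gamma_pos_of_pos (show 0 < (1 + s) / 2 by linarith [hs.1])
  have hG2 := Real.Gamma_pos_of_pos (show 0 < ((n : ℝ) + 1 + s) / 2 by linarith [hs.1])
  have hG3 := Real.Gamma_pos_of_pos (show 0 < (n : ℝ) / (1 - s) by positivity)
  unfold constLS; positivity

lemma constLH_pos {n : ℕ} {s : ℝ} (hs : s ∈ Ioo (-1 : ℝ) 1) (hn : 2 ≤ n) : 0 < constLH n s := by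
  have hn' : (2 : ℝ) ≤ n := by exact_mod_cast hn
  have h1 : 0 < 1 - s := by linarith [hs.2]
  have h2 : 0 < 2 * (n : ℝ) - 1 + s := by linarith [hs.1]
  have h3 : 0 < (n : ℝ) - 1 + s := by linarith [hs.1]
  have hG := Real.Gamma_pos_of_pos (show (0 : ℝ) < (n : ℝ) / 2 by positivity)
  have hG0 := Real.Gamma_pos_of_pos (show (0 : ℝ) < (n : ℝ) / 2 + 1 by positivity)
  have hG1 := Real.Gamma_pos_of_pos (show 0 < (1 + s) / 2 by linarith [hs.1])
  have hG2 := Real.Gamma_pos_of_pos (show 0 < ((n : ℝ) + 1 + s) / 2 by linarith [hs.1])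
  unfold constLH; positivity

/-- The best constant in the logarithmic Sobolev inequality in terms of the profile. -/
lemma log_constLS_mul {n : ℕ} {s D : ℝ} (hs : s ∈ Ioo (-1 : ℝ) 1) (hn : 0 < n) (hD : 0 < D) :
    (n : ℝ) / (1 - s) * Real.log (constLS n s * (halfSphereArea n s * D)) =
      Real.log ((1 - s) / Real.Gamma ((n : ℝ) / (1 - s)) / sphereArea n) - n / (1 - s) +
        n / (1 - s) * Real.log (4 * sphereArea n / (n * (1 - s)) * D) := by
  have hn' : (0 : ℝ) < n := Nat.cast_pos.2 hn
  have h1 : 0 < 1 - s := by linarith [hs.2]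
  have hG := Real.Gamma_pos_of_pos (show (0 : ℝ) < (n : ℝ) / 2 by positivity)
  have hG1 := Real.Gamma_pos_of_pos (show 0 < (1 + s) / 2 by linarith [hs.1])
  have hG2 := Real.Gamma_pos_of_pos (show 0 < ((n : ℝ) + 1 + s) / 2 by linarith [hs.1])
  have hG3 := Real.Gamma_pos_of_pos (show 0 < (n : ℝ) / (1 - s) by positivity)
  have hω := sphereArea_pos hn
  have hA := halfSphereArea_pos n hs.1
  have e1 : (1 - s) * Real.Gamma ((n : ℝ) / 2) / (2 * Real.pi ^ ((n : ℝ) / 2) *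
      Real.Gamma ((n : ℝ) / (1 - s))) =
      (1 - s) / Real.Gamma ((n : ℝ) / (1 - s)) / sphereArea n := by
    unfold sphereArea; field_simp
  -- The Gamma quotient in the constant cancels the half sphere area and leaves `ω/2`.
  have e2 : Real.Gamma (((n : ℝ) + 1 + s) / 2) /
      (Real.Gamma ((n : ℝ) / 2) * Real.Gamma ((1 + s) / 2)) * halfSphereArea n s =
      sphereArea n / 2 := by
    unfold sphereArea halfSphereArea; field_simp
  have e3 : constLS n s * (halfSphereArea n s * D) =
      ((1 - s) / Real.Gamma ((n : ℝ) / (1 - s)) / sphereArea n) ^ ((1 - s) / (n : ℝ)) *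
        (4 * sphereArea n / (n * (1 - s)) * D) / Real.exp 1 := by
    rw [constLS, e1]
    calc _ = 8 / ((n : ℝ) * (1 - s) * Real.exp 1) * (Real.Gamma (((n : ℝ) + 1 + s) / 2) /
      (Real.Gamma ((n : ℝ) / 2) * Real.Gamma ((1 + s) / 2)) * halfSphereArea n s) *
      ((1 - s) / Real.Gamma ((n : ℝ) / (1 - s)) / sphereArea n) ^ ((1 - s) / (n : ℝ)) * D := by ring
      _ = _ := by rw [e2]; field_simp; norm_num
  rw [e3, Real.log_div (by positivity) (Real.exp_pos _).ne', Real.log_exp,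
    Real.log_mul (by positivity) (by positivity), Real.log_rpow (by positivity)]
  field_simp
  ring

/-- The best constant in the logarithmic Hardy inequality in terms of the profile. -/
lemma log_constLH_mul {n : ℕ} {s D : ℝ} (hs : s ∈ Ioo (-1 : ℝ) 1) (hn : 2 ≤ n) (hD : 0 < D) :
    (n : ℝ) / (1 - s) * Real.log (constLH n s * (halfSphereArea n s * D)) =
      -Real.log (sphereArea n) + Real.log (2 / Real.pi) / 2 - 1 / 2
      - Real.log (2 * n / (1 - s)) / 2 - (2 * n / (1 - s) - 1) / 2 *
        Real.log (2 * n / (1 - s) * (((n : ℝ) - 1 + s) / 2) ^ 2 / (2 * n / (1 - s) - 1)) +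
      2 * n / (1 - s) / 2 * Real.log (sphereArea n * D) := by
  have hn' : (2 : ℝ) ≤ n := by exact_mod_cast hn
  have hn0 : (0 : ℝ) < n := by linarith
  have h1 : 0 < 1 - s := by linarith [hs.2]
  have h2 : 0 < 2 * (n : ℝ) - 1 + s := by linarith [hs.1]
  have h3 : 0 < (n : ℝ) - 1 + s := by linarith [hs.1]
  have hG := Real.Gamma_pos_of_pos (show (0 : ℝ) < (n : ℝ) / 2 by positivity)
  have hG1 := Real.Gamma_pos_of_pos (show 0 < (1 + s) / 2 by linarith [hs.1])
  have hG2 := Real.Gamma_pos_of_pos (show 0 < ((n : ℝ) + 1 + s) / 2 by linarith [hs.1])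
  have hω := sphereArea_pos (show 0 < n by lia)
  have hA := halfSphereArea_pos n hs.1
  have hpi := Real.pi_pos
  have ed : 2 * (n : ℝ) / (1 - s) - 1 = (2 * n - 1 + s) / (1 - s) := by field_simp; ring
  have hd : 2 * (n : ℝ) / (1 - s) * (((n : ℝ) - 1 + s) / 2) ^ 2 / ((2 * n - 1 + s) / (1 - s)) =
      n * (n - 1 + s) ^ 2 / (2 * (2 * n - 1 + s)) := by field_simp
  have l8 : Real.log 8 = 3 * Real.log 2 := by
    rw [show (8 : ℝ) = 2 ^ (3 : ℕ) by norm_num, Real.log_pow]; push_cast; ring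
  have lA : Real.log (halfSphereArea n s) = n / 2 * Real.log Real.pi +
      Real.log (Real.Gamma ((1 + s) / 2)) - Real.log (Real.Gamma (((n : ℝ) + 1 + s) / 2)) := by
    rw [halfSphereArea, Real.log_div (by positivity) hG2.ne', Real.log_mul (by positivity) hG1.ne',
      Real.log_rpow hpi]
  have lω : Real.log (sphereArea n) = Real.log 2 + n / 2 * Real.log Real.pi -
      Real.log (Real.Gamma ((n : ℝ) / 2)) := by
    rw [sphereArea, Real.log_div (by positivity) hG.ne', Real.log_mul two_ne_zero (by positivity),
      Real.log_rpow hpi]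
  -- Every logarithm is expanded into logarithms of its atomic factors, so that the identity becomes
  -- linear in them.
  have lC : Real.log (constLH n s) = Real.log 2 + Real.log (Real.Gamma (((n : ℝ) + 1 + s) / 2)) -
      ((1 - s) / 2 * Real.log Real.pi + (Real.log n - Real.log 2 +
        Real.log (Real.Gamma ((n : ℝ) / 2))) + Real.log (Real.Gamma ((1 + s) / 2))) +
      (1 - (1 - s) / (2 * n)) * (Real.log (2 * n - 1 + s) - 2 * Real.log (n - 1 + s)) +
      (1 - s) / (2 * n) * (Real.log (1 - s) + 2 * Real.log (Real.Gamma ((n : ℝ) / 2)) -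
        (3 * Real.log 2 + Real.log Real.pi + 1)) := by
    rw [constLH, Real.Gamma_add_one (by positivity), Real.log_mul (by positivity) (by positivity),
      Real.log_mul (by positivity) (by positivity), Real.log_div (by positivity) (by positivity),
      Real.log_mul two_ne_zero hG2.ne', Real.log_mul (by positivity) hG1.ne',
      Real.log_mul (by positivity) (by positivity), Real.log_rpow hpi,
      Real.log_mul (by positivity) hG.ne', Real.log_div hn0.ne' two_ne_zero,
      Real.log_rpow (by positivity), Real.log_rpow (by positivity),
      Real.log_div (by positivity) (by positivity), Real.log_pow,
      Real.log_div (by positivity) (by positivity), Real.log_mul (by positivity) (by positivity),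
      Real.log_pow, Real.log_mul (by positivity) (by positivity),
      Real.log_mul (by positivity) (by positivity), Real.log_exp, l8]
    push_cast; ring
  have hC := constLH_pos hs hn
  rw [ed, hd, Real.log_mul hC.ne' (by positivity), Real.log_mul hA.ne' hD.ne',
    Real.log_mul hω.ne' hD.ne', Real.log_div two_ne_zero hpi.ne',
    Real.log_div (by positivity) h1.ne', Real.log_mul two_ne_zero hn0.ne',
    Real.log_div (by positivity) (by positivity), Real.log_mul hn0.ne' (by positivity),
    Real.log_pow, Real.log_mul two_ne_zero h2.ne', lC, lA, lω]
  field_simp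
  ring

/-! ### The inequalities -/

/-- The Hardy weight `e^{-(1-s)y}` and the polar Jacobian `e^{ny}` combine to `e^{2ay}` with `2a = n
- 1 + s`, the same weight as in the energy. -/
lemma sq_div_exp_mul_exp (n : ℕ) (s y v : ℝ) :
    v ^ 2 / Real.exp ((1 - s) * y) * Real.exp (n * y) =
      (Real.exp (((n : ℝ) - 1 + s) / 2 * y) * v) ^ 2 := by
  rw [mul_pow, ← Real.exp_nat_mul, div_mul_eq_mul_div, mul_div_assoc, ← Real.exp_sub, mul_comm]
  congr 2; push_cast; ring

section profile

variable {n : ℕ} (hn : 0 < n) (s : ℝ) {f : Sp n → ℝ} {V : ℝ → ℝ}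
  (hf : ∀ᵐ x, f x = V (Real.log ‖x‖))
include hn hf

lemma ae_densityLH : densityLH s f =ᵐ[volume]
    fun x => (fun y => V y ^ 2 / Real.exp ((1 - s) * y)) (Real.log ‖x‖) := by
  filter_upwards [hf, ae_exp_log_norm hn] with x hx hx2
  rw [densityLH, hx, mul_comm (1 - s), Real.exp_mul, hx2]

/-- The exponent `1 - s - n` inside the logarithm is exactly what makes its argument the density
`(e^{ay} V)²` on the line. -/
lemma ae_entropyLH : entropyLH s f =ᵐ[volume] fun x => (fun y =>
    V y ^ 2 / Real.exp ((1 - s) * y) *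
      Real.log ((Real.exp (((n : ℝ) - 1 + s) / 2 * y) * V y) ^ 2)) (Real.log ‖x‖) := by
  filter_upwards [hf, ae_densityLH hn s hf, ae_exp_log_norm hn] with x hx hx1 hx2
  rw [entropyLH, hx1]
  have e : ‖x‖ ^ (1 - s - (n : ℝ)) = Real.exp ((1 - s) * Real.log ‖x‖) /
      Real.exp (n * Real.log ‖x‖) := by
    rw [← Real.exp_sub, ← sub_mul, mul_comm, Real.exp_mul, hx2]
  rw [← sq_div_exp_mul_exp, e, hx, div_div_eq_mul_div, div_mul_eq_mul_div (_ ^ 2) _ (Real.exp (n * _))]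

end profile

theorem radialLogSobolevTrace_constLS {n : ℕ} (hn : 2 ≤ n) {s : ℝ} (hs : s ∈ Ioo (-1 : ℝ) 1) :
    RadialLogSobolevTrace n s (constLS n s) := by
  intro u Gx Gt f hW hr hone
  have hn0 : 0 < n := by lia
  have hn' : (2 : ℝ) ≤ n := by exact_mod_cast hn
  have h1s : 0 < 1 - s := by linarith [hs.2]
  obtain ⟨V, hV, hfV, hD, hE⟩ := hW.exists_profile hs hn0 hr
  have hVm := hV.continuous.measurable
  have hω := sphereArea_pos hn0
  have hA := halfSphereArea_pos n hs.1
  have hsq : (fun x => f x ^ 2) =ᵐ[volume] fun x => (fun y => V y ^ 2) (Real.log ‖x‖) :=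
    hfV.mono fun x hx => by simp only [hx]
  have hent : entropyLS f =ᵐ[volume]
      fun x => (fun y => V y ^ 2 * Real.log (V y ^ 2)) (Real.log ‖x‖) :=
    hfV.mono fun x hx => by simp only [entropyLS, hx]
  have hpow : ∀ y, (Real.exp ((n : ℝ) / 2 * y) * V y) ^ 2 = V y ^ 2 * Real.exp (n * y) := fun y => by
    rw [mul_pow, ← Real.exp_nat_mul, mul_comm]; congr 2; push_cast; ring
  -- A Bochner integral equal to `1` cannot be the default value `0`.
  have hint : Integrable fun x => f x ^ 2 := Integrable.of_integral_ne_zero (by rw [hone]; simp)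
  have h1 : MemLp (fun y => Real.exp ((n : ℝ) / 2 * y) * V y) 2 := by
    rw [memLp_two_iff_integrable_sq (by fun_prop)]
    simp only [hpow]
    exact (integrable_comp_log_norm hn0 (H := fun y => V y ^ 2) (by fun_prop)).1
      ((integrable_congr hsq).1 hint)
  have eθ : (n : ℝ) / 2 - (1 - s) / 2 = ((n : ℝ) - 1 + s) / 2 := by ring
  have h2 : MemLp (fun y => Real.exp (((n : ℝ) / 2 - (1 - s) / 2) * y) * deriv V y) 2 := by
    rwa [eθ]
  have hone' : sphereArea n * ∫ y, (Real.exp ((n : ℝ) / 2 * y) * V y) ^ 2 = 1 := by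
    simp only [hpow]
    rw [← integral_comp_log_norm hn0 (H := fun y => V y ^ 2) (by fun_prop)]
    exact (integral_congr_ae hsq).symm.trans hone
  refine ⟨?_, fun hint => ?_⟩
  · obtain ⟨G, hG, hle⟩ := exists_integrable_exp_entropy_le hV (θ := (1 - s) / 2) (by linarith)
      (by linarith [hs.1]) h1 h2
    rw [lintegral_congr_ae (hent.mono fun x hx => by rw [hx])]
    exact lintegral_comp_log_norm_lt_top hn0 (by fun_prop) hG hle
  · rw [integral_congr_ae hent, integral_comp_log_norm hn0
      (H := fun y => V y ^ 2 * Real.log (V y ^ 2)) (by fun_prop)]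
    have he := (integrable_comp_log_norm hn0 (H := fun y => V y ^ 2 * Real.log (V y ^ 2))
      (by fun_prop)).1 ((integrable_congr hent).1 hint)
    obtain ⟨hD0, hmain⟩ := exp_logSobolev_sharp hV (θ := (1 - s) / 2) (by linarith)
      (by linarith [hs.1]) hω h1 h2 hone' he
    have e2 : 2 * ((1 - s) / 2) = 1 - s := by ring
    have e4 : ∀ D : ℝ, 2 * sphereArea n / (n * ((1 - s) / 2)) * D =
        4 * sphereArea n / (n * (1 - s)) * D := fun D => by field_simp; ring
    rw [e2, e4, eθ] at hmain
    rw [eθ] at hD0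
    rw [← log_constLS_mul hs hn0 hD0] at hmain
    -- The bound is sharp for the profile energy, which is at most the energy. Its positivity is
    -- needed for monotonicity of `Real.log`.
    refine hmain.trans (mul_le_mul_of_nonneg_left ?_ (by positivity))
    have hC := constLS_pos hs hn0
    exact Real.log_le_log (by positivity) (mul_le_mul_of_nonneg_left hE hC.le)

theorem radialLogHardyTrace_constLH {n : ℕ} (hn : 2 ≤ n) {s : ℝ} (hs : s ∈ Ioo (-1 : ℝ) 1) :
    RadialLogHardyTrace n s (constLH n s) := by
  intro u Gx Gt f hW hr hone
  have hn0 : 0 < n := by lia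
  have hn' : (2 : ℝ) ≤ n := by exact_mod_cast hn
  have h1s : 0 < 1 - s := by linarith [hs.2]
  obtain ⟨V, hV, hfV, hD, hE⟩ := hW.exists_profile hs hn0 hr
  have hVm := hV.continuous.measurable
  have hω := sphereArea_pos hn0
  have hA := halfSphereArea_pos n hs.1
  set a := ((n : ℝ) - 1 + s) / 2 with ha
  have ha0 : 0 < a := by rw [ha]; linarith [hs.1]
  have hdens := ae_densityLH hn0 s hfV
  have hent := ae_entropyLH hn0 s hfV
  have hpow : ∀ y, V y ^ 2 / Real.exp ((1 - s) * y) * Real.exp (n * y) =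
      (Real.exp (a * y) * V y) ^ 2 := fun y => sq_div_exp_mul_exp n s y (V y)
  have hint : Integrable (densityLH s f) := Integrable.of_integral_ne_zero (by rw [hone]; simp)
  have h1 : MemLp (fun y => Real.exp (a * y) * V y) 2 := by
    rw [memLp_two_iff_integrable_sq (by fun_prop)]
    simp only [← hpow]
    exact (integrable_comp_log_norm hn0 (H := fun y => V y ^ 2 / Real.exp ((1 - s) * y))
      (by fun_prop)).1 ((integrable_congr hdens).1 hint)
  have hone' : sphereArea n * ∫ y, (Real.exp (a * y) * V y) ^ 2 = 1 := by
    simp only [← hpow]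
    rw [← integral_comp_log_norm hn0 (H := fun y => V y ^ 2 / Real.exp ((1 - s) * y)) (by fun_prop)]
    exact (integral_congr_ae hdens).symm.trans hone
  have hpow2 : ∀ y, V y ^ 2 / Real.exp ((1 - s) * y) * Real.log ((Real.exp (a * y) * V y) ^ 2) *
      Real.exp (n * y) = (Real.exp (a * y) * V y) ^ 2 * Real.log ((Real.exp (a * y) * V y) ^ 2) :=
    fun y => by rw [mul_right_comm, hpow]
  refine ⟨?_, fun hint => ?_⟩
  · obtain ⟨G, hG, hle⟩ := exists_integrable_hardy_entropy_le hV ha0.le h1 hD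
    rw [lintegral_congr_ae (hent.mono fun x hx => by rw [hx])]
    exact lintegral_comp_log_norm_lt_top hn0 (by fun_prop) hG fun y => (hpow2 y).le.trans (hle y)
  · rw [integral_congr_ae hent, integral_comp_log_norm hn0
      (H := fun y => V y ^ 2 / Real.exp ((1 - s) * y) * Real.log ((Real.exp (a * y) * V y) ^ 2))
      (by fun_prop)]
    have he := (integrable_comp_log_norm hn0 (H := fun y => V y ^ 2 / Real.exp ((1 - s) * y) *
      Real.log ((Real.exp (a * y) * V y) ^ 2)) (by fun_prop)).1 ((integrable_congr hent).1 hint)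
    simp only [hpow2] at he ⊢
    -- This `d` makes `d/2` the prefactor `n/(1-s)` of the target.
    have hd : 1 < 2 * (n : ℝ) / (1 - s) := by
      rw [one_lt_div h1s]; linarith [hs.1]
    obtain ⟨hD0, hmain⟩ := exp_logHardy_sharp hV ha0 hω hd h1 hD hone' he
    rw [ha, ← log_constLH_mul hs hn hD0, ← ha] at hmain
    refine hmain.trans (mul_le_mul_of_nonneg_left ?_ (by positivity))
    have hC := constLH_pos hs hn
    exact Real.log_le_log (by positivity) (mul_le_mul_of_nonneg_left hE hC.le)

/-! ### Smooth radial functions -/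

section radial

variable {n : ℕ} {V : ℝ → ℝ} {u : Sp n × ℝ → ℝ}

lemma euclLen_pos_of_ne {p : Sp n × ℝ} (hp : p ≠ 0) : 0 < euclLen p := by
  refine Real.sqrt_pos.2 ?_
  rcases eq_or_ne p.1 0 with h | h
  · have h2 : p.2 ≠ 0 := fun h2 => hp (Prod.ext h h2)
    positivity
  · positivity

lemma norm_le_euclLen (p : Sp n × ℝ) : ‖p‖ ≤ euclLen p := by
  refine max_le (Real.le_sqrt_of_sq_le ?_) (Real.le_sqrt_of_sq_le ?_)
  · nlinarith [sq_nonneg p.2]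
  · rw [Real.norm_eq_abs, sq_abs]; nlinarith [sq_nonneg ‖p.1‖]

lemma euclLen_zero_right (x : Sp n) : euclLen (x, (0 : ℝ)) = ‖x‖ := by
  simp [euclLen, Real.sqrt_sq]

lemma isOpen_upperHalf (n : ℕ) : IsOpen (upperHalf n) := isOpen_lt continuous_const continuous_snd

lemma ne_zero_of_mem_upperHalf {p : Sp n × ℝ} (hp : p ∈ upperHalf n) : p ≠ 0 := by
  rintro rfl
  exact lt_irrefl (0 : ℝ) hp

lemma contDiffAt_log_euclLen {p : Sp n × ℝ} (hp : p ≠ 0) (m : WithTop ℕ∞) :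
    ContDiffAt ℝ m (fun p : Sp n × ℝ => Real.log (euclLen p)) p := by
  have h := euclLen_pos_of_ne hp
  have h2 : ‖p.1‖ ^ 2 + p.2 ^ 2 ≠ 0 := (Real.sqrt_pos.1 h).ne'
  refine ContDiffAt.log (ContDiffAt.sqrt ?_ h2) h.ne'
  exact ((contDiff_fst.norm_sq ℝ).add (contDiff_snd.pow 2)).contDiffAt

lemma hasFDerivAt_log_euclLen {p : Sp n × ℝ} (hp : p ≠ 0) :
    HasFDerivAt (fun p : Sp n × ℝ => Real.log (euclLen p))
      ((euclLen p ^ 2)⁻¹ • ((innerSL ℝ p.1).comp (ContinuousLinearMap.fst ℝ (Sp n) ℝ) +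
        p.2 • ContinuousLinearMap.snd ℝ (Sp n) ℝ)) p := by
  have h := euclLen_pos_of_ne hp
  have h2 : ‖p.1‖ ^ 2 + p.2 ^ 2 ≠ 0 := (Real.sqrt_pos.1 h).ne'
  have h3 : HasFDerivAt (fun p : Sp n × ℝ => ‖p.1‖ ^ 2 + p.2 ^ 2)
      ((2 • innerSL ℝ p.1).comp (ContinuousLinearMap.fst ℝ (Sp n) ℝ) +
        (2 * p.2) • ContinuousLinearMap.snd ℝ (Sp n) ℝ) p := by
    have h4 := (hasStrictFDerivAt_norm_sq p.1).hasFDerivAt.comp p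
      (hasFDerivAt_fst (𝕜 := ℝ) (E := Sp n) (F := ℝ) (p := p))
    have h5 := (hasFDerivAt_snd (𝕜 := ℝ) (E := Sp n) (F := ℝ) (p := p)).pow 2
    refine (h4.add h5).congr_fderiv ?_
    ext <;> simp
  have h6 := (h3.log h2).const_mul (1 / 2)
  have e : (fun p : Sp n × ℝ => Real.log (euclLen p)) =
      fun p => 1 / 2 * Real.log (‖p.1‖ ^ 2 + p.2 ^ 2) := by
    funext p
    rw [euclLen, Real.log_sqrt (by positivity)]; ring
  rw [e]
  refine h6.congr_fderiv ?_
  rw [euclLen_sq]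
  ext <;> simp <;> ring

lemma hasFDerivAt_radial (hV : Differentiable ℝ V)
    (hu : ∀ p ∈ upperHalf n, u p = V (Real.log (euclLen p))) {p : Sp n × ℝ}
    (hp : p ∈ upperHalf n) :
    HasFDerivAt u (deriv V (Real.log (euclLen p)) • (euclLen p ^ 2)⁻¹ •
      ((innerSL ℝ p.1).comp (ContinuousLinearMap.fst ℝ (Sp n) ℝ) +
        p.2 • ContinuousLinearMap.snd ℝ (Sp n) ℝ)) p := by
  have h := (hV (Real.log (euclLen p))).hasDerivAt.comp_hasFDerivAt p
    (hasFDerivAt_log_euclLen (ne_zero_of_mem_upperHalf hp))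
  refine h.congr_of_eventuallyEq ?_
  filter_upwards [(isOpen_upperHalf n).mem_nhds hp] with q hq using hu q hq

lemma gradX_radial (hV : Differentiable ℝ V)
    (hu : ∀ p ∈ upperHalf n, u p = V (Real.log (euclLen p))) {p : Sp n × ℝ}
    (hp : p ∈ upperHalf n) :
    gradX u p = (deriv V (Real.log (euclLen p)) * (euclLen p ^ 2)⁻¹) • p.1 := by
  have h := hasFDerivAt_radial hV hu hp
  refine ext_inner_right ℝ fun v => ?_
  rw [inner_gradX h.differentiableAt, h.fderiv]
  simp [inner_smul_left, mul_assoc]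

lemma gradT_radial (hV : Differentiable ℝ V)
    (hu : ∀ p ∈ upperHalf n, u p = V (Real.log (euclLen p))) {p : Sp n × ℝ}
    (hp : p ∈ upperHalf n) :
    gradT u p = deriv V (Real.log (euclLen p)) * (euclLen p ^ 2)⁻¹ * p.2 := by
  have h := hasFDerivAt_radial hV hu hp
  rw [gradT_eq h.differentiableAt, h.fderiv]
  simp [mul_assoc]

lemma norm_sq_add_sq_radial {p : Sp n × ℝ} (hp : p ∈ upperHalf n) (c : ℝ) :
    ‖(c * (euclLen p ^ 2)⁻¹) • p.1‖ ^ 2 + (c * (euclLen p ^ 2)⁻¹ * p.2) ^ 2 =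
      c ^ 2 * Real.exp (-2 * Real.log (euclLen p)) := by
  have h := euclLen_pos hp
  have e : Real.exp (-2 * Real.log (euclLen p)) = (euclLen p ^ 2)⁻¹ := by
    rw [show -2 * Real.log (euclLen p) = -(((2 : ℕ) : ℝ) * Real.log (euclLen p)) by push_cast; ring,
      Real.exp_neg, Real.exp_nat_mul, Real.exp_log h]
  rw [e, norm_smul, mul_pow, mul_pow (c * _), Real.norm_eq_abs, sq_abs, ← mul_add,
    ← euclLen_sq]
  field_simp

/-- A profile supported in bounded `y` gives a function vanishing near the origin and outside a
ball, so the singularity of `ln |p|` at `0` is harmless. -/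
lemma isTest_radial (hV : ContDiff ℝ ((⊤ : ℕ∞) : WithTop ℕ∞) V) {R : ℝ}
    (hR : ∀ y, R < |y| → V y = 0) (h0 : u 0 = 0)
    (hu : ∀ p, p ≠ 0 → u p = V (Real.log (euclLen p))) : IsTest u := by
  constructor
  · rw [contDiff_iff_contDiffAt]
    intro p
    rcases eq_or_ne p 0 with rfl | hp
    · refine (contDiffAt_const (c := (0 : ℝ))).congr_of_eventuallyEq ?_
      have : ∀ᶠ p : Sp n × ℝ in 𝓝 0, euclLen p < Real.exp (-|R|) := by
        refine (continuous_euclLen.tendsto 0).eventually_lt_const ?_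
        simp [euclLen, Real.exp_pos]
      filter_upwards [this] with q hq
      rcases eq_or_ne q 0 with rfl | hq0
      · exact h0
      · rw [hu q hq0]
        refine hR _ ?_
        have := (Real.log_lt_iff_lt_exp (euclLen_pos_of_ne hq0)).2 hq
        have h2 := neg_le_abs (Real.log (euclLen q))
        have h3 := le_abs_self R
        linarith
    · refine ((hV.contDiffAt (x := Real.log (euclLen p))).comp p
        (contDiffAt_log_euclLen hp _)).congr_of_eventuallyEq ?_
      filter_upwards [isOpen_ne.mem_nhds hp] with q hq using hu q hq
  · refine HasCompactSupport.intro (isCompact_closedBall 0 (Real.exp R)) fun p hp => ?_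
    rcases eq_or_ne p 0 with rfl | hp0
    · exact h0
    · rw [hu p hp0]
      refine hR _ ?_
      rw [mem_closedBall_zero_iff, not_le] at hp
      have := hp.trans_le (norm_le_euclLen p)
      exact ((Real.lt_log_iff_exp_lt (euclLen_pos_of_ne hp0)).2 this).trans_le (le_abs_self _)

end radial

/-- Integrals of radial functions over the half space. -/
lemma lintegral_comp_log_euclLen (n : ℕ) {s : ℝ} (hs : -1 < s) {H : ℝ → ℝ} (hH : Measurable H)
    (h0 : ∀ y, 0 ≤ H y) :
    ∫⁻ p in upperHalf n, ENNReal.ofReal (H (Real.log (euclLen p)) * p.2 ^ s) =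
      ∫⁻ y, ENNReal.ofReal (halfSphereArea n s * (Real.exp (((n : ℝ) + 1 + s) * y) * H y)) := by
  have hA := halfSphereArea_pos n hs
  have hm := measurable_log_euclLen (n := n)
  simp only [ENNReal.ofReal_mul (h0 _)]
  rw [← lintegral_halfMeasure s (F := fun p => ENNReal.ofReal (H (Real.log (euclLen p))))
    (by fun_prop), ← lintegral_map (f := fun y => ENNReal.ofReal (H y)) (by fun_prop) hm,
    map_log_euclLen n hs, lintegral_withDensity_eq_lintegral_mul _ (by fun_prop) (by fun_prop)]
  refine lintegral_congr fun y => ?_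
  rw [Pi.mul_apply, ← ENNReal.ofReal_mul (by positivity), mul_assoc]

lemma lintegral_comp_log_norm {n : ℕ} (hn : 0 < n) {H : ℝ → ℝ} (hH : Measurable H) :
    ∫⁻ x : Sp n, ENNReal.ofReal (H (Real.log ‖x‖)) =
      ∫⁻ y, ENNReal.ofReal (sphereArea n * (Real.exp ((n : ℝ) * y) * H y)) := by
  have hω := sphereArea_pos hn
  have hm : Measurable fun x : Sp n => Real.log ‖x‖ := by fun_prop
  rw [← lintegral_map (f := fun y => ENNReal.ofReal (H y)) (by fun_prop) hm, map_log_norm hn,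
    lintegral_withDensity_eq_lintegral_mul _ (by fun_prop) (by fun_prop)]
  refine lintegral_congr fun y => ?_
  rw [Pi.mul_apply, ← ENNReal.ofReal_mul (by positivity), mul_assoc]

/-- The gradient is `V'(ln r) p / r²`, so its squared length is `V'² r⁻²`. For a radial gradient the
bound of `MemW.exists_profile` becomes an equality. -/
lemma energy_radial {n : ℕ} {s : ℝ} (hs : -1 < s) {V : ℝ → ℝ} {u : Sp n × ℝ → ℝ}
    (hV : Differentiable ℝ V) (hu : ∀ p ∈ upperHalf n, u p = V (Real.log (euclLen p))) :
    energy s (gradX u) (gradT u) =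
      halfSphereArea n s * ∫ y, Real.exp (((n : ℝ) - 1 + s) * y) * deriv V y ^ 2 := by
  have hA := halfSphereArea_pos n hs
  have hVm := measurable_deriv V
  have hm := measurable_log_euclLen (n := n)
  have e : energy s (gradX u) (gradT u) = ∫ p in upperHalf n,
      (fun y => deriv V y ^ 2 * Real.exp (-2 * y)) (Real.log (euclLen p)) * p.2 ^ s := by
    refine setIntegral_congr_fun (measurableSet_upperHalf n) fun p hp => ?_
    simp only
    rw [gradX_radial hV hu hp, gradT_radial hV hu hp, norm_sq_add_sq_radial hp]
  rw [e, integral_eq_lintegral_of_nonneg_ae, lintegral_comp_log_euclLen n hs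
    (H := fun y => deriv V y ^ 2 * Real.exp (-2 * y)) (by fun_prop) (fun y => by positivity), ← integral_const_mul, integral_eq_lintegral_of_nonneg_ae]
  · congr 1
    refine lintegral_congr fun y => ?_
    congr 2
    rw [mul_comm (deriv V y ^ 2), ← mul_assoc, ← Real.exp_add]
    congr 2; ring
  · exact ae_of_all _ fun y => by positivity
  · fun_prop
  · filter_upwards [ae_restrict_mem (measurableSet_upperHalf n)] with p hp
    have : 0 < p.2 := hp
    simp only [Pi.zero_apply]; positivity
  · have : Measurable fun p : Sp n × ℝ =>
      (fun y => deriv V y ^ 2 * Real.exp (-2 * y)) (Real.log (euclLen p)) * p.2 ^ s := by fun_prop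
    exact this.aestronglyMeasurable

/-! ### Cutoff -/

/-- A smooth cutoff equal to `1` near the origin. -/
noncomputable def cutoff : ContDiffBump (0 : ℝ) := ⟨1, 2, one_pos, one_lt_two⟩

/-- The truncation of a profile to `|y| ≤ 2 (k + 1)`. -/
noncomputable def truncate (V : ℝ → ℝ) (k : ℕ) (y : ℝ) : ℝ := V y * cutoff (((k : ℝ) + 1)⁻¹ * y)

lemma contDiff_truncate {V : ℝ → ℝ} (hV : ContDiff ℝ ((⊤ : ℕ∞) : WithTop ℕ∞) V) (k : ℕ) :
    ContDiff ℝ ((⊤ : ℕ∞) : WithTop ℕ∞) (truncate V k) :=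
  hV.mul (cutoff.contDiff.comp (contDiff_const.mul contDiff_id))

lemma truncate_eq_zero (V : ℝ → ℝ) {k : ℕ} {y : ℝ} (hy : 2 * ((k : ℝ) + 1) < |y|) :
    truncate V k y = 0 := by
  have hk : (0 : ℝ) < k + 1 := by positivity
  rw [truncate, cutoff.zero_of_le_dist, mul_zero]
  rw [dist_zero_right, Real.norm_eq_abs, abs_mul, abs_of_pos (inv_pos.2 hk), inv_mul_eq_div,
    le_div_iff₀ hk]
  exact hy.le

lemma deriv_truncate {V : ℝ → ℝ} (hV : Differentiable ℝ V) (k : ℕ) (y : ℝ) :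
    deriv (truncate V k) y = deriv V y * cutoff (((k : ℝ) + 1)⁻¹ * y) +
      V y * (((k : ℝ) + 1)⁻¹ * deriv cutoff (((k : ℝ) + 1)⁻¹ * y)) := by
  have h1 : HasDerivAt (fun y : ℝ => cutoff (((k : ℝ) + 1)⁻¹ * y))
      (deriv cutoff (((k : ℝ) + 1)⁻¹ * y) * ((k : ℝ) + 1)⁻¹) y := by
    have h2 : HasDerivAt (fun y : ℝ => ((k : ℝ) + 1)⁻¹ * y) (((k : ℝ) + 1)⁻¹) y := by
      simpa using (hasDerivAt_id y).const_mul (((k : ℝ) + 1)⁻¹)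
    exact ((cutoff.contDiff (n := 1)).differentiable one_ne_zero _).hasDerivAt.comp y h2
  refine ((hV y).hasDerivAt.mul h1).deriv.trans ?_
  ring

lemma exists_abs_deriv_cutoff_le : ∃ M : ℝ, 0 ≤ M ∧ ∀ y, |deriv cutoff y| ≤ M := by
  have hc : Continuous (deriv cutoff) := (cutoff.contDiff (n := 1)).continuous_deriv le_rfl
  obtain ⟨M, hM⟩ := hc.bounded_above_of_compact_support cutoff.hasCompactSupport.deriv
  exact ⟨M, (norm_nonneg _).trans (hM 0), hM⟩

lemma tendsto_inv_mul_atTop_zero (y : ℝ) :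
    Tendsto (fun k : ℕ => ((k : ℝ) + 1)⁻¹ * y) atTop (𝓝 0) := by
  have := (tendsto_one_div_add_atTop_nhds_zero_nat (𝕜 := ℝ)).mul_const y
  simpa using this

lemma tendsto_cutoff (y : ℝ) :
    Tendsto (fun k : ℕ => cutoff (((k : ℝ) + 1)⁻¹ * y)) atTop (𝓝 1) := by
  have h := (cutoff.continuous.tendsto 0).comp (tendsto_inv_mul_atTop_zero y)
  rwa [cutoff.one_of_mem_closedBall (Metric.mem_closedBall_self cutoff.rIn_pos.le)] at h

section truncation

variable {V : ℝ → ℝ} (hV : ContDiff ℝ ((⊤ : ℕ∞) : WithTop ℕ∞) V) {α : ℝ}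
  (h1 : Integrable fun y => Real.exp (α * y) * V y ^ 2)
include hV h1

lemma tendsto_lintegral_truncate :
    Tendsto (fun k => ∫⁻ y, ENNReal.ofReal (Real.exp (α * y) * (V y - truncate V k y) ^ 2))
      atTop (𝓝 0) := by
  have hc : ∀ k, Continuous (truncate V k) := fun k => (contDiff_truncate hV k).continuous
  have hVc := hV.continuous
  rw [← lintegral_zero (μ := (volume : Measure ℝ))]
  refine tendsto_lintegral_of_dominated_convergence
    (fun y => ENNReal.ofReal (Real.exp (α * y) * V y ^ 2))
    (fun k => by have := hc k; fun_prop) (fun k => ae_of_all _ fun y => ?_)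
    h1.lintegral_lt_top.ne (ae_of_all _ fun y => ?_)
  · refine ENNReal.ofReal_le_ofReal (mul_le_mul_of_nonneg_left ?_ (Real.exp_pos _).le)
    have e : V y - truncate V k y = V y * (1 - cutoff (((k : ℝ) + 1)⁻¹ * y)) := by
      unfold truncate; ring
    rw [e, mul_pow]
    have h2 := cutoff.nonneg (x := ((k : ℝ) + 1)⁻¹ * y)
    have h3 := cutoff.le_one (x := ((k : ℝ) + 1)⁻¹ * y)
    exact mul_le_of_le_one_right (sq_nonneg _) (pow_le_one₀ (by linarith) (by linarith))
  · rw [show (0 : ENNReal) = ENNReal.ofReal (Real.exp (α * y) * (V y - V y * 1) ^ 2) by simp]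
    refine ENNReal.tendsto_ofReal (Tendsto.const_mul _ (Tendsto.pow ?_ 2))
    exact tendsto_const_nhds.sub ((tendsto_cutoff y).const_mul _)

/-- The derivative of the cutoff contributes `V` times a factor of size at most `M/(k+1)`. Square
integrability of `V` in the same weight dominates it. -/
lemma tendsto_lintegral_deriv_truncate
    (h2 : Integrable fun y => Real.exp (α * y) * deriv V y ^ 2) :
    Tendsto (fun k => ∫⁻ y, ENNReal.ofReal
      (Real.exp (α * y) * (deriv V y - deriv (truncate V k) y) ^ 2)) atTop (𝓝 0) := by
  obtain ⟨M, hM0, hM⟩ := exists_abs_deriv_cutoff_le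
  have hVd : Differentiable ℝ V := hV.differentiable (by simp)
  have hdc : Continuous (deriv V) := hV.continuous_deriv (by simp)
  have hc : ∀ k, Continuous (deriv (truncate V k)) := fun k =>
    (contDiff_truncate hV k).continuous_deriv (by simp)
  rw [← lintegral_zero (μ := (volume : Measure ℝ))]
  refine tendsto_lintegral_of_dominated_convergence
    (fun y => ENNReal.ofReal (2 * (Real.exp (α * y) * deriv V y ^ 2) +
      2 * M ^ 2 * (Real.exp (α * y) * V y ^ 2)))
    (fun k => by have := hc k; fun_prop) (fun k => ae_of_all _ fun y => ?_)
    ((h2.const_mul 2).add (h1.const_mul (2 * M ^ 2))).lintegral_lt_top.ne (ae_of_all _ fun y => ?_)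
  · refine ENNReal.ofReal_le_ofReal ?_
    rw [deriv_truncate hVd]
    set c := cutoff (((k : ℝ) + 1)⁻¹ * y)
    set c' := ((k : ℝ) + 1)⁻¹ * deriv cutoff (((k : ℝ) + 1)⁻¹ * y) with hc'
    have h3 : 0 ≤ c := cutoff.nonneg
    have h4 : c ≤ 1 := cutoff.le_one
    have h5 : |c'| ≤ M := by
      rw [hc', abs_mul, abs_of_pos (by positivity)]
      refine (mul_le_of_le_one_left (abs_nonneg _) ?_).trans (hM _)
      exact inv_le_one_of_one_le₀ (by linarith [k.cast_nonneg (α := ℝ)])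
    have h6 : c' ^ 2 ≤ M ^ 2 := sq_le_sq.2 (h5.trans (le_abs_self M))
    have h7 : (1 - c) ^ 2 ≤ 1 := pow_le_one₀ (by linarith) (by linarith)
    have h8 : (deriv V y - (deriv V y * c + V y * c')) ^ 2 ≤
        2 * deriv V y ^ 2 + 2 * M ^ 2 * V y ^ 2 := by
      have h9 := mul_le_mul_of_nonneg_left h7 (sq_nonneg (deriv V y))
      have h10 := mul_le_mul_of_nonneg_left h6 (sq_nonneg (V y))
      have h11 := sq_nonneg (deriv V y * (1 - c) + V y * c')
      nlinarith
    have := mul_le_mul_of_nonneg_left h8 (Real.exp_pos (α * y)).le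
    linarith
  · rw [show (0 : ENNReal) = ENNReal.ofReal (Real.exp (α * y) *
      (deriv V y - (deriv V y * 1 + V y * (0 * deriv cutoff 0))) ^ 2) by simp]
    refine ENNReal.tendsto_ofReal (Tendsto.const_mul _ (Tendsto.pow ?_ 2))
    simp only [deriv_truncate hVd]
    have hcc : Continuous (deriv cutoff) := (cutoff.contDiff (n := 1)).continuous_deriv le_rfl
    have h3 : Tendsto (fun k : ℕ => ((k : ℝ) + 1)⁻¹) atTop (𝓝 0) := by
      simpa using tendsto_inv_mul_atTop_zero 1
    exact tendsto_const_nhds.sub (((tendsto_cutoff y).const_mul _).add (Tendsto.const_mul _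
      (h3.mul ((hcc.tendsto 0).comp (tendsto_inv_mul_atTop_zero y)))))

end truncation

/-- A radial function with a smooth profile of finite weighted norm is an element of the completion
of the test functions. -/
theorem memW_of_profile {n : ℕ} (hn : 0 < n) {s : ℝ} (hs : s ∈ Ioo (-1 : ℝ) 1) {V : ℝ → ℝ}
    (hV : ContDiff ℝ ((⊤ : ℕ∞) : WithTop ℕ∞) V)
    (h1 : Integrable fun y => Real.exp (((n : ℝ) - 1 + s) * y) * V y ^ 2)
    (h2 : Integrable fun y => Real.exp (((n : ℝ) - 1 + s) * y) * deriv V y ^ 2)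
    {u : Sp n × ℝ → ℝ} (hu : ∀ p, p ≠ 0 → u p = V (Real.log (euclLen p))) :
    MemW s u (gradX u) (gradT u) (fun x => u (x, 0)) := by
  have hA := halfSphereArea_pos n hs.1
  have hω := sphereArea_pos hn
  have hVd : Differentiable ℝ V := hV.differentiable (by simp)
  have hVm : Measurable V := hV.continuous.measurable
  have hdm : Measurable (deriv V) := measurable_deriv V
  have hm := measurable_log_euclLen (n := n)
  have hem := measurable_euclLen (n := n)
  have huu : ∀ p ∈ upperHalf n, u p = V (Real.log (euclLen p)) := fun p hp =>
    hu p (ne_zero_of_mem_upperHalf hp)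
  have hmem := ae_restrict_mem (μ := volume) (measurableSet_upperHalf n)
  have : Nonempty (Fin n) := ⟨⟨0, hn⟩⟩
  have hne : ∀ᵐ x : Sp n, x ≠ 0 := by simp [ae_iff, measure_singleton]
  have hf : ∀ x : Sp n, x ≠ 0 → u (x, 0) = V (Real.log ‖x‖) := fun x hx => by
    rw [hu _ (fun h => hx (congrArg Prod.fst h)), euclLen_zero_right]
  set φ : ℕ → Sp n × ℝ → ℝ := fun k p => if p = 0 then 0 else truncate V k (Real.log (euclLen p))
    with hφ
  have hφ0 : ∀ k p, p ≠ 0 → φ k p = truncate V k (Real.log (euclLen p)) := fun k p hp => if_neg hp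
  have hφu : ∀ k, ∀ p ∈ upperHalf n, φ k p = truncate V k (Real.log (euclLen p)) := fun k p hp =>
    hφ0 k p (ne_zero_of_mem_upperHalf hp)
  have htd : ∀ k, ContDiff ℝ ((⊤ : ℕ∞) : WithTop ℕ∞) (truncate V k) := contDiff_truncate hV
  have htm : ∀ k, Measurable (truncate V k) := fun k => (htd k).continuous.measurable
  have hdtm : ∀ k, Measurable (deriv (truncate V k)) := fun k => measurable_deriv _
  have hlim0 := tendsto_lintegral_truncate hV h1
  have hlim1 := tendsto_lintegral_deriv_truncate hV h1 h2
  have hscale : ∀ (c : ℝ) (F : ℕ → ℝ → ℝ), 0 ≤ c →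
      Tendsto (fun k => ∫⁻ y, ENNReal.ofReal (F k y)) atTop (𝓝 0) →
      Tendsto (fun k => ∫⁻ y, ENNReal.ofReal (c * F k y)) atTop (𝓝 0) := by
    intro c F hc hF
    simp only [ENNReal.ofReal_mul hc, lintegral_const_mul' _ _ ENNReal.ofReal_ne_top]
    simpa using ENNReal.Tendsto.const_mul hF (Or.inr ENNReal.ofReal_ne_top)
  have hexp : ∀ y, Real.exp (((n : ℝ) + 1 + s) * y) * Real.exp (-2 * y) =
      Real.exp (((n : ℝ) - 1 + s) * y) := fun y => by rw [← Real.exp_add]; congr 1; ring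
  have hexp' : ∀ y, Real.exp ((n : ℝ) * y) * Real.exp (-((1 - s) * y)) =
      Real.exp (((n : ℝ) - 1 + s) * y) := fun y => by rw [← Real.exp_add]; congr 1; ring
  refine ⟨?_, ?_, ?_, ?_, φ, fun k => isTest_radial (htd k) (fun y hy => truncate_eq_zero V hy)
    (if_pos rfl) (hφ0 k), ?_, fun K hK => ?_, fun K hK => ?_⟩
  · exact (hVm.comp hm).aestronglyMeasurable.congr (hmem.mono fun p hp => (huu p hp).symm)
  · refine AEStronglyMeasurable.congr (f := fun p : Sp n × ℝ =>
      (deriv V (Real.log (euclLen p)) * (euclLen p ^ 2)⁻¹) • p.1) ?_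
      (hmem.mono fun p hp => (gradX_radial hVd huu hp).symm)
    exact Measurable.aestronglyMeasurable (by fun_prop)
  · refine AEStronglyMeasurable.congr (f := fun p : Sp n × ℝ =>
      deriv V (Real.log (euclLen p)) * (euclLen p ^ 2)⁻¹ * p.2) ?_
      (hmem.mono fun p hp => (gradT_radial hVd huu hp).symm)
    exact Measurable.aestronglyMeasurable (by fun_prop)
  · refine AEStronglyMeasurable.congr (f := fun x : Sp n => V (Real.log ‖x‖)) ?_
      (hne.mono fun x hx => (hf x hx).symm)
    exact Measurable.aestronglyMeasurable (by fun_prop)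
  · have e : ∀ k, ∫⁻ p in upperHalf n, ENNReal.ofReal ((‖gradX u p - gradX (φ k) p‖ ^ 2 +
        (gradT u p - gradT (φ k) p) ^ 2) * p.2 ^ s) =
        ∫⁻ y, ENNReal.ofReal (halfSphereArea n s * (Real.exp (((n : ℝ) - 1 + s) * y) *
          (deriv V y - deriv (truncate V k) y) ^ 2)) := by
      intro k
      have := hdtm k
      rw [setLIntegral_congr_fun (g := fun p => ENNReal.ofReal
        ((fun y => (deriv V y - deriv (truncate V k) y) ^ 2 * Real.exp (-2 * y))
          (Real.log (euclLen p)) * p.2 ^ s)) (measurableSet_upperHalf n),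
        lintegral_comp_log_euclLen n hs.1
          (H := fun y => (deriv V y - deriv (truncate V k) y) ^ 2 * Real.exp (-2 * y))
          (by fun_prop) (fun y => by positivity)]
      · refine lintegral_congr fun y => ?_
        rw [mul_comm (_ ^ 2), ← mul_assoc (Real.exp _), hexp]
      · intro p hp
        have htk := (htd k).differentiable (by simp)
        simp only
        rw [gradX_radial hVd huu hp, gradT_radial hVd huu hp, gradX_radial htk (hφu k) hp,
          gradT_radial htk (hφu k) hp, ← sub_smul, ← sub_mul, ← sub_mul, ← sub_mul,
          norm_sq_add_sq_radial hp]
    simp only [e]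
    exact hscale _ _ hA.le hlim1
  -- On `K` one has `1 ≤ R²/r²`. The extra `r⁻²` lowers the polar weight `e^{(n+1+s)y}` to
  -- `e^{(n-1+s)y}`, for which convergence is known.
  · obtain ⟨R, hR⟩ := (hK.image continuous_euclLen).bddAbove
    have hR' : ∀ p ∈ K, euclLen p ≤ R := fun p hp => hR (mem_image_of_mem _ hp)
    refine tendsto_of_tendsto_of_tendsto_of_le_of_le tendsto_const_nhds
      (hscale (halfSphereArea n s * R ^ 2) _ (by positivity) hlim0) (fun k => zero_le)
      fun k => ?_
    have := htm k
    have h3 := lintegral_comp_log_euclLen n hs.1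
      (H := fun y => R ^ 2 * ((V y - truncate V k y) ^ 2 * Real.exp (-2 * y)))
      (by fun_prop) (fun y => by positivity)
    have h4 : ∀ y, halfSphereArea n s * (Real.exp (((n : ℝ) + 1 + s) * y) *
        (R ^ 2 * ((V y - truncate V k y) ^ 2 * Real.exp (-2 * y)))) = halfSphereArea n s * R ^ 2 *
        (Real.exp (((n : ℝ) - 1 + s) * y) * (V y - truncate V k y) ^ 2) := fun y => by
      rw [← hexp]; ring
    simp only [h4] at h3
    beta_reduce
    rw [← h3]
    refine le_trans ?_ (lintegral_mono_set (inter_subset_left (t := K)))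
    refine setLIntegral_mono' ((measurableSet_upperHalf n).inter hK.measurableSet) fun p hp => ?_
    have hp2 : 0 < p.2 := hp.1
    have hpos := euclLen_pos hp.1
    refine ENNReal.ofReal_le_ofReal (mul_le_mul_of_nonneg_right ?_ (by positivity))
    rw [huu p hp.1, hφu k p hp.1, mul_left_comm]
    refine le_mul_of_one_le_right (sq_nonneg _) ?_
    rw [show -2 * Real.log (euclLen p) = -(((2 : ℕ) : ℝ) * Real.log (euclLen p)) by
      push_cast; ring, Real.exp_neg, Real.exp_nat_mul, Real.exp_log hpos, ← div_eq_mul_inv,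
      one_le_div (by positivity)]
    exact pow_le_pow_left₀ hpos.le (hR' p hp.2) 2
  -- For the trace the factor `(R/|x|)^{1-s} ≥ 1` plays the same role, lowering `e^{ny}` to
  -- `e^{(n-1+s)y}`.
  · obtain ⟨R, hR⟩ := (hK.image continuous_norm).bddAbove
    have hR' : ∀ x ∈ K, ‖x‖ ≤ R := fun x hx => hR (mem_image_of_mem _ hx)
    have h1s : 0 < 1 - s := by linarith [hs.2]
    refine tendsto_of_tendsto_of_tendsto_of_le_of_le tendsto_const_nhds
      (hscale (sphereArea n * |R| ^ (1 - s)) _ (by positivity) hlim0) (fun k => zero_le)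
      fun k => ?_
    have := htm k
    have h3 := lintegral_comp_log_norm hn
      (H := fun y => |R| ^ (1 - s) * ((V y - truncate V k y) ^ 2 * Real.exp (-((1 - s) * y))))
      (by fun_prop)
    have h4 : ∀ y, sphereArea n * (Real.exp ((n : ℝ) * y) *
        (|R| ^ (1 - s) * ((V y - truncate V k y) ^ 2 * Real.exp (-((1 - s) * y))))) =
        sphereArea n * |R| ^ (1 - s) *
        (Real.exp (((n : ℝ) - 1 + s) * y) * (V y - truncate V k y) ^ 2) := fun y => by
      rw [← hexp']; ring
    simp only [h4] at h3
    beta_reduce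
    rw [← h3]
    refine le_trans ?_ (setLIntegral_le_lintegral K _)
    refine setLIntegral_mono_ae' hK.measurableSet (hne.mono fun x hx hxK => ?_)
    have hpos := norm_pos_iff.2 hx
    refine ENNReal.ofReal_le_ofReal ?_
    rw [hf x hx, hφ0 k _ (fun h => hx (congrArg Prod.fst h)), euclLen_zero_right, mul_left_comm]
    refine le_mul_of_one_le_right (sq_nonneg _) ?_
    rw [Real.exp_neg, mul_comm (1 - s), Real.exp_mul, Real.exp_log hpos, ← div_eq_mul_inv,
      one_le_div (by positivity)]
    exact Real.rpow_le_rpow hpos.le ((hR' x hxK).trans (le_abs_self R)) h1s.le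

lemma isRadial_of_profile {n : ℕ} {V : ℝ → ℝ} (hV : Continuous V) {u : Sp n × ℝ → ℝ}
    (hu : ∀ p, p ≠ 0 → u p = V (Real.log (euclLen p))) : IsRadial u := by
  have hVm := hV.measurable
  refine ⟨fun r => V (Real.log r), by fun_prop, ?_⟩
  filter_upwards [ae_restrict_mem (measurableSet_upperHalf n)] with p hp
  exact hu p (ne_zero_of_mem_upperHalf hp)

/-! ### The extremals of the logarithmic Sobolev inequality -/

/-- The profile of the extremals of the logarithmic Sobolev trace inequality. -/
noncomputable def sobolevProfile (K L q y : ℝ) : ℝ := K * Real.exp (-(L * Real.exp (q * y)) / 2)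

lemma sobolevProfile_sq (K L q y : ℝ) :
    sobolevProfile K L q y ^ 2 = K ^ 2 * Real.exp (-(L * Real.exp (q * y))) := by
  rw [sobolevProfile, mul_pow, ← Real.exp_nat_mul]; congr 2; push_cast; ring

lemma contDiff_sobolevProfile (K L q : ℝ) (m : WithTop ℕ∞) :
    ContDiff ℝ m (sobolevProfile K L q) := by
  unfold sobolevProfile; fun_prop

lemma deriv_sobolevProfile (K L q y : ℝ) : deriv (sobolevProfile K L q) y =
    -(L * q / 2) * Real.exp (q * y) * sobolevProfile K L q y := by
  have h1 : HasDerivAt (fun y : ℝ => q * y) q y := by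
    simpa using (hasDerivAt_id y).const_mul q
  have h2 := ((((h1.exp.const_mul L).fun_neg).div_const 2).exp).const_mul K
  refine h2.deriv.trans ?_
  unfold sobolevProfile; ring

theorem isLogSobolevExtremal_extremalLS {n : ℕ} (hn : 2 ≤ n) {s : ℝ} (hs : s ∈ Ioo (-1 : ℝ) 1)
    {l : ℝ} (hl : 0 < l) : IsLogSobolevExtremal n s (constLS n s) (extremalLS n s l) ∧
      0 < energy s (gradX (extremalLS n s l)) (gradT (extremalLS n s l)) := by
  have hn0 : 0 < n := by lia
  have hn' : (2 : ℝ) ≤ n := by exact_mod_cast hn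
  have hω := sphereArea_pos hn0
  set ω := sphereArea n with hωdef
  set q := 1 - s with hq
  have hq0 : 0 < q := by rw [hq]; linarith [hs.2]
  have hqn : 0 < (n : ℝ) - q := by rw [hq]; linarith [hs.1]
  have hG := Real.Gamma_pos_of_pos (show 0 < (n : ℝ) / q by positivity)
  set c := q / (Real.Gamma ((n : ℝ) / q) * ω) with hc
  have hc0 : 0 < c := by positivity
  set L := l ^ q with hL
  have hL0 : 0 < L := by positivity
  set K := l ^ ((n : ℝ) / 2) * √c with hK
  have hK2 : K ^ 2 = l ^ (n : ℝ) * c := by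
    rw [hK, mul_pow, Real.sq_sqrt hc0.le, ← Real.rpow_natCast, ← Real.rpow_mul hl.le]
    congr 2; push_cast; ring
  have hK0 : 0 < K ^ 2 := by rw [hK2]; positivity
  have hu : ∀ p : Sp n × ℝ, p ≠ 0 → extremalLS n s l p =
      sobolevProfile K L q (Real.log (euclLen p)) := by
    intro p hp
    have hr := euclLen_pos_of_ne hp
    rw [extremalLS, sobolevProfile, ← hq, Real.mul_rpow hl.le hr.le, mul_comm q, Real.exp_mul,
      Real.exp_log hr, neg_div]
  have hint : ∀ N : ℝ, 0 < N → Integrable fun y =>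
      Real.exp (N * y) * Real.exp (-(L * Real.exp (q * y))) :=
    fun N hN => integrable_exp_mul_exp_neg hN hq0 hL0
  have hLn : L ^ (-((n : ℝ) / q)) = (l ^ (n : ℝ))⁻¹ := by
    rw [hL, ← Real.rpow_mul hl.le, ← Real.rpow_neg hl.le]; congr 1; field_simp
  have hI0 : ω * (K ^ 2 * ∫ y, Real.exp ((n : ℝ) * y) * Real.exp (-(L * Real.exp (q * y)))) = 1 := by
    rw [integral_exp_mul_exp_neg (by positivity) hq0 hL0, hLn, hK2, hc]
    have := Real.rpow_pos_of_pos hl n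
    field_simp
  -- Raising the exponent by `q` replaces `Γ(n/q)` by `Γ(n/q + 1) = (n/q) Γ(n/q)`. This moment gives
  -- both the energy and the nonconstant part of the entropy.
  have hI1 : ω * (K ^ 2 * (L * ∫ y, Real.exp (((n : ℝ) + q) * y) *
      Real.exp (-(L * Real.exp (q * y))))) = n / q := by
    rw [integral_exp_mul_exp_neg (by positivity) hq0 hL0,
      show -(((n : ℝ) + q) / q) = -((n : ℝ) / q) - 1 by field_simp; ring,
      show ((n : ℝ) + q) / q = (n : ℝ) / q + 1 by field_simp,
      Real.Gamma_add_one (by positivity), Real.rpow_sub_one hL0.ne', hLn, hK2, hc]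
    have := Real.rpow_pos_of_pos hl n
    field_simp
  have hVc := contDiff_sobolevProfile K L q ((⊤ : ℕ∞) : WithTop ℕ∞)
  have hVm := hVc.continuous.measurable
  have hden : ∀ y, Real.exp (((n : ℝ) - 1 + s) * y) * deriv (sobolevProfile K L q) y ^ 2 =
      K ^ 2 * L ^ 2 * q ^ 2 / 4 * (Real.exp (((n : ℝ) + q) * y) *
        Real.exp (-(L * Real.exp (q * y)))) := fun y => by
    have e : Real.exp (((n : ℝ) + q) * y) = Real.exp (((n : ℝ) - 1 + s) * y) *
        Real.exp (q * y) ^ 2 := by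
      rw [← Real.exp_nat_mul, ← Real.exp_add]; congr 1; rw [hq]; push_cast; ring
    rw [deriv_sobolevProfile, mul_pow, sobolevProfile_sq, e]; ring
  have h1 : Integrable fun y => Real.exp (((n : ℝ) - 1 + s) * y) * sobolevProfile K L q y ^ 2 := by
    refine ((hint ((n : ℝ) - 1 + s) (by linarith)).const_mul (K ^ 2)).congr
      (ae_of_all _ fun y => ?_)
    simp only [sobolevProfile_sq]
    ring
  have h2 : Integrable fun y => Real.exp (((n : ℝ) - 1 + s) * y) *
      deriv (sobolevProfile K L q) y ^ 2 := by
    simp only [hden]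
    exact (hint _ (by positivity)).const_mul _
  have hne : ∀ᵐ x : Sp n, x ≠ 0 := by
    have : Nonempty (Fin n) := ⟨⟨0, hn0⟩⟩
    simp [ae_iff, measure_singleton]
  have hf : ∀ᵐ x : Sp n, extremalLS n s l (x, 0) = sobolevProfile K L q (Real.log ‖x‖) :=
    hne.mono fun x hx => by
      rw [hu _ (fun h => hx (congrArg Prod.fst h)), euclLen_zero_right]
  set E : ℝ → ℝ := fun y => sobolevProfile K L q y ^ 2 * Real.log (sobolevProfile K L q y ^ 2)
    with hE
  have hEm : Measurable E := by fun_prop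
  have hent : entropyLS (fun x : Sp n => extremalLS n s l (x, 0)) =ᵐ[volume]
      fun x => E (Real.log ‖x‖) := hf.mono fun x hx => by simp only [entropyLS, hx, hE]
  have hEe : ∀ y, E y * Real.exp (n * y) =
      Real.log (K ^ 2) * (K ^ 2 * (Real.exp ((n : ℝ) * y) * Real.exp (-(L * Real.exp (q * y))))) -
      K ^ 2 * (L * (Real.exp (((n : ℝ) + q) * y) * Real.exp (-(L * Real.exp (q * y))))) := fun y => by
    simp only [hE]
    rw [sobolevProfile_sq, Real.log_mul hK0.ne' (Real.exp_pos _).ne', Real.log_exp, add_mul,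
      Real.exp_add]
    ring
  have hi1 := ((hint n (by positivity)).const_mul (K ^ 2)).const_mul (Real.log (K ^ 2))
  have hi2 := ((hint ((n : ℝ) + q) (by positivity)).const_mul L).const_mul (K ^ 2)
  have hD : ∫ y, Real.exp (((n : ℝ) - 1 + s) * y) * deriv (sobolevProfile K L q) y ^ 2 =
      L * q * n / (4 * ω) := by
    simp only [hden]
    rw [integral_const_mul, eq_div_iff (by positivity)]
    rw [eq_div_iff hq0.ne'] at hI1
    linear_combination (L * q) * hI1
  have hEn : energy s (gradX (extremalLS n s l)) (gradT (extremalLS n s l)) =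
      halfSphereArea n s * (L * q * n / (4 * ω)) := by
    rw [energy_radial hs.1 (hVc.differentiable (by simp))
      (fun p hp => hu p (ne_zero_of_mem_upperHalf hp)), hD]
  have hA := halfSphereArea_pos n hs.1
  refine ⟨⟨memW_of_profile hn0 hs hVc h1 h2 hu, isRadial_of_profile hVc.continuous hu, ?_, ?_, ?_⟩,
    by rw [hEn]; positivity⟩
  · rw [integral_congr_ae (hf.mono fun x hx => congrArg (· ^ 2) hx),
      integral_comp_log_norm hn0 (H := fun y => sobolevProfile K L q y ^ 2) (by fun_prop), ← hωdef,
      ← hI0]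
    simp only [sobolevProfile_sq, mul_assoc]
    rw [integral_const_mul]
    simp only [mul_comm]
  · rw [integrable_congr hent, integrable_comp_log_norm hn0 hEm]
    simp only [hEe]
    exact hi1.sub hi2
  · rw [integral_congr_ae hent, integral_comp_log_norm hn0 hEm, hEn,
      log_constLS_mul hs hn0 (by positivity)]
    simp only [hEe]
    rw [integral_sub hi1 hi2, integral_const_mul, integral_const_mul, integral_const_mul,
      integral_const_mul, ← hωdef, ← hq]
    -- The argument of the logarithm reduces to `L = l^q`, so both sides contain `n ln l + ln c -
    -- n/q`.
    have e1 : 4 * ω / (n * q) * (L * q * n / (4 * ω)) = L := by field_simp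
    have e2 : q / Real.Gamma ((n : ℝ) / q) / ω = c := by rw [hc, div_div]
    rw [e1, e2, mul_sub, hI1, mul_left_comm, hI0, hK2, Real.log_mul (by positivity) hc0.ne',
      Real.log_rpow hl, hL, Real.log_rpow hl]
    field_simp
    ring

/-! ### The extremals of the logarithmic Hardy inequality -/

section gaussian

variable {b : ℝ} (hb : 0 < b)
include hb

lemma integral_mul_exp_neg_mul_sq : ∫ z : ℝ, z * Real.exp (-b * z ^ 2) = 0 := by
  have hi := integrable_pow_mul_exp_neg_mul_sq hb 1
  have hi0 := integrable_pow_mul_exp_neg_mul_sq hb 0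
  simp only [pow_one, pow_zero, one_mul] at hi hi0
  have h := integral_eq_zero_of_hasDerivAt_of_integrable
    (f := fun z => Real.exp (-b * z ^ 2)) (f' := fun z => -2 * b * (z * Real.exp (-b * z ^ 2)))
    (fun z => ?_) (hi.const_mul _) hi0
  · rw [integral_const_mul] at h
    exact (mul_eq_zero.1 h).resolve_left (by simp [hb.ne'])
  · have h := (((hasDerivAt_id z).fun_pow 2).const_mul (-b)).exp
    refine h.congr_deriv ?_
    simp only [id]; push_cast; ring

/-- Integrate the derivative of `z e^{-bz²}`. -/
lemma integral_sq_mul_exp_neg_mul_sq :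
    ∫ z : ℝ, z ^ 2 * Real.exp (-b * z ^ 2) = √(Real.pi / b) / (2 * b) := by
  have hi := integrable_pow_mul_exp_neg_mul_sq hb 1
  have hi0 := integrable_pow_mul_exp_neg_mul_sq hb 0
  have hi2 := integrable_pow_mul_exp_neg_mul_sq hb 2
  simp only [pow_one, pow_zero, one_mul] at hi hi0
  have h := integral_eq_zero_of_hasDerivAt_of_integrable
    (f := fun z => z * Real.exp (-b * z ^ 2))
    (f' := fun z => Real.exp (-b * z ^ 2) - 2 * b * (z ^ 2 * Real.exp (-b * z ^ 2)))
    (fun z => ?_) (hi0.sub (hi2.const_mul _)) hi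
  · rw [integral_sub hi0 (hi2.const_mul _), integral_const_mul, integral_gaussian] at h
    rw [eq_div_iff (by positivity)]
    linarith
  · have h := (hasDerivAt_id z).fun_mul (((hasDerivAt_id z).fun_pow 2).const_mul (-b)).exp
    refine h.congr_deriv ?_
    simp only [id]; push_cast; ring

end gaussian

/-- The profile of the extremals of the logarithmic Hardy trace inequality. -/
noncomputable def hardyProfile (K a b m y : ℝ) : ℝ :=
  K * Real.exp (-(a * y)) * Real.exp (-(b * (m + y) ^ 2))

lemma exp_mul_hardyProfile_sq (K a b m y : ℝ) :
    Real.exp (2 * a * y) * hardyProfile K a b m y ^ 2 =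
      K ^ 2 * Real.exp (-(2 * b) * (m + y) ^ 2) := by
  have e : Real.exp (-(2 * b) * (m + y) ^ 2) = Real.exp (2 * a * y) *
      Real.exp (-(a * y)) ^ 2 * Real.exp (-(b * (m + y) ^ 2)) ^ 2 := by
    rw [← Real.exp_nat_mul, ← Real.exp_nat_mul, ← Real.exp_add, ← Real.exp_add]
    congr 1; push_cast; ring
  rw [hardyProfile, e]; ring

lemma contDiff_hardyProfile (K a b l : ℝ) (m : WithTop ℕ∞) :
    ContDiff ℝ m (hardyProfile K a b l) := by
  unfold hardyProfile; fun_prop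

lemma deriv_hardyProfile (K a b m y : ℝ) : deriv (hardyProfile K a b m) y =
    -(a + 2 * b * (m + y)) * hardyProfile K a b m y := by
  have h1 : HasDerivAt (fun y : ℝ => -(a * y)) (-a) y := by
    simpa using ((hasDerivAt_id y).const_mul a).fun_neg
  have h2 : HasDerivAt (fun y : ℝ => -(b * (m + y) ^ 2)) (-(b * (2 * (m + y)))) y := by
    have := ((((hasDerivAt_id y).const_add m).fun_pow 2).const_mul b).fun_neg
    refine this.congr_deriv ?_
    simp
  refine ((h1.exp.const_mul K).fun_mul h2.exp).deriv.trans ?_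
  unfold hardyProfile; ring

theorem isLogHardyExtremal_extremalLH {n : ℕ} (hn : 2 ≤ n) {s : ℝ} (hs : s ∈ Ioo (-1 : ℝ) 1)
    {l : ℝ} (hl : 0 < l) : IsLogHardyExtremal n s (constLH n s) (extremalLH n s l) ∧
      0 < energy s (gradX (extremalLH n s l)) (gradT (extremalLH n s l)) := by
  have hn0 : 0 < n := by lia
  have hn' : (2 : ℝ) ≤ n := by exact_mod_cast hn
  have hω := sphereArea_pos hn0
  set ω := sphereArea n with hωdef
  have h1s : 0 < 1 - s := by linarith [hs.2]
  obtain ⟨a, ha⟩ : ∃ a, a = ((n : ℝ) - 1 + s) / 2 := ⟨_, rfl⟩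
  have ha2 : (n : ℝ) - 1 + s = 2 * a := by rw [ha]; ring
  have ha0 : 0 < a := by rw [ha]; linarith [hs.1]
  obtain ⟨d, hd⟩ : ∃ d, d = 2 * (n : ℝ) / (1 - s) := ⟨_, rfl⟩
  have hd1 : 0 < d - 1 := by
    rw [hd, sub_pos, one_lt_div h1s]; linarith [hs.1]
  have hd0 : 0 < d := by linarith
  -- With this `b` the Gaussian `g² ∝ e^{-2b(m+y)²}` satisfies `∫ g'² = b = a²/(d-1)`, the equality
  -- case in the concavity step of the Hardy inequality.
  obtain ⟨b, hb⟩ : ∃ b, b = a ^ 2 / (d - 1) := ⟨_, rfl⟩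
  have hb0 : 0 < b := by rw [hb]; positivity
  obtain ⟨K, hK⟩ : ∃ K, K = (((n : ℝ) - 1 + s) ^ 2 /
      (2 * Real.pi * (2 * (n : ℝ) / (1 - s) - 1) * ω ^ 2)) ^ (1 / 4 : ℝ) := ⟨_, rfl⟩
  have hpi := Real.pi_pos
  have hK2 : K ^ 2 = √(2 * b / Real.pi) / ω := by
    have e : ((n : ℝ) - 1 + s) ^ 2 / (2 * Real.pi * (2 * (n : ℝ) / (1 - s) - 1) * ω ^ 2) =
        2 * b / Real.pi / ω ^ 2 := by
      rw [ha2, ← hd, hb]; field_simp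
    rw [hK, e, ← Real.rpow_natCast, ← Real.rpow_mul (by positivity),
      show (1 / 4 : ℝ) * ((2 : ℕ) : ℝ) = 1 / 2 by norm_num, ← Real.sqrt_eq_rpow,
      Real.sqrt_div (by positivity), Real.sqrt_sq hω.le]
  have hK0 : 0 < K ^ 2 := by rw [hK2]; positivity
  set m := Real.log l with hm
  have hu : ∀ p : Sp n × ℝ, p ≠ 0 → extremalLH n s l p =
      hardyProfile K a b m (Real.log (euclLen p)) := by
    intro p hp
    have hr := euclLen_pos_of_ne hp
    have e : Real.exp (-(a * Real.log (euclLen p))) = euclLen p ^ (-a) := by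
      rw [← mul_neg, ← neg_mul_comm, mul_comm, Real.exp_mul, Real.exp_log hr]
    have e2 : ((n : ℝ) - 1 + s) ^ 2 / (4 * (2 * (n : ℝ) / (1 - s) - 1)) = b := by
      rw [ha2, ← hd, hb]; field_simp; ring
    rw [extremalLH, hardyProfile, ← hωdef, ← hK, ← ha, e, e2, Real.mul_rpow hl.le hr.le,
      Real.log_mul hl.ne' hr.ne', ← hm, Real.rpow_neg hl.le]
    have := Real.rpow_pos_of_pos hl a
    field_simp
  have hint : ∀ k : ℕ, Integrable fun y => (m + y) ^ k * Real.exp (-(2 * b) * (m + y) ^ 2) :=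
    fun k => (integrable_pow_mul_exp_neg_mul_sq (b := 2 * b) (by positivity) k).comp_add_left m
  have hint0 : Integrable fun y => Real.exp (-(2 * b) * (m + y) ^ 2) := by simpa using hint 0
  have hint1 : Integrable fun y => (m + y) * Real.exp (-(2 * b) * (m + y) ^ 2) := by
    simpa using hint 1
  have hint2 := hint 2
  have hJ0 : ω * (K ^ 2 * ∫ y, Real.exp (-(2 * b) * (m + y) ^ 2)) = 1 := by
    rw [integral_add_left_eq_self (fun y => Real.exp (-(2 * b) * y ^ 2)) m, integral_gaussian, hK2,
      div_mul_eq_mul_div, mul_div_cancel₀ _ hω.ne', ← Real.sqrt_mul (by positivity),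
      show 2 * b / Real.pi * (Real.pi / (2 * b)) = 1 by field_simp, Real.sqrt_one]
  have hJ1 : ∫ y, (m + y) * Real.exp (-(2 * b) * (m + y) ^ 2) = 0 := by
    rw [integral_add_left_eq_self (fun y => y * Real.exp (-(2 * b) * y ^ 2)) m]
    exact integral_mul_exp_neg_mul_sq (by positivity)
  have hJ2 : ω * (K ^ 2 * (4 * b * ∫ y, (m + y) ^ 2 * Real.exp (-(2 * b) * (m + y) ^ 2))) = 1 := by
    rw [← hJ0, integral_add_left_eq_self (fun y => Real.exp (-(2 * b) * y ^ 2)) m,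
      integral_gaussian, integral_add_left_eq_self (fun y => y ^ 2 * Real.exp (-(2 * b) * y ^ 2)) m,
      integral_sq_mul_exp_neg_mul_sq (by positivity)]
    congr 2
    field_simp
    ring
  have hVc := contDiff_hardyProfile K a b m ((⊤ : ℕ∞) : WithTop ℕ∞)
  have hVm := hVc.continuous.measurable
  have hden : ∀ y, Real.exp (((n : ℝ) - 1 + s) * y) * deriv (hardyProfile K a b m) y ^ 2 =
      K ^ 2 * (a ^ 2 * Real.exp (-(2 * b) * (m + y) ^ 2) +
        (4 * a * b * ((m + y) * Real.exp (-(2 * b) * (m + y) ^ 2)) +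
        4 * b ^ 2 * ((m + y) ^ 2 * Real.exp (-(2 * b) * (m + y) ^ 2)))) := fun y => by
    rw [deriv_hardyProfile, mul_pow, mul_left_comm, ha2, exp_mul_hardyProfile_sq]; ring
  have hi12 : Integrable fun y => 4 * a * b * ((m + y) * Real.exp (-(2 * b) * (m + y) ^ 2)) +
      4 * b ^ 2 * ((m + y) ^ 2 * Real.exp (-(2 * b) * (m + y) ^ 2)) := (hint1.const_mul (4 * a * b)).add (hint2.const_mul (4 * b ^ 2))
  have h1 : Integrable fun y => Real.exp (((n : ℝ) - 1 + s) * y) * hardyProfile K a b m y ^ 2 := by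
    simp only [ha2, exp_mul_hardyProfile_sq]
    exact hint0.const_mul _
  have h2 : Integrable fun y => Real.exp (((n : ℝ) - 1 + s) * y) *
      deriv (hardyProfile K a b m) y ^ 2 := by
    simp only [hden]
    exact ((hint0.const_mul (a ^ 2)).add hi12).const_mul _
  have hne : ∀ᵐ x : Sp n, x ≠ 0 := by
    have : Nonempty (Fin n) := ⟨⟨0, hn0⟩⟩
    simp [ae_iff, measure_singleton]
  have hf : ∀ᵐ x : Sp n, extremalLH n s l (x, 0) = hardyProfile K a b m (Real.log ‖x‖) :=
    hne.mono fun x hx => by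
      rw [hu _ (fun h => hx (congrArg Prod.fst h)), euclLen_zero_right]
  have hdens := ae_densityLH hn0 s hf
  have hent := ae_entropyLH hn0 s hf
  have hsq : ∀ y, (Real.exp (a * y) * hardyProfile K a b m y) ^ 2 =
      K ^ 2 * Real.exp (-(2 * b) * (m + y) ^ 2) := fun y => by
    rw [← exp_mul_hardyProfile_sq, mul_pow, ← Real.exp_nat_mul]; congr 2; push_cast; ring
  have hpow : ∀ y, hardyProfile K a b m y ^ 2 / Real.exp ((1 - s) * y) * Real.exp (n * y) =
      K ^ 2 * Real.exp (-(2 * b) * (m + y) ^ 2) := fun y => by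
    rw [sq_div_exp_mul_exp, ← ha, hsq]
  have hlog : ∀ y, hardyProfile K a b m y ^ 2 / Real.exp ((1 - s) * y) *
      Real.log ((Real.exp (((n : ℝ) - 1 + s) / 2 * y) * hardyProfile K a b m y) ^ 2) *
      Real.exp (n * y) = Real.log (K ^ 2) * (K ^ 2 * Real.exp (-(2 * b) * (m + y) ^ 2)) -
      K ^ 2 * (2 * b * ((m + y) ^ 2 * Real.exp (-(2 * b) * (m + y) ^ 2))) := fun y => by
    rw [mul_right_comm, hpow, ← ha, hsq, Real.log_mul hK0.ne' (Real.exp_pos _).ne', Real.log_exp]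
    ring
  have hi1 := (hint0.const_mul (K ^ 2)).const_mul (Real.log (K ^ 2))
  have hi2 := (hint2.const_mul (2 * b)).const_mul (K ^ 2)
  have hEm : Measurable fun y => hardyProfile K a b m y ^ 2 / Real.exp ((1 - s) * y) *
      Real.log ((Real.exp (((n : ℝ) - 1 + s) / 2 * y) * hardyProfile K a b m y) ^ 2) := by fun_prop
  have hD : ∫ y, Real.exp (((n : ℝ) - 1 + s) * y) * deriv (hardyProfile K a b m) y ^ 2 =
      (a ^ 2 + b) / ω := by
    simp only [hden]
    rw [integral_const_mul, integral_add (hint0.const_mul _) hi12,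
      integral_add (hint1.const_mul _) (hint2.const_mul _), integral_const_mul,
      integral_const_mul, integral_const_mul, hJ1, eq_div_iff hω.ne']
    linear_combination a ^ 2 * hJ0 + b * hJ2
  have hEn : energy s (gradX (extremalLH n s l)) (gradT (extremalLH n s l)) =
      halfSphereArea n s * ((a ^ 2 + b) / ω) := by
    rw [energy_radial hs.1 (hVc.differentiable (by simp))
      (fun p hp => hu p (ne_zero_of_mem_upperHalf hp)), hD]
  have hA := halfSphereArea_pos n hs.1
  refine ⟨⟨memW_of_profile hn0 hs hVc h1 h2 hu, isRadial_of_profile hVc.continuous hu, ?_, ?_, ?_⟩,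
    by rw [hEn]; positivity⟩
  · rw [integral_congr_ae hdens, integral_comp_log_norm hn0
      (H := fun y => hardyProfile K a b m y ^ 2 / Real.exp ((1 - s) * y)) (by fun_prop)]
    simp only [hpow]
    rw [integral_const_mul]
    exact hJ0
  · rw [integrable_congr hent, integrable_comp_log_norm hn0 hEm]
    simp only [hlog]
    exact hi1.sub hi2
  · rw [integral_congr_ae hent, integral_comp_log_norm hn0 hEm, hEn,
      log_constLH_mul hs hn (by positivity)]
    simp only [hlog]
    rw [integral_sub hi1 hi2, integral_const_mul, integral_const_mul, integral_const_mul,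
      integral_const_mul, ← hωdef, ← hd, ← ha]
    -- The two points in the concavity inequality coincide, so the two logarithms in the bound
    -- merge.
    have e1 : ω * ((a ^ 2 + b) / ω) = d * a ^ 2 / (d - 1) := by rw [hb]; field_simp; ring
    have e2 : ω * (Real.log (K ^ 2) * (K ^ 2 * ∫ y, Real.exp (-(2 * b) * (m + y) ^ 2)) -
        K ^ 2 * (2 * b * ∫ y, (m + y) ^ 2 * Real.exp (-(2 * b) * (m + y) ^ 2))) =
        Real.log (K ^ 2) - 1 / 2 := by
      linear_combination Real.log (K ^ 2) * hJ0 - 1 / 2 * hJ2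
    rw [e1, e2, hK2, Real.log_div (by positivity) hω.ne', Real.log_sqrt (by positivity), hb,
      Real.log_div (by positivity) hpi.ne', Real.log_mul two_ne_zero (by positivity),
      Real.log_div (by positivity) hd1.ne', Real.log_div (by positivity) hd1.ne',
      Real.log_mul hd0.ne' (by positivity), Real.log_div two_ne_zero hpi.ne']
    ring

/-! ### Optimality -/

lemma le_of_mul_log_mul_le {k C C' E : ℝ} (hk : 0 < k) (hC : 0 < C) (hC' : 0 < C') (hE : 0 < E)
    (h : k * Real.log (C * E) ≤ k * Real.log (C' * E)) : C ≤ C' := by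
  have h1 := le_of_mul_le_mul_left h hk
  rw [Real.log_le_log_iff (by positivity) (by positivity)] at h1
  exact le_of_mul_le_mul_right h1 hE

/-- Any admissible constant is tested on the extremal with scale `1`, whose energy is positive and
whose entropy is integrable. Equality there forces the constant to be at least `constLS n s`. -/
theorem isLeast_constLS {n : ℕ} (hn : 2 ≤ n) {s : ℝ} (hs : s ∈ Ioo (-1 : ℝ) 1) :
    IsLeast {C : ℝ | 0 < C ∧ RadialLogSobolevTrace n s C} (constLS n s) := by
  have hC0 := constLS_pos hs (show 0 < n by lia)
  refine ⟨⟨hC0, radialLogSobolevTrace_constLS hn hs⟩, fun C hC => ?_⟩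
  obtain ⟨⟨hW, hr, hone, hint, heq⟩, hE⟩ := isLogSobolevExtremal_extremalLS hn hs one_pos
  have hk : 0 < (n : ℝ) / (1 - s) :=
    div_pos (Nat.cast_pos.2 (by lia)) (by linarith [hs.2])
  exact le_of_mul_log_mul_le hk hC0 hC.1 hE (heq.symm.le.trans ((hC.2 _ _ _ _ hW hr hone).2 hint))

theorem isLeast_constLH {n : ℕ} (hn : 2 ≤ n) {s : ℝ} (hs : s ∈ Ioo (-1 : ℝ) 1) :
    IsLeast {C : ℝ | 0 < C ∧ RadialLogHardyTrace n s C} (constLH n s) := by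
  have hC0 := constLH_pos hs hn
  refine ⟨⟨hC0, radialLogHardyTrace_constLH hn hs⟩, fun C hC => ?_⟩
  obtain ⟨⟨hW, hr, hone, hint, heq⟩, hE⟩ := isLogHardyExtremal_extremalLH hn hs one_pos
  have hk : 0 < (n : ℝ) / (1 - s) :=
    div_pos (Nat.cast_pos.2 (by lia)) (by linarith [hs.2])
  exact le_of_mul_log_mul_le hk hC0 hC.1 hE (heq.symm.le.trans ((hC.2 _ _ _ _ hW hr hone).2 hint))

end RadialLogTrace

theorem mainTheorem5 (n : ℕ) (hn : 2 ≤ n) (s : ℝ) (hs : s ∈ Set.Ioo (-1 : ℝ) 1) :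
    IsLeast {C : ℝ | 0 < C ∧ RadialLogTrace.RadialLogSobolevTrace n s C}
        (RadialLogTrace.constLS n s) ∧
      IsLeast {C : ℝ | 0 < C ∧ RadialLogTrace.RadialLogHardyTrace n s C}
        (RadialLogTrace.constLH n s) ∧
      ∀ l : ℝ, 0 < l →
        RadialLogTrace.IsLogSobolevExtremal n s (RadialLogTrace.constLS n s)
            (RadialLogTrace.extremalLS n s l) ∧
          RadialLogTrace.IsLogHardyExtremal n s (RadialLogTrace.constLH n s)
            (RadialLogTrace.extremalLH n s l) :=
  ⟨RadialLogTrace.isLeast_constLS hn hs, RadialLogTrace.isLeast_constLH hn hs, fun _ hl =>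
    ⟨(RadialLogTrace.isLogSobolevExtremal_extremalLS hn hs hl).1,
      (RadialLogTrace.isLogHardyExtremal_extremalLH hn hs hl).1⟩⟩
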